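/- **Setting.** Let $\kappa$ be a field, $\overline\kappa$ its algebraic closure, and let $H_r$ denote singular homology with coefficients in $\kappa$; dimensions and numbers of elements are cardinals. For a continuous map $f:X\to Y$ and $U\subseteq Y$ put $X_U=f^{-1}(U)$ and $X_y=f^{-1}(y)$. Say that $f$ is a *fibration near* $y\in Y$ if $y$ has a neighborhood $U$ such that $f:X_U\to U$ and $\mathrm{pr}:X_y\times U\to U$ are fiberwise homotopy equivalent, and a *fibration* if this holds near every $y$. Call $f$ *good* if every $y\in Y$ has arbitrarily small contractible neighborhoods $U$ such that the inclusion $X_y\to X_U$ is a homotopy equivalence. A proper continuous map $f$ is *tame* if it is good and, for some closed discrete $S\subset Y$, the restriction $X\setminus f^{-1}(S)\to Y\setminus S$ is a fibration. The *critical values* of $f$ are the $y$ near which $f$ is not a fibration. **Bar codes and Jordan cells.** Let $g:X\to\mathbb S^1=\mathbb R/2\pi\mathbb Z$ be a map with finitely many critical values, given by the angles $0<s_1<\dots<s_m\le 2\pi$; choose $0<t_1<s_1<t_2<\dots<t_m<s_m$, put $t_{m+1}=t_1+2\pi$, and let $\tilde g:\tilde X\to\mathbb R$ be the pull back of $g$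 along $\mathbb R\to\mathbb S^1$, so that $\tilde X_t= X_\theta$ if $t$ lies over $\theta$. The representation $\rho_r$ of the cyclic quiver $G_{2m}$, with vertices $x_1,\dots,x_{2m}$ and arrows $x_{2i-1}\to x_{2i}\leftarrow x_{2i+1}$ ($x_{2m+1}=x_1$), has the spaces $H_r(X_{t_i})$ at $x_{2i-1}$ and $H_r(X_{s_i})$ at $x_{2i}$, and the maps $H_r(X_{t_i})\to H_r(\tilde X_{[t_i,t_{i+1}]})\cong H_r(X_{s_i})$ and $H_r(X_{t_{i+1}})\to H_r(\tilde X_{[t_i,t_{i+1}]})\cong H_r(X_{s_i})$ induced by inclusions. A *bar code* $B$ is a non-empty interval $\{s,s'\}$ with $s=s_i$, $s'=s_j+2\pi k$, $k\ge0$ an integer, closed or open at either end. It determines the spiral $\tau\mapsto \big(\tfrac{1}{s'-s}\tau+\tfrac{s'-2s}{s'-s}+1\big)(\cos\tau,\sin\tau)$, $\tau\in\{s,s'\}$ (a single point at angle $s$ if $s=s'$). For an angle $\theta$, $n_\theta(B)$ is the number of points of the spiral on the ray from the origin at angle $\theta$, that is, the number of $\tau\in B$ with $\tau\equiv\theta$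 mod $2\pi$. The representation $\rho^I(B)$ has at each vertex the vector space whose basis is the set of points of the spiral on the ray at the angle ($t_i$ or $s_i$) of that vertex, and its maps send a point to the adjacent point of the spiral on the neighboring ray, or to $0$ if there is none. A *Jordan cell* is a pair $(\lambda,k)$ with $\lambda\in\overline\kappa\setminus0$, $k\ge1$; $\rho^J(\lambda,k)$ has $\overline\kappa^{\,k}$ at each vertex, the map $x_1\to x_2$ is the $k\times k$ Jordan matrix with eigenvalue $\lambda$, and all other maps are the identity. Families $\mathcal B_r$ of bar codes and $\mathcal J_r$ of Jordan cells are *the $r$-bar codes and $r$-Jordan cells of $g$* if $\rho_r\cong\bigoplus_{B\in\mathcal B_r}\rho^I(B)\oplus\rho'$ with $\rho'\otimes_\kappa\overline\kappa\cong\bigoplus_{J\in\mathcal J_r}\rho^J(J)$. **Statement.** Let $X$ be a non-empty compact space and $f:X\to\mathbb R$ a tame map, viewed as the circle valued map $f'=2\arctan f+\pi$ mod $2\pi$. Then $f'$ has finitely many critical values and, for each choice of the $t_i$ as above, it has $r$-bar codes $\mathcal B_r$ and $r$-Jordan cells $\mathcal J_r$ for every $r\ge 0$. For any such $\mathcal B_r,\mathcal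 J_r$, one has $\mathcal J_r=\emptyset$ for all $r$ ($f'$ has no Jordan cells), and for every $r\ge0$ and every angle $\theta$ $$\dim H_r(X_\theta)=\sum_{B\in\mathcal B_r}n_\theta(B),\qquad X_\theta=(f')^{-1}(\theta),$$ $$\dim H_r(X)=\sharp\{B\in\mathcal B_r\mid\text{both ends closed}\}+\sharp\{B\in\mathcal B_{r-1}\mid\text{both ends open}\},$$ where $\mathcal B_{-1}=\emptyset$. -/

import Mathlib

universe u v w w'

namespace CircleValued

noncomputable section

open scoped Topology ContinuousMap CategoryTheory

/-! ### Tame maps -/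

section Tame

variable {E E' B X Y : Type*} [TopologicalSpace E] [TopologicalSpace E'] [TopologicalSpace B]
  [TopologicalSpace X] [TopologicalSpace Y]

/-- `p : E → B` and `q : E' → B` are fiberwise homotopy equivalent: there are maps over `B` in both
directions whose composites are homotopic to the identities through maps over `B`. -/
def FiberwiseHomotopyEquivalent (p : E → B) (q : E' → B) : Prop :=
  ∃ (l : C(E, E')) (k : C(E', E)),
    (∀ e, q (l e) = p e) ∧ (∀ e', p (k e') = q e') ∧
    (k.comp l).HomotopicWith (ContinuousMap.id E) (fun h => ∀ e, p (h e) = p e) ∧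
    (l.comp k).HomotopicWith (ContinuousMap.id E') (fun h => ∀ e', q (h e') = q e')

/-- Near `y` the map `f` is fiberwise homotopy equivalent to the projection `X_y × U → U`. -/
def IsFibrationAt (f : X → Y) (y : Y) : Prop :=
  ∃ U ∈ 𝓝 y, FiberwiseHomotopyEquivalent (U.restrictPreimage f)
    (Prod.snd : (f ⁻¹' {y}) × U → U)

/-- Fibrations, in the sense of local fiberwise homotopy triviality. -/
def IsFibration (f : X → Y) : Prop := ∀ y, IsFibrationAt f y

/-- A map is good if every point `y` has (arbitrarily small) contractible neighborhoods `U`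
for which the inclusion `X_y → X_U` is a homotopy equivalence. -/
def IsGood (f : X → Y) : Prop :=
  ∀ y, ∀ W ∈ 𝓝 y, ∃ U ∈ 𝓝 y, U ⊆ W ∧ ContractibleSpace U ∧
    ∃ e : (f ⁻¹' {y}) ≃ₕ (f ⁻¹' U), ∀ x, (e x : X) = x

/-- Tame maps: proper, continuous, good, and a fibration away from a discrete closed set of
values. -/
structure IsTame (f : X → Y) : Prop where
  continuous : Continuous f
  proper : IsProperMap f
  good : IsGood f
  fibration : ∃ S : Set Y, IsClosed S ∧ DiscreteTopology S ∧ IsFibration (Sᶜ.restrictPreimage f)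

/-- The critical values: the points which prevent `f` from being a fibration. -/
def criticalValues (f : X → Y) : Set Y := {y | ¬ IsFibrationAt f y}

/-- The circle valued map `f'` attached to a real valued map `f`, obtained by identifying `ℝ` with
`(0, 2π)` by `t ↦ 2 arctan t + π`. -/
def toCircleValued (f : X → ℝ) : X → Real.Angle :=
  fun x => ((2 * Real.arctan (f x) + Real.pi : ℝ) : Real.Angle)

end Tame

/-! ### Singular homology with coefficients in a field -/

instance hasCoproducts_moduleCat (κ : Type v) [Field κ] :
    CategoryTheory.Limits.HasCoproducts.{u} (ModuleCat.{max u v} κ) := fun J => by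
  have : CategoryTheory.Limits.HasColimitsOfSize.{max u v, max u v} (ModuleCat.{max u v} κ) :=
    inferInstance
  have := CategoryTheory.Limits.hasColimitsOfSizeShrink.{u, u, max u v, max u v}
    (ModuleCat.{max u v} κ)
  infer_instance

/-- The `r`-th singular homology functor with coefficients in the field `κ`. -/
def homology (κ : Type v) [Field κ] (r : ℕ) : TopCat.{u} ⥤ ModuleCat.{max u v} κ :=
  (AlgebraicTopology.singularHomologyFunctor (ModuleCat.{max u v} κ) r).obj
    (ModuleCat.of κ (ULift.{u} κ))

/-! ### Representations of the quiver `G_{2m}` -/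

/-- A representation of the cyclic quiver with vertices `x₁, …, x_{2m}`. For `i : Fin m`, counted
from `0`, `odd i` sits at the vertex `x_{2i+1}`, `even i` at `x_{2i+2}`, and there are arrows
`odd i → even i` and `odd (i + 1) → even i`, with `i + 1` taken cyclically. -/
structure CyclicRep (κ : Type v) [Field κ] (m : ℕ) where
  odd : Fin m → ModuleCat.{w} κ
  even : Fin m → ModuleCat.{w} κ
  α : ∀ i, odd i →ₗ[κ] even i
  β : ∀ i, odd (finRotate m i) →ₗ[κ] even i

namespace CyclicRep

variable {κ : Type v} [Field κ] {m : ℕ}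

/-- Isomorphisms of representations. -/
structure Iso (ρ : CyclicRep.{v, w} κ m) (σ : CyclicRep.{v, w'} κ m) where
  odd : ∀ i, ρ.odd i ≃ₗ[κ] σ.odd i
  even : ∀ i, ρ.even i ≃ₗ[κ] σ.even i
  comm_α : ∀ i x, even i (ρ.α i x) = σ.α i (odd i x)
  comm_β : ∀ i x, even i (ρ.β i x) = σ.β i (odd (finRotate m i) x)

/-- The sum of two representations. -/
def prod (ρ : CyclicRep.{v, w} κ m) (σ : CyclicRep.{v, w'} κ m) :
    CyclicRep.{v, max w w'} κ m where
  odd i := ModuleCat.of κ (ρ.odd i × σ.odd i)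
  even i := ModuleCat.of κ (ρ.even i × σ.even i)
  α i := (ρ.α i).prodMap (σ.α i)
  β i := (ρ.β i).prodMap (σ.β i)

/-- The direct sum of a family of representations. -/
def directSum {ι : Type w'} (ρ : ι → CyclicRep.{v, w} κ m) : CyclicRep.{v, max w w'} κ m where
  odd i := ModuleCat.of κ (Π₀ b, (ρ b).odd i)
  even i := ModuleCat.of κ (Π₀ b, (ρ b).even i)
  α i := DFinsupp.mapRange.linearMap fun b => (ρ b).α i
  β i := DFinsupp.mapRange.linearMap fun b => (ρ b).β i

/-- Extension of scalars to a larger field. -/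
def baseChange (K : Type v) [Field K] [Algebra κ K] (ρ : CyclicRep.{v, w} κ m) :
    CyclicRep.{v, max v w} K m where
  odd i := ModuleCat.of K (TensorProduct κ K (ρ.odd i))
  even i := ModuleCat.of K (TensorProduct κ K (ρ.even i))
  α i := (ρ.α i).baseChange K
  β i := (ρ.β i).baseChange K

end CyclicRep

/-! ### Bar codes and Jordan cells -/

/-- `0 < t₁ < s₁ < t₂ < s₂ < ⋯ < t_m < s_m ≤ 2π`. -/
structure Interlaced {m : ℕ} (s t : Fin m → ℝ) : Prop where
  pos : ∀ i, 0 < t i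
  lt : ∀ i, t i < s i
  lt_next : ∀ i j, i < j → s i < t j
  le : ∀ i, s i ≤ 2 * Real.pi

/-- `1` for the last index and `0` for all others: the number of full turns gained when passing from
the index `i` to the cyclically next one. -/
def carry {m : ℕ} (i : Fin m) : ℤ := if i.val + 1 = m then 1 else 0

/-- The real parameter of the regular angle following `s i`: it is `t (i + 1)`, respectively
`t₁ + 2π` if `i` is the last index. -/
def nextAngle {m : ℕ} (t : Fin m → ℝ) (i : Fin m) : ℝ :=
  t (finRotate m i) + 2 * Real.pi * (carry i : ℤ)

/-- The interval with end points `a`, `b`, the flags telling whether an end point belongs to it. -/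
def flaggedInterval (a b : ℝ) (leftClosed rightClosed : Bool) : Set ℝ :=
  {τ | (a < τ ∨ (leftClosed = true ∧ τ = a)) ∧ (τ < b ∨ (rightClosed = true ∧ τ = b))}

/-- The bar codes over the critical angles `s`: the non-empty intervals `{s_i, s_j + 2πk}`,
`k ≥ 0`, closed or open at either end. -/
structure BarCode {m : ℕ} (s : Fin m → ℝ) where
  left : Fin m
  right : Fin m
  turns : ℕ
  leftClosed : Bool
  rightClosed : Bool
  nonempty : (flaggedInterval (s left) (s right + 2 * Real.pi * turns)
    leftClosed rightClosed).Nonempty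

namespace BarCode

variable {m : ℕ} {s : Fin m → ℝ}

/-- The left end of a bar code. -/
def first (b : BarCode s) : ℝ := s b.left

/-- The right end of a bar code. -/
def last (b : BarCode s) : ℝ := s b.right + 2 * Real.pi * b.turns

/-- The interval of a bar code. -/
def interval (b : BarCode s) : Set ℝ :=
  flaggedInterval b.first b.last b.leftClosed b.rightClosed

/-- Both ends belong to the bar code. -/
def BothClosed (b : BarCode s) : Prop := b.leftClosed = true ∧ b.rightClosed = true

/-- Neither end belongs to the bar code. -/
def BothOpen (b : BarCode s) : Prop := b.leftClosed = false ∧ b.rightClosed = false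

/-- The radius of the spiral of a bar code at the parameter `τ`; it increases from `2` to `3`.
(For a bar code consisting of one point the quotients vanish and the spiral is one point.) -/
def radius (b : BarCode s) (τ : ℝ) : ℝ :=
  1 / (b.last - b.first) * τ + (b.last - 2 * b.first) / (b.last - b.first) + 1

/-- The spiral in the plane of a bar code. -/
def spiral (b : BarCode s) : Set (ℝ × ℝ) :=
  (fun τ => (b.radius τ * Real.cos τ, b.radius τ * Real.sin τ)) '' b.interval

end BarCode

/-- The ray from the origin at the angle `θ`. -/
def ray (θ : Real.Angle) : Set (ℝ × ℝ) :=
  {z | ∃ c : ℝ, 0 ≤ c ∧ z = (c * θ.cos, c * θ.sin)}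

/-- `n_θ(B)`: the number of points in which the spiral of `B` meets the ray at the angle `θ`. -/
def BarCode.count {m : ℕ} {s : Fin m → ℝ} (b : BarCode s) (θ : Real.Angle) : Cardinal.{0} :=
  Cardinal.mk ↥(b.spiral ∩ ray θ)

section Indecomposable

variable (κ : Type v) [Field κ]

/-- The vector space with one basis vector for each integer `n` with `a + 2πn ∈ I`. If `I` is the
interval of a bar code, these are the points of the spiral on the ray at the angle `a`. -/
abbrev PointSpace (I : Set ℝ) (a : ℝ) : Type v :=
  {n : ℤ // a + 2 * Real.pi * n ∈ I} →₀ κ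

open Classical in
/-- The basis vector at the parameter `a + 2πn` is sent to the one at the parameter
`b + 2π(n - c)` if this is in `I`, and to zero otherwise. -/
def pointMap (I : Set ℝ) (a b : ℝ) (c : ℤ) : PointSpace κ I a →ₗ[κ] PointSpace κ I b :=
  Finsupp.linearCombination κ fun n =>
    if h : b + 2 * Real.pi * ((n.1 - c : ℤ) : ℝ) ∈ I then Finsupp.single ⟨n.1 - c, h⟩ 1 else 0

/-- The representation of a bar code: a point of the spiral on an odd ray is sent to the adjacent
point of the spiral on the neighboring even ray, or to zero if the spiral ends before. -/
def BarCode.rep {m : ℕ} {s : Fin m → ℝ} (t : Fin m → ℝ) (b : BarCode s) :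
    CyclicRep.{v, v} κ m where
  odd i := ModuleCat.of κ (PointSpace κ b.interval (t i))
  even i := ModuleCat.of κ (PointSpace κ b.interval (s i))
  α i := pointMap κ b.interval (t i) (s i) 0
  β i := pointMap κ b.interval (t (finRotate m i)) (s i) (carry i)

/-- A Jordan cell `(λ, k)` with `λ ≠ 0` and `k > 0`. -/
structure JordanCell where
  eigenvalue : κ
  size : ℕ
  eigenvalue_ne_zero : eigenvalue ≠ 0
  size_pos : 0 < size

variable {κ}

/-- The matrix with `λ` on the diagonal and `1` just above it. -/
def JordanCell.matrix (J : JordanCell κ) : Matrix (Fin J.size) (Fin J.size) κ :=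
  fun i j => if i = j then J.eigenvalue else if i.val + 1 = j.val then 1 else 0

/-- The representation of a Jordan cell: `κ^k` at each vertex, the first `α` is the Jordan matrix
and all other maps are the identity. -/
def JordanCell.rep (m : ℕ) (J : JordanCell κ) : CyclicRep.{v, v} κ m where
  odd _ := ModuleCat.of κ (Fin J.size → κ)
  even _ := ModuleCat.of κ (Fin J.size → κ)
  α i := if i.val = 0 then J.matrix.mulVecLin else LinearMap.id
  β _ := LinearMap.id

/-- The family `B` of bar codes and the family `J` of Jordan cells over the algebraic closure are
the bar codes and the Jordan cells of `ρ`: it is the sum of the representations of the bar codes and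
of a representation which becomes, over the algebraic closure, the sum of the representations of
the Jordan cells. -/
def HasInvariants {m : ℕ} {s : Fin m → ℝ} (t : Fin m → ℝ) (ρ : CyclicRep.{v, w} κ m)
    {ι ι' : Type w} (B : ι → BarCode s) (J : ι' → JordanCell (AlgebraicClosure κ)) : Prop :=
  ∃ ρ' : CyclicRep.{v, w} κ m,
    Nonempty (ρ.Iso ((CyclicRep.directSum fun b => (B b).rep κ t).prod ρ')) ∧
    Nonempty ((ρ'.baseChange (AlgebraicClosure κ)).Iso
      (CyclicRep.directSum fun j => (J j).rep m))

end Indecomposable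

/-! ### The representation of a circle valued map -/

section Map

variable {X : Type u} [TopologicalSpace X]

/-- The fiber `X_θ`. -/
abbrev Fiber (g : X → Real.Angle) (θ : Real.Angle) : Type u := g ⁻¹' {θ}

/-- The part `X̃_{[a,b]}` over `[a, b]` of the infinite cyclic covering `X̃ → ℝ` of `g`, the pull
back of `ℝ → 𝕊¹` along `g`. -/
abbrev CoverPart (g : X → Real.Angle) (a b : ℝ) : Type u :=
  {z : X × ℝ // g z.1 = (z.2 : Real.Angle) ∧ z.2 ∈ Set.Icc a b}

/-- The inclusion `X_θ = X̃_τ → X̃_{[a,b]}`, for `τ ∈ [a, b]` lying over `θ`. -/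
def fiberInclusion (g : X → Real.Angle) {a b τ : ℝ} {θ : Real.Angle} (hτ : τ ∈ Set.Icc a b)
    (hθ : θ = (τ : Real.Angle)) : C(Fiber g θ, CoverPart g a b) where
  toFun x := ⟨(x.1, τ), x.2.trans hθ, hτ⟩
  continuous_toFun := by fun_prop

theorem coe_nextAngle {m : ℕ} (t : Fin m → ℝ) (i : Fin m) :
    (t (finRotate m i) : Real.Angle) = (nextAngle t i : Real.Angle) := by
  unfold nextAngle carry
  split_ifs <;> simp

theorem Interlaced.lt_nextAngle {m : ℕ} {s t : Fin m → ℝ} (h : Interlaced s t) (i : Fin m) :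
    s i < nextAngle t i := by
  obtain _ | n := m
  · exact i.elim0
  · unfold nextAngle carry
    split_ifs with hi
    · have h1 := h.le i
      have h2 := h.pos (finRotate _ i)
      push_cast
      linarith
    · have : i < finRotate _ i := by
        rw [finRotate_apply, Fin.lt_def, Fin.val_add_one_of_lt]
        · omega
        · rw [Fin.lt_def, Fin.val_last]; omega
      simpa using h.lt_next i _ this

variable (κ : Type v) [Field κ]

/-- The map induced in homology by a continuous map. -/
def homologyMap (r : ℕ) {A B : Type u} [TopologicalSpace A] [TopologicalSpace B] (φ : C(A, B)) :
    (homology.{u, v} κ r).obj (TopCat.of A) ⟶ (homology.{u, v} κ r).obj (TopCat.of B) :=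
  (homology κ r).map (TopCat.ofHom φ)

open Classical in
/-- The composite of `f` with the inverse of `j`; used only where `j` is an isomorphism. -/
def compInv {L M N : ModuleCat.{w} κ} (f : L ⟶ M) (j : N ⟶ M) : L →ₗ[κ] N :=
  if _h : CategoryTheory.IsIso j then (f ≫ CategoryTheory.inv j).hom else 0

/-- The representation `ρ_r` of a circle valued map `g` with critical angles `s` and regular angles
`t`. The spaces are the homologies of the fibers. With `U = [t_i, t_{i+1}]`, a neighborhood of the
critical angle `s_i`, the maps are the compositions
`H_r(X_{t_i}) → H_r(X̃_U) ≅ H_r(X_{s_i})` and `H_r(X_{t_{i+1}}) → H_r(X̃_U) ≅ H_r(X_{s_i})`. For a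
tame map on a compact space `X_{s_i} → X̃_U` does induce an isomorphism in homology. -/
def fiberRep (g : X → Real.Angle) {m : ℕ} {s t : Fin m → ℝ} (h : Interlaced s t) (r : ℕ) :
    CyclicRep.{v, max u v} κ m where
  odd i := (homology.{u, v} κ r).obj (TopCat.of (Fiber g (t i : Real.Angle)))
  even i := (homology.{u, v} κ r).obj (TopCat.of (Fiber g (s i : Real.Angle)))
  α i := compInv κ
    (homologyMap κ r (fiberInclusion g (a := t i) (b := nextAngle t i) (τ := t i)
      ⟨le_rfl, ((h.lt i).trans (h.lt_nextAngle i)).le⟩ rfl))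
    (homologyMap κ r (fiberInclusion g (a := t i) (b := nextAngle t i) (τ := s i)
      ⟨(h.lt i).le, (h.lt_nextAngle i).le⟩ rfl))
  β i := compInv κ
    (homologyMap κ r (fiberInclusion g (a := t i) (b := nextAngle t i) (τ := nextAngle t i)
      ⟨((h.lt i).trans (h.lt_nextAngle i)).le, le_rfl⟩ (coe_nextAngle t i)))
    (homologyMap κ r (fiberInclusion g (a := t i) (b := nextAngle t i) (τ := s i)
      ⟨(h.lt i).le, (h.lt_nextAngle i).le⟩ rfl))

/-- The Betti number `dim H_r(A)`, a cardinal. -/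
def betti (r : ℕ) (A : Type u) [TopologicalSpace A] : Cardinal.{max u v} :=
  Module.rank κ ((homology.{u, v} κ r).obj (TopCat.of A))

end Map

end

end CircleValued

/-! The image of `f'` is a compact part of `(0, 2π)`, so the circle plays no real role. Near a
regular value that is attained, all values are attained; hence the minimum and the maximum of `f'`
are critical, `s₁` is the minimum and `t₁` lies below all values. The fiber over `t₁` is empty and
`ρ_r` vanishes at `x₁` (`IsFrame.subsingleton_odd`). This opens the cycle `G_{2m}` to a line. A
Jordan cell is non-zero at every vertex, so there are none, and no bar code passes over `t₁`, so
none makes a full turn (`HasInvariants.isEmpty_and_iso`, `turns_eq_zero_of_iso`). Bar codes exist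
because every representation of a line is a sum of intervals, in any dimension: bases adapted to
flags are transported from vertex to vertex (`exists_decomposition`).

For the Betti numbers, cover `X` by the parts over the stars of the critical values, a star being
`s_i` with the two gaps next to it. The part over a gap has the homology of any fiber over the gap,
by local triviality, excision and compact supports (`homologyTrivialOn_of_locally`); the part over a
star has the homology of the critical fiber, by goodness and excision (`homologyIso_of_critical`).
Under these identifications the Mayer-Vietoris difference map is `(x_i) ↦ (α_i x_i - β_i x_{i+1})`
for `ρ_r` (`IsFrame.diff_comm`). So `dim H_r(X)` is the dimension of its cokernel in degree `r` plus
that of its kernel in degree `r - 1` (`IsFrame.betti_succ`).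

Kernel and cokernel are additive over the bar codes. For a single bar code the kernel is a line if
both ends are open and zero otherwise; an Euler characteristic count then makes the cokernel a line
exactly if both ends are closed (`BarCode.finrank_ker_diff`, `BarCode.finrank_coker_diff`). Fibers
are counted by the basis of points, vertex by vertex, and the count is constant on gaps. -/

noncomputable section

open CategoryTheory AlgebraicTopology

/-! ### Homology of a complex of vector spaces by cycles and boundaries. -/

namespace ChainComplex

variable {κ : Type v} [Field κ] (K L : ChainComplex (ModuleCat.{w} κ) ℕ) (n : ℕ)

/-- In degree `0` both sides are `0`: the subtraction is truncated, and `next` returns its argument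
when there is no successor. The differential `K.d 0 0` is zero, so one formula for cycles serves all
degrees. -/
theorem next_down_eq_sub_one (n : ℕ) : (ComplexShape.down ℕ).next n = n - 1 := by
  cases n <;> simp

/-- The homology class of a cycle. -/
def cycleClass : LinearMap.ker (K.d n (n - 1)).hom →ₗ[κ] K.homology n :=
  (K.liftCycles (A := ModuleCat.of κ (LinearMap.ker (K.d n (n - 1)).hom))
    (ModuleCat.ofHom (Submodule.subtype _)) (n - 1) (next_down_eq_sub_one n)
    (by ext x; exact x.2) ≫ K.homologyπ n).hom

theorem liftCycles_ker_surjective : Function.Surjective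
    (K.liftCycles (A := ModuleCat.of κ (LinearMap.ker (K.d n (n - 1)).hom))
    (ModuleCat.ofHom (Submodule.subtype _)) (n - 1) (next_down_eq_sub_one n)
    (by ext x; exact x.2)).hom := by
  intro c
  have hc : (K.iCycles n).hom c ∈ LinearMap.ker (K.d n (n - 1)).hom :=
    (congrArg (fun f : K.cycles n ⟶ K.X (n - 1) => f.hom c) (K.iCycles_d n (n - 1)) :)
  refine ⟨⟨(K.iCycles n).hom c, hc⟩, ?_⟩
  · apply (ModuleCat.mono_iff_injective (K.iCycles n)).1 inferInstance
    have := K.liftCycles_i (A := ModuleCat.of κ (LinearMap.ker (K.d n (n - 1)).hom))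
      (ModuleCat.ofHom (Submodule.subtype _)) (n - 1) (next_down_eq_sub_one n)
      (by ext x; exact x.2)
    exact congrArg (fun f => f.hom ⟨_, hc⟩) this

theorem cycleClass_surjective : Function.Surjective (K.cycleClass n) := by
  have h := (ModuleCat.epi_iff_surjective (K.homologyπ n)).1 inferInstance
  exact h.comp (K.liftCycles_ker_surjective n)

theorem cycleClass_eq_zero_iff (z : LinearMap.ker (K.d n (n - 1)).hom) :
    K.cycleClass n z = 0 ↔ ∃ w, (K.d (n + 1) n).hom w = z := by
  have hex : (ShortComplex.mk _ _ (K.toCycles_comp_homologyπ (n + 1) n)).Exact :=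
    ShortComplex.exact_of_g_is_cokernel _ (K.homologyIsCokernel (n + 1) n (by simp))
  rw [ShortComplex.moduleCat_exact_iff] at hex
  have hlift := K.liftCycles_i (A := ModuleCat.of κ (LinearMap.ker (K.d n (n - 1)).hom))
      (ModuleCat.ofHom (Submodule.subtype _)) (n - 1) (next_down_eq_sub_one n)
      (by ext x; exact x.2)
  constructor
  · intro h
    obtain ⟨w, hw⟩ := hex _ h
    refine ⟨w, ?_⟩
    have h1 := congrArg (fun f => f.hom w) (K.toCycles_i (n + 1) n)
    have h2 := congrArg (fun f => f.hom z) hlift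
    have h3 := congrArg (K.iCycles n).hom hw
    exact (h1.symm.trans h3).trans h2
  · rintro ⟨w, hw⟩
    have h1 := congrArg (fun f => f.hom w) (K.toCycles_comp_homologyπ (n + 1) n)
    refine Eq.trans ?_ h1
    refine congrArg (K.homologyπ n).hom ?_
    apply (ModuleCat.mono_iff_injective (K.iCycles n)).1 inferInstance
    have h2 := congrArg (fun f => f.hom z) hlift
    have h1 := congrArg (fun f => f.hom w) (K.toCycles_i (n + 1) n)
    exact (h2.trans hw.symm).trans h1.symm

variable {K L}

theorem homologyMap_cycleClass (φ : K ⟶ L) (z : LinearMap.ker (K.d n (n - 1)).hom)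
    (z' : LinearMap.ker (L.d n (n - 1)).hom) (h : (z' : L.X n) = (φ.f n).hom z) :
    (HomologicalComplex.homologyMap φ n).hom (K.cycleClass n z) = L.cycleClass n z' := by
  have h1 := congrArg (fun f => f.hom (K.liftCycles (A := ModuleCat.of κ (LinearMap.ker
    (K.d n (n - 1)).hom))
    (ModuleCat.ofHom (Submodule.subtype _)) (n - 1) (next_down_eq_sub_one n)
    (by ext x; exact x.2) z)) (HomologicalComplex.homologyπ_naturality φ n)
  refine h1.trans (congrArg (L.homologyπ n).hom ?_)
  apply (ModuleCat.mono_iff_injective (L.iCycles n)).1 inferInstance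
  have h2 := congrArg (fun f => f.hom (K.liftCycles (A := ModuleCat.of κ (LinearMap.ker
    (K.d n (n - 1)).hom))
    (ModuleCat.ofHom (Submodule.subtype _)) (n - 1) (next_down_eq_sub_one n)
    (by ext x; exact x.2) z)) (HomologicalComplex.cyclesMap_i φ n)
  refine h2.trans ?_
  have h3 := congrArg (fun f => f.hom z) (K.liftCycles_i (A := ModuleCat.of κ (LinearMap.ker
    (K.d n (n - 1)).hom)) (ModuleCat.ofHom (Submodule.subtype _)) (n - 1) (next_down_eq_sub_one n)
      (by ext x; exact x.2))
  have h4 := congrArg (fun f => f.hom z') (L.liftCycles_i (A := ModuleCat.of κ (LinearMap.ker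
    (L.d n (n - 1)).hom)) (ModuleCat.ofHom (Submodule.subtype _)) (n - 1) (next_down_eq_sub_one n)
      (by ext x; exact x.2))
  refine (congrArg (φ.f n).hom h3).trans ?_
  exact h.symm.trans h4.symm

end ChainComplex

/-! ### Singular homology by explicit singular chains. -/

namespace CircleValued

/-- Singular simplices of dimension `n`. -/
abbrev Simplex (n : ℕ) (X : Type u) [TopologicalSpace X] : Type u :=
  C(stdSimplex ℝ (Fin (n + 1)), X)

/-- The face of the standard simplex opposite to the vertex `i`. -/
def faceMap (n : ℕ) (i : Fin (n + 2)) :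
    C(stdSimplex ℝ (Fin (n + 1)), stdSimplex ℝ (Fin (n + 2))) :=
  ⟨_, stdSimplex.continuous_map i.succAbove⟩

/-- Singular chains with coefficients in `κ`. -/
abbrev Chain (κ : Type v) [Field κ] (n : ℕ) (X : Type u) [TopologicalSpace X] : Type (max u v) :=
  Simplex n X →₀ κ

variable (κ : Type v) [Field κ] {X Y : Type u} [TopologicalSpace X] [TopologicalSpace Y]

/-- The boundary of singular chains, from degree `n + 1` to degree `n`. -/
def bd (n : ℕ) : Chain κ (n + 1) X →ₗ[κ] Chain κ n X :=
  ∑ i : Fin (n + 2), (-1 : κ) ^ (i : ℕ) • Finsupp.lmapDomain κ κ (fun σ => σ.comp (faceMap n i))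

/-- The boundary of singular chains, extended by zero to degree zero. -/
def dd : (n : ℕ) → Chain κ n X →ₗ[κ] Chain κ (n - 1) X
  | 0 => 0
  | n + 1 => bd κ n

/-- The map induced on chains. -/
def chainMap (n : ℕ) (φ : C(X, Y)) : Chain κ n X →ₗ[κ] Chain κ n Y :=
  Finsupp.lmapDomain κ κ (fun σ => φ.comp σ)

/-- Mathlib's singular chain complex. -/
abbrev singularComplex (X : Type u) [TopologicalSpace X] : ChainComplex (ModuleCat.{max u v} κ) ℕ :=
  ((singularChainComplexFunctor (ModuleCat.{max u v} κ)).obj (ModuleCat.of κ (ULift.{u} κ))).obj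
    (TopCat.of X)

/-- Singular simplices as simplices of the singular simplicial set. -/
def simplexEquiv (n : ℕ) : Simplex n X ≃ (TopCat.toSSet.obj (TopCat.of X)).obj (.op (.mk n)) :=
  ((TopCat.of X).toSSetObjEquiv (.op (.mk n))).symm

theorem simplexEquiv_face (n : ℕ) (i : Fin (n + 2)) (σ : Simplex (n + 1) X) :
    (TopCat.toSSet.obj (TopCat.of X)).δ i (simplexEquiv (n + 1) σ) =
      simplexEquiv n (σ.comp (faceMap n i)) := by
  rfl

theorem simplexEquiv_map (n : ℕ) (φ : C(X, Y)) (σ : Simplex n X) :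
    (TopCat.toSSet.map (TopCat.ofHom φ)).app _ (simplexEquiv n σ) =
      simplexEquiv n (φ.comp σ) := by
  rfl

/-- The inclusion of a summand of the singular chain complex. -/
def chainι {n : ℕ} (σ : Simplex n X) : κ →ₗ[κ] (singularComplex κ X).X n :=
  (SSet.ιChainComplex (R := ModuleCat.of κ (ULift.{u} κ)) _ (simplexEquiv n σ)).hom ∘ₗ
    (ULift.moduleEquiv.symm : κ ≃ₗ[κ] ULift.{u} κ).toLinearMap

/-- The comparison of concrete chains with Mathlib's chains. -/
def toSingular (n : ℕ) : Chain κ n X →ₗ[κ] (singularComplex κ X).X n :=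
  Finsupp.lsum κ fun σ => chainι κ σ

/-- The inverse of the comparison. -/
def ofSingular (n : ℕ) : (singularComplex κ X).X n ⟶ ModuleCat.of κ (Chain κ n X) :=
  Limits.Sigma.desc fun σ => ModuleCat.ofHom
    (Finsupp.lsingle ((simplexEquiv n).symm σ) ∘ₗ (ULift.moduleEquiv : ULift.{u} κ ≃ₗ[κ] κ).toLinearMap)

theorem ι_ofSingular (n : ℕ) (σ : (TopCat.toSSet.obj (TopCat.of X)).obj (.op (.mk n))) :
    SSet.ιChainComplex (R := ModuleCat.of κ (ULift.{u} κ)) _ σ ≫ ofSingular κ n = ModuleCat.ofHom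
    (Finsupp.lsingle ((simplexEquiv n).symm σ) ∘ₗ
      (ULift.moduleEquiv : ULift.{u} κ ≃ₗ[κ] κ).toLinearMap) :=
  Limits.Sigma.ι_desc _ _

/-- The universal property of the coproduct gives the inverse `ofSingular`; both composites are
checked on one summand. `ULift` only adjusts universes. -/
theorem toSingular_bijective (n : ℕ) : Function.Bijective (toSingular κ (X := X) n) := by
  have h1 : (ofSingular κ (X := X) n).hom ∘ₗ toSingular κ n = LinearMap.id := by
    ext σ : 1
    ext
    have := congrArg (fun f => f.hom (ULift.up 1)) (ι_ofSingular κ n (simplexEquiv n σ))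
    simp only [toSingular, LinearMap.comp_apply, Finsupp.lsingle_apply, Finsupp.lsum_single]
    refine DFunLike.congr (this.trans ?_) rfl
    simp
  have h2 : ofSingular κ (X := X) n ≫ ModuleCat.ofHom (toSingular κ n) = 𝟙 _ := by
    apply SSet.chainComplex_hom_ext
    intro σ
    refine ((Category.assoc _ _ _).symm.trans (congrArg (· ≫ ModuleCat.ofHom (toSingular κ n))
      (ι_ofSingular κ n σ))).trans ?_
    ext a
    simp [toSingular, chainι]
    rfl
  constructor
  · exact Function.LeftInverse.injective (g := (ofSingular κ n).hom) fun x => DFunLike.congr_fun h1 x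
  · exact Function.RightInverse.surjective (g := (ofSingular κ n).hom)
      fun x => congrArg (fun f => f.hom x) h2

theorem toSingular_bd (n : ℕ) (c : Chain κ (n + 1) X) :
    ((singularComplex κ X).d (n + 1) n).hom (toSingular κ (n + 1) c) =
      toSingular κ n (bd κ n c) := by
  revert c
  refine DFunLike.congr_fun (f := ((singularComplex κ X).d (n + 1) n).hom ∘ₗ toSingular κ (n + 1))
    (g := toSingular κ n ∘ₗ bd κ n) ?_
  ext σ : 2
  have := congrArg (fun f => f.hom (ULift.up 1)) (SSet.ιChainComplex_d _
    (R := ModuleCat.of κ (ULift.{u} κ)) (simplexEquiv (n + 1) σ))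
  simp only [LinearMap.comp_apply, toSingular, Finsupp.lsingle_apply, Finsupp.lsum_single, bd,
    LinearMap.sum_apply, LinearMap.smul_apply, Finsupp.lmapDomain_apply, Finsupp.mapDomain_single,
    map_sum, map_smul]
  refine this.trans ?_
  simp only [simplexEquiv_face]
  rw [ModuleCat.hom_sum, LinearMap.sum_apply]
  refine Finset.sum_congr rfl fun i _ => ?_
  rcases Nat.even_or_odd (i : ℕ) with h | h
  · simp [h.neg_one_pow, chainι]
    rfl
  · simp [h.neg_one_pow, chainι]
    rfl

theorem toSingular_dd (n : ℕ) (c : Chain κ n X) :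
    ((singularComplex κ X).d n (n - 1)).hom (toSingular κ n c) =
      toSingular κ (n - 1) (dd κ n c) := by
  cases n with
  | zero =>
    rw [HomologicalComplex.shape _ _ _ (by simp)]
    simp [dd]
  | succ n => exact toSingular_bd κ n c

theorem toSingular_chainMap (n : ℕ) (φ : C(X, Y)) (c : Chain κ n X) :
    ((((singularChainComplexFunctor (ModuleCat.{max u v} κ)).obj
      (ModuleCat.of κ (ULift.{u} κ))).map (TopCat.ofHom φ)).f n).hom (toSingular κ n c) =
      toSingular κ n (chainMap κ n φ c) := by
  revert c
  refine DFunLike.congr_fun (f := ((((singularChainComplexFunctor (ModuleCat.{max u v} κ)).obj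
      (ModuleCat.of κ (ULift.{u} κ))).map (TopCat.ofHom φ)).f n).hom ∘ₗ toSingular κ n)
    (g := toSingular κ n ∘ₗ chainMap κ n φ) ?_
  ext σ : 2
  have := congrArg (fun f => f.hom (ULift.up 1)) (SSet.ι_chainComplexMap_f _ _
    (TopCat.toSSet.map (TopCat.ofHom φ))
    (ModuleCat.of κ (ULift.{u} κ)) (simplexEquiv n σ))
  simp only [LinearMap.comp_apply, toSingular, Finsupp.lsingle_apply, Finsupp.lsum_single, chainMap,
     Finsupp.lmapDomain_apply, Finsupp.mapDomain_single]
  refine this.trans ?_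
  rw [simplexEquiv_map]
  rfl

/-- The homology class of a singular cycle. -/
def cls (n : ℕ) : LinearMap.ker (dd κ (X := X) n) →ₗ[κ] (homology.{u, v} κ n).obj (TopCat.of X) :=
  (singularComplex κ X).cycleClass n ∘ₗ
    (toSingular κ n).restrict (p := LinearMap.ker (dd κ n))
      (q := LinearMap.ker ((singularComplex κ X).d n (n - 1)).hom) (fun z hz => by
        rw [LinearMap.mem_ker] at hz ⊢
        rw [toSingular_dd, hz, map_zero])

theorem cls_surjective (n : ℕ) : Function.Surjective (cls κ (X := X) n) := by
  refine (ChainComplex.cycleClass_surjective _ n).comp ?_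
  rintro ⟨z, hz⟩
  obtain ⟨c, rfl⟩ := (toSingular_bijective κ n).2 z
  refine ⟨⟨c, ?_⟩, rfl⟩
  rw [LinearMap.mem_ker, toSingular_dd] at hz
  exact (toSingular_bijective κ _).1 (hz.trans (map_zero _).symm)

theorem cls_eq_zero_iff {n : ℕ} (z : LinearMap.ker (dd κ (X := X) n)) :
    cls κ n z = 0 ↔ ∃ w, bd κ n w = (z : Chain κ n X) := by
  refine (ChainComplex.cycleClass_eq_zero_iff _ n _).trans ?_
  constructor
  · rintro ⟨w, hw⟩
    obtain ⟨c, rfl⟩ := (toSingular_bijective κ _).2 w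
    rw [toSingular_bd] at hw
    exact ⟨c, (toSingular_bijective κ _).1 hw⟩
  · rintro ⟨w, hw⟩
    exact ⟨toSingular κ _ w, (toSingular_bd κ n w).trans (congrArg _ hw)⟩

theorem homologyMap_cls {n : ℕ} (φ : C(X, Y)) (z : LinearMap.ker (dd κ (X := X) n))
    (z' : LinearMap.ker (dd κ (X := Y) n)) (h : (z' : Chain κ n Y) = chainMap κ n φ z) :
    (homologyMap κ n φ).hom (cls κ n z) = cls κ n z' := by
  refine ChainComplex.homologyMap_cycleClass n _ _ _ ?_
  refine Eq.trans ?_ (toSingular_chainMap κ n φ _).symm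
  exact congrArg (toSingular κ n) h

end CircleValued

end

noncomputable section

open CategoryTheory AlgebraicTopology

namespace CircleValued

/-! ### Chains of tuples of points and their subdivision -/

section Tuple

variable (κ : Type v) [Field κ] {P Q : Type*}

/-- Formal combinations of `k`-tuples of points. -/
abbrev TupleChain (κ : Type v) [Field κ] (P : Type*) (k : ℕ) := (Fin k → P) →₀ κ

/-- The boundary of a chain of tuples. -/
def tupleBd (k : ℕ) : TupleChain κ P (k + 1) →ₗ[κ] TupleChain κ P k :=
  ∑ i : Fin (k + 1), (-1 : κ) ^ (i : ℕ) • Finsupp.lmapDomain κ κ (fun v => v ∘ i.succAbove)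

/-- The cone with apex `p`. -/
def cone (k : ℕ) (p : P) : TupleChain κ P k →ₗ[κ] TupleChain κ P (k + 1) :=
  Finsupp.lmapDomain κ κ (fun v => (Fin.cons p v : Fin (k + 1) → P))

/-- The map on chains of tuples induced by a map of points. -/
def tupleMap (k : ℕ) (f : P → Q) : TupleChain κ P k →ₗ[κ] TupleChain κ Q k :=
  Finsupp.lmapDomain κ κ (fun v => f ∘ v)

theorem tupleBd_single (k : ℕ) (v : Fin (k + 1) → P) (a : κ) :
    tupleBd κ k (Finsupp.single v a) =
      ∑ i : Fin (k + 1), (-1 : κ) ^ (i : ℕ) • Finsupp.single (v ∘ i.succAbove) a := by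
  simp [tupleBd, Finsupp.mapDomain_single]

@[simp]
theorem cone_single (k : ℕ) (p : P) (v : Fin k → P) (a : κ) :
    cone κ k p (Finsupp.single v a) = Finsupp.single (Fin.cons p v : Fin (k + 1) → P) a := by
  simp [cone, Finsupp.mapDomain_single]

@[simp]
theorem tupleMap_single (k : ℕ) (f : P → Q) (v : Fin k → P) (a : κ) :
    tupleMap κ k f (Finsupp.single v a) = Finsupp.single (f ∘ v) a := by
  simp [tupleMap, Finsupp.mapDomain_single]

/-- Chains of tuples are augmented by the empty tuple, in length `0`; the lowest case of the cone
formula therefore has no correction term. -/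
theorem tupleBd_cone_zero (p : P) (c : TupleChain κ P 0) : tupleBd κ 0 (cone κ 0 p c) = c := by
  induction c using Finsupp.induction_linear with
  | zero => simp
  | add f g hf hg => rw [map_add, map_add, hf, hg]
  | single v a =>
    rw [cone_single, tupleBd_single]
    simp

/-- Omitting the apex returns the tuple; omitting another point gives the cone over a face, with its
index shifted by one and hence the opposite sign. -/
theorem tupleBd_cone (k : ℕ) (p : P) (c : TupleChain κ P (k + 1)) :
    tupleBd κ (k + 1) (cone κ (k + 1) p c) = c - cone κ k p (tupleBd κ k c) := by
  induction c using Finsupp.induction_linear with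
  | zero => simp
  | add f g hf hg => rw [map_add, map_add, hf, hg, map_add, map_add]; abel
  | single v a =>
    rw [cone_single, tupleBd_single, tupleBd_single, Fin.sum_univ_succ, map_sum,
      sub_eq_add_neg, ← Finset.sum_neg_distrib]
    congr 1
    · simp only [Fin.val_zero, pow_zero, one_smul]
      congr 1
    · refine Finset.sum_congr rfl fun i _ => ?_
      rw [map_smul, cone_single, Fin.val_succ, pow_succ, mul_neg_one, neg_smul]
      congr 3
      funext j
      refine Fin.cases ?_ (fun j => ?_) j <;> simp

/-- Every tuple is the cone over its tail with apex its first point, so the cone formula and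
induction replace the usual double sum over pairs of faces. -/
theorem tupleBd_tupleBd (k : ℕ) (c : TupleChain κ P (k + 2)) :
    tupleBd κ k (tupleBd κ (k + 1) c) = 0 := by
  induction k with
  | zero =>
    induction c using Finsupp.induction_linear with
    | zero => simp
    | add f g hf hg => rw [map_add, map_add, hf, hg, add_zero]
    | single v a =>
      obtain ⟨p, w, rfl⟩ : ∃ p w, v = Fin.cons p w := ⟨_, _, (Fin.cons_self_tail v).symm⟩
      rw [← cone_single, tupleBd_cone, map_sub, tupleBd_cone_zero, sub_self]
  | succ k ih =>
    induction c using Finsupp.induction_linear with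
    | zero => simp
    | add f g hf hg => rw [map_add, map_add, hf, hg, add_zero]
    | single v a =>
      obtain ⟨p, w, rfl⟩ : ∃ p w, v = Fin.cons p w := ⟨_, _, (Fin.cons_self_tail v).symm⟩
      rw [← cone_single, tupleBd_cone, map_sub, tupleBd_cone, ih, map_zero, sub_zero, sub_self]

variable (b : ∀ k, (Fin (k + 1) → P) → P)

/-- Barycentric subdivision of chains of tuples, the barycenters being given by `b`. -/
def subdiv : (k : ℕ) → TupleChain κ P k →ₗ[κ] TupleChain κ P k
  | 0 => LinearMap.id
  | k + 1 => Finsupp.linearCombination κ fun v =>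
      cone κ k (b k v) (subdiv k (tupleBd κ k (Finsupp.single v 1)))

/-- The homotopy between the identity and the subdivision. -/
def subdivHomotopy : (k : ℕ) → TupleChain κ P k →ₗ[κ] TupleChain κ P (k + 1)
  | 0 => 0
  | k + 1 => Finsupp.linearCombination κ fun v =>
      cone κ (k + 1) (b k v)
        (Finsupp.single v 1 - subdivHomotopy k (tupleBd κ k (Finsupp.single v 1)))

theorem subdiv_succ_single (k : ℕ) (v : Fin (k + 1) → P) :
    subdiv κ b (k + 1) (Finsupp.single v 1) =
      cone κ k (b k v) (subdiv κ b k (tupleBd κ k (Finsupp.single v 1))) := by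
  simp [subdiv]

theorem subdivHomotopy_succ_single (k : ℕ) (v : Fin (k + 1) → P) :
    subdivHomotopy κ b (k + 1) (Finsupp.single v 1) = cone κ (k + 1) (b k v)
        (Finsupp.single v 1 - subdivHomotopy κ b k (tupleBd κ k (Finsupp.single v 1))) := by
  simp [subdivHomotopy]

variable {κ} in
theorem TupleChain.hom_ext {k : ℕ} {M : Type*} [AddCommGroup M] [Module κ M]
    {f g : TupleChain κ P k →ₗ[κ] M}
    (h : ∀ v, f (Finsupp.single v 1) = g (Finsupp.single v 1)) : f = g := by
  ext v
  exact h v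

/-- By the cone formula the boundary of the cone over `subdiv (∂v)` is `subdiv (∂v)` minus a cone
over `∂ (subdiv (∂v)) = subdiv (∂∂v) = 0`. -/
theorem tupleBd_subdiv (k : ℕ) (c : TupleChain κ P (k + 1)) :
    tupleBd κ k (subdiv κ b (k + 1) c) = subdiv κ b k (tupleBd κ k c) := by
  induction k with
  | zero =>
    refine DFunLike.congr_fun (f := tupleBd κ 0 ∘ₗ subdiv κ b 1)
      (g := subdiv κ b 0 ∘ₗ tupleBd κ 0) (TupleChain.hom_ext fun v => ?_) c
    simp only [LinearMap.comp_apply]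
    rw [subdiv_succ_single, tupleBd_cone_zero]
  | succ k ih =>
    refine DFunLike.congr_fun (f := tupleBd κ (k + 1) ∘ₗ subdiv κ b (k + 2))
      (g := subdiv κ b (k + 1) ∘ₗ tupleBd κ (k + 1)) (TupleChain.hom_ext fun v => ?_) c
    simp only [LinearMap.comp_apply]
    rw [subdiv_succ_single, tupleBd_cone, ih, tupleBd_tupleBd, map_zero, map_zero, sub_zero]

/-- The homotopy `T` takes `v` to the cone over `v - T(∂v)`. By induction `∂(v - T(∂v)) = subdiv
(∂v)`, and the cone over this is `subdiv v`. -/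
theorem tupleBd_subdivHomotopy (k : ℕ) (c : TupleChain κ P (k + 1)) :
    tupleBd κ (k + 1) (subdivHomotopy κ b (k + 1) c) =
      c - subdiv κ b (k + 1) c - subdivHomotopy κ b k (tupleBd κ k c) := by
  induction k with
  | zero =>
    refine DFunLike.congr_fun (f := tupleBd κ 1 ∘ₗ subdivHomotopy κ b 1)
      (g := LinearMap.id - subdiv κ b 1 - subdivHomotopy κ b 0 ∘ₗ tupleBd κ 0)
      (TupleChain.hom_ext fun v => ?_) c
    simp only [LinearMap.comp_apply, LinearMap.sub_apply, LinearMap.id_apply]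
    rw [subdivHomotopy_succ_single, tupleBd_cone, subdiv_succ_single]
    simp [subdivHomotopy, subdiv]
  | succ k ih =>
    refine DFunLike.congr_fun (f := tupleBd κ (k + 2) ∘ₗ subdivHomotopy κ b (k + 2))
      (g := LinearMap.id - subdiv κ b (k + 2) - subdivHomotopy κ b (k + 1) ∘ₗ tupleBd κ (k + 1))
      (TupleChain.hom_ext fun v => ?_) c
    simp only [LinearMap.comp_apply, LinearMap.sub_apply, LinearMap.id_apply]
    rw [subdivHomotopy_succ_single, tupleBd_cone, subdiv_succ_single, map_sub, ih,
      tupleBd_tupleBd, map_zero, sub_zero, sub_sub_cancel]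
    abel

theorem tupleMap_tupleBd (k : ℕ) (f : P → Q) (c : TupleChain κ P (k + 1)) :
    tupleMap κ k f (tupleBd κ k c) = tupleBd κ k (tupleMap κ (k + 1) f c) := by
  refine DFunLike.congr_fun (f := tupleMap κ k f ∘ₗ tupleBd κ k)
      (g := tupleBd κ k ∘ₗ tupleMap κ (k + 1) f) (TupleChain.hom_ext fun v => ?_) c
  simp [tupleBd_single, Function.comp_assoc]

theorem tupleMap_cone (k : ℕ) (f : P → Q) (p : P) (c : TupleChain κ P k) :
    tupleMap κ (k + 1) f (cone κ k p c) = cone κ k (f p) (tupleMap κ k f c) := by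
  refine DFunLike.congr_fun (f := tupleMap κ (k + 1) f ∘ₗ cone κ k p)
      (g := cone κ k (f p) ∘ₗ tupleMap κ k f) (TupleChain.hom_ext fun v => ?_) c
  simp [Fin.comp_cons]

variable {b} {b' : ∀ k, (Fin (k + 1) → Q) → Q} {f : P → Q}

theorem tupleMap_subdiv (hf : ∀ k v, f (b k v) = b' k (f ∘ v)) (k : ℕ) (c : TupleChain κ P k) :
    tupleMap κ k f (subdiv κ b k c) = subdiv κ b' k (tupleMap κ k f c) := by
  induction k with
  | zero => simp [subdiv]
  | succ k ih =>
    refine DFunLike.congr_fun (f := tupleMap κ (k + 1) f ∘ₗ subdiv κ b (k + 1))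
      (g := subdiv κ b' (k + 1) ∘ₗ tupleMap κ (k + 1) f) (TupleChain.hom_ext fun v => ?_) c
    simp only [LinearMap.comp_apply]
    rw [tupleMap_single, subdiv_succ_single, subdiv_succ_single, tupleMap_cone, ih, hf,
      tupleMap_tupleBd, tupleMap_single]

theorem tupleMap_subdivHomotopy (hf : ∀ k v, f (b k v) = b' k (f ∘ v)) (k : ℕ)
    (c : TupleChain κ P k) :
    tupleMap κ (k + 1) f (subdivHomotopy κ b k c) =
      subdivHomotopy κ b' k (tupleMap κ k f c) := by
  induction k with
  | zero => simp [subdivHomotopy]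
  | succ k ih =>
    refine DFunLike.congr_fun (f := tupleMap κ (k + 2) f ∘ₗ subdivHomotopy κ b (k + 1))
      (g := subdivHomotopy κ b' (k + 1) ∘ₗ tupleMap κ (k + 1) f)
      (TupleChain.hom_ext fun v => ?_) c
    simp only [LinearMap.comp_apply]
    rw [tupleMap_single, subdivHomotopy_succ_single, subdivHomotopy_succ_single, tupleMap_cone,
      map_sub, ih, hf, tupleMap_tupleBd, tupleMap_single]

variable {κ}

/-- A property of tuples which is inherited by the faces and, by passing to cones, by the tuples of
the subdivision. -/
theorem subdiv_induction (R : ∀ k, (Fin (k + 1) → P) → (Fin (k + 1) → P) → Prop)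
    (h0 : ∀ v : Fin 1 → P, R 0 v (Fin.cons (b 0 v) Fin.elim0))
    (hs : ∀ k (v : Fin (k + 2) → P) (i : Fin (k + 2)) w, R k (v ∘ i.succAbove) w →
      R (k + 1) v (Fin.cons (b (k + 1) v) w))
    (k : ℕ) (v : Fin (k + 1) → P) :
    subdiv κ b (k + 1) (Finsupp.single v 1) ∈ Finsupp.supported κ κ {w | R k v w} := by
  induction k with
  | zero =>
    rw [subdiv_succ_single, tupleBd_single, map_sum, map_sum]
    refine Submodule.sum_mem _ fun i _ => ?_
    rw [map_smul, map_smul]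
    refine Submodule.smul_mem _ _ ?_
    simp only [subdiv, LinearMap.id_apply, cone_single]
    refine Finsupp.single_mem_supported _ _ ?_
    rw [Subsingleton.elim (v ∘ i.succAbove) Fin.elim0]
    exact h0 v
  | succ k ih =>
    rw [subdiv_succ_single, tupleBd_single, map_sum, map_sum]
    refine Submodule.sum_mem _ fun i _ => ?_
    rw [map_smul, map_smul]
    refine Submodule.smul_mem _ _ ?_
    have h1 := ih (v ∘ i.succAbove)
    rw [Finsupp.mem_supported] at h1 ⊢
    classical
    intro w hw
    obtain ⟨w', hw', rfl⟩ := Finset.mem_image.1 (Finsupp.mapDomain_support hw)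
    exact hs k v i w' (h1 hw')

end Tuple

/-! ### Affine simplices in the standard simplices -/

section Affine

/-- The combination of points of a standard simplex with given weights. -/
def affComb {m n : ℕ} (v : Fin (m + 1) → stdSimplex ℝ (Fin (n + 1)))
    (w : stdSimplex ℝ (Fin (m + 1))) : stdSimplex ℝ (Fin (n + 1)) :=
  ⟨fun i => ∑ j, w.1 j * (v j).1 i,
    fun i => Finset.sum_nonneg fun j _ => mul_nonneg (w.2.1 j) ((v j).2.1 i), by
      rw [Finset.sum_comm]
      simp_rw [← Finset.mul_sum, (v _).2.2, mul_one]
      exact w.2.2⟩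

/-- The affine simplex with given vertices. -/
def aff {m n : ℕ} (v : Fin (m + 1) → stdSimplex ℝ (Fin (n + 1))) :
    C(stdSimplex ℝ (Fin (m + 1)), stdSimplex ℝ (Fin (n + 1))) :=
  ⟨affComb v, Continuous.subtype_mk (continuous_pi fun _ => continuous_finsetSum _ fun j _ =>
    ((continuous_apply j).comp continuous_subtype_val).mul continuous_const) _⟩

/-- The vertices of the standard simplex. -/
def vertices (n : ℕ) : Fin (n + 1) → stdSimplex ℝ (Fin (n + 1)) :=
  fun i => stdSimplex.vertex i

theorem aff_apply {m n : ℕ} (v : Fin (m + 1) → stdSimplex ℝ (Fin (n + 1)))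
    (w : stdSimplex ℝ (Fin (m + 1))) (i : Fin (n + 1)) :
    (aff v w).1 i = ∑ j, w.1 j * (v j).1 i := rfl

theorem aff_vertices (n : ℕ) : aff (vertices n) = ContinuousMap.id _ := by
  ext w i
  change ∑ j, w.1 j * (vertices n j).1 i = w.1 i
  simp [vertices, Pi.single_apply]

theorem aff_vertex {m n : ℕ} (v : Fin (m + 1) → stdSimplex ℝ (Fin (n + 1))) (j : Fin (m + 1)) :
    aff v (vertices m j) = v j := by
  ext i
  change ∑ l, (vertices m j).1 l * (v l).1 i = (v j).1 i
  simp [vertices, Pi.single_apply]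

theorem aff_comp_aff {l m n : ℕ} (v : Fin (m + 1) → stdSimplex ℝ (Fin (n + 1)))
    (w : Fin (l + 1) → stdSimplex ℝ (Fin (m + 1))) :
    (aff v).comp (aff w) = aff (aff v ∘ w) := by
  ext x i
  change ∑ j, (∑ k, x.1 k * (w k).1 j) * (v j).1 i = ∑ k, x.1 k * ∑ j, (w k).1 j * (v j).1 i
  simp_rw [Finset.sum_mul, Finset.mul_sum]
  rw [Finset.sum_comm]
  simp_rw [mul_assoc]

theorem faceMap_eq_aff (n : ℕ) (i : Fin (n + 2)) :
    faceMap n i = aff (vertices (n + 1) ∘ i.succAbove) := by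
  ext w j
  change (stdSimplex.map i.succAbove w).1 j = ∑ l, w.1 l * (vertices (n + 1) (i.succAbove l)).1 j
  simp only [stdSimplex.map, vertices]
  simp [FunOnFinite.linearMap_apply_apply, Pi.single_apply, Finset.sum_filter, eq_comm]
  rfl

/-- The barycenter of a tuple of points. -/
def bary {n : ℕ} (k : ℕ) (v : Fin (k + 1) → stdSimplex ℝ (Fin (n + 1))) :
    stdSimplex ℝ (Fin (n + 1)) :=
  aff v stdSimplex.barycenter

theorem aff_bary {m n : ℕ} (u : Fin (m + 1) → stdSimplex ℝ (Fin (n + 1))) (k : ℕ)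
    (v : Fin (k + 1) → stdSimplex ℝ (Fin (m + 1))) : aff u (bary k v) = bary k (aff u ∘ v) := by
  rw [bary, bary, ← aff_comp_aff]
  rfl

/-- Balls of the sup distance are convex: each coordinate of the difference is a weighted mean of
the differences to the vertices. -/
theorem dist_aff_le {m n : ℕ} {v : Fin (m + 1) → stdSimplex ℝ (Fin (n + 1))}
    {q : stdSimplex ℝ (Fin (n + 1))} {R : ℝ} (h : ∀ j, dist q (v j) ≤ R)
    (w : stdSimplex ℝ (Fin (m + 1))) : dist q (aff v w) ≤ R := by
  have hR : 0 ≤ R := dist_nonneg.trans (h 0)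
  rw [Subtype.dist_eq, dist_pi_le_iff hR]
  intro i
  have h1 : q.1 i - (aff v w).1 i = ∑ j, w.1 j * (q.1 i - (v j).1 i) := by
    simp_rw [mul_sub, Finset.sum_sub_distrib, ← Finset.sum_mul]
    rw [w.2.2, one_mul, aff_apply]
  rw [Real.dist_eq, h1]
  calc |∑ j, w.1 j * (q.1 i - (v j).1 i)| ≤ ∑ j, |w.1 j * (q.1 i - (v j).1 i)| :=
        Finset.abs_sum_le_sum_abs _ _
    _ ≤ ∑ j, w.1 j * R := by
        refine Finset.sum_le_sum fun j _ => ?_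
        rw [abs_mul, abs_of_nonneg (w.2.1 j)]
        refine mul_le_mul_of_nonneg_left ?_ (w.2.1 j)
        rw [← Real.dist_eq]
        exact (dist_le_pi_dist _ _ i).trans (h j)
    _ = R := by rw [← Finset.sum_mul, w.2.2, one_mul]

/-- Of the `k + 1` equally weighted differences to the vertices, the one with `j = l` vanishes. -/
theorem dist_bary_le {n k : ℕ} {v : Fin (k + 1) → stdSimplex ℝ (Fin (n + 1))} {D : ℝ}
    (h : ∀ i j, dist (v i) (v j) ≤ D) (l : Fin (k + 1)) :
    dist (v l) (bary k v) ≤ (k : ℝ) / (k + 1) * D := by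
  have hD : 0 ≤ D := dist_nonneg.trans (h 0 0)
  have hk : (0 : ℝ) < k + 1 := by positivity
  rw [Subtype.dist_eq, dist_pi_le_iff (by positivity)]
  intro i
  have h1 : (v l).1 i - (bary k v).1 i = ∑ j, ((k : ℝ) + 1)⁻¹ * ((v l).1 i - (v j).1 i) := by
    simp_rw [mul_sub, Finset.sum_sub_distrib]
    rw [bary, aff_apply]
    simp
    field_simp
  rw [Real.dist_eq, h1]
  calc |∑ j, ((k : ℝ) + 1)⁻¹ * ((v l).1 i - (v j).1 i)|
      ≤ ∑ j, |((k : ℝ) + 1)⁻¹ * ((v l).1 i - (v j).1 i)| := Finset.abs_sum_le_sum_abs _ _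
    _ ≤ ∑ j, if j = l then 0 else ((k : ℝ) + 1)⁻¹ * D := by
        refine Finset.sum_le_sum fun j _ => ?_
        split_ifs with hj
        · simp [hj]
        · rw [abs_mul, abs_of_nonneg (by positivity)]
          refine mul_le_mul_of_nonneg_left ?_ (by positivity)
          rw [← Real.dist_eq]
          exact (dist_le_pi_dist _ _ i).trans (h l j)
    _ = (k : ℝ) / (k + 1) * D := by
        rw [Finset.sum_ite]
        simp [Finset.filter_ne', Finset.card_erase_of_mem]
        field_simp

/-- Subdivision makes simplices smaller. -/
theorem subdiv_mesh {κ : Type v} [Field κ] {n k : ℕ} (v : Fin (k + 1) → stdSimplex ℝ (Fin (n + 1))) :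
    subdiv κ bary (k + 1) (Finsupp.single v 1) ∈ Finsupp.supported κ κ {w |
      (∀ D, (∀ i j, dist (v i) (v j) ≤ D) → ∀ i j, dist (w i) (w j) ≤ (k : ℝ) / (k + 1) * D) ∧
      ∀ q R, (∀ i, dist q (v i) ≤ R) → ∀ i, dist q (w i) ≤ R} := by
  -- The second property, staying in every ball that contains `v`, is carried along because it
  -- bounds the distance from the new apex to the other vertices.
  refine subdiv_induction (fun k v w =>
      (∀ D, (∀ i j, dist (v i) (v j) ≤ D) → ∀ i j, dist (w i) (w j) ≤ (k : ℝ) / (k + 1) * D) ∧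
      ∀ q R, (∀ i, dist q (v i) ≤ R) → ∀ i, dist q (w i) ≤ R) ?_ ?_ k v
  · intro v
    refine ⟨fun D h i j => ?_, fun q R h i => ?_⟩
    · simp [Fin.fin_one_eq_zero i, Fin.fin_one_eq_zero j]
    · rw [Fin.fin_one_eq_zero i]
      exact dist_aff_le h _
  · rintro k v i w ⟨h1, h2⟩
    refine ⟨fun D h => ?_, fun q R h j => ?_⟩
    · have hD : 0 ≤ D := dist_nonneg.trans (h 0 0)
      have hw : ∀ j, dist (bary (k + 1) v) (w j) ≤ ((k + 1 : ℕ) : ℝ) / ((k + 1 : ℕ) + 1) * D := by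
        refine h2 _ _ fun j => ?_
        rw [dist_comm]
        exact dist_bary_le h _
      have hle : (k : ℝ) / (k + 1) * D ≤ ((k + 1 : ℕ) : ℝ) / ((k + 1 : ℕ) + 1) * D := by
        refine mul_le_mul_of_nonneg_right ?_ hD
        push_cast
        rw [div_le_div_iff₀ (by positivity) (by positivity)]
        nlinarith
      intro j l
      refine Fin.cases ?_ (fun j => ?_) j <;> refine Fin.cases ?_ (fun l => ?_) l
      · simp only [Fin.cons_zero, dist_self]
        positivity
      · simpa using hw l
      · simpa [dist_comm] using hw j
      · simpa using (h1 D (fun _ _ => h _ _) j l).trans hle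
    · refine Fin.cases ?_ (fun j => ?_) j
      · exact dist_aff_le h _
      · simpa using h2 q R (fun _ => h _) j

end Affine

end CircleValued

end

noncomputable section

open CategoryTheory AlgebraicTopology

namespace CircleValued

/-! ### Barycentric subdivision of singular chains and small simplices. -/

section Subdivision

variable (κ : Type v) [Field κ] {X : Type u} [TopologicalSpace X]

/-- The chains supported by the simplices with a given property. -/
abbrev chainsOf (n : ℕ) (p : Set (Simplex n X)) : Submodule κ (Chain κ n X) :=
  Finsupp.supported κ κ p

/-- The simplices contained in a subset. -/
def simplicesIn (n : ℕ) (A : Set X) : Set (Simplex n X) := {σ | Set.range σ ⊆ A}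

/-- The chains in a subset. -/
abbrev chainsIn (n : ℕ) (A : Set X) : Submodule κ (Chain κ n X) := chainsOf κ n (simplicesIn n A)

/-- The simplices contained in one of the members of a family of subsets. -/
def smallSimplices (n : ℕ) {ι : Type*} (U : ι → Set X) : Set (Simplex n X) :=
  ⋃ i, simplicesIn n (U i)

variable {κ} in
theorem Chain.hom_ext {n : ℕ} {M : Type*} [AddCommGroup M] [Module κ M]
    {f g : Chain κ n X →ₗ[κ] M}
    (h : ∀ σ, f (Finsupp.single σ 1) = g (Finsupp.single σ 1)) : f = g := by
  ext v
  exact h v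

variable {κ} in
theorem map_chainsOf_le {M : Type*} [AddCommGroup M] [Module κ M] {n : ℕ} {p : Set (Simplex n X)}
    {f : Chain κ n X →ₗ[κ] M} {S : Submodule κ M} (h : ∀ σ ∈ p, f (Finsupp.single σ 1) ∈ S)
    {c : Chain κ n X} (hc : c ∈ chainsOf κ n p) : f c ∈ S := by
  have : chainsOf κ n p ≤ S.comap f := by
    rw [chainsOf, Finsupp.supported_eq_span_single, Submodule.span_le]
    rintro _ ⟨σ, hσ, rfl⟩
    exact h σ hσ
  exact this hc

variable {κ} in
theorem chainsIn_mono {n : ℕ} {A B : Set X} (h : A ⊆ B) : chainsIn κ n A ≤ chainsIn κ n B :=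
  Finsupp.supported_mono fun _ hσ => hσ.trans h

theorem bd_single (n : ℕ) (σ : Simplex (n + 1) X) (a : κ) :
    bd κ n (Finsupp.single σ a) =
      ∑ i : Fin (n + 2), (-1 : κ) ^ (i : ℕ) • Finsupp.single (σ.comp (faceMap n i)) a := by
  simp [bd, Finsupp.mapDomain_single]

theorem bd_mem {n : ℕ} {A : Set X} {c : Chain κ (n + 1) X} (hc : c ∈ chainsIn κ (n + 1) A) :
    bd κ n c ∈ chainsIn κ n A := by
  refine map_chainsOf_le (fun σ hσ => ?_) hc
  rw [bd_single]
  refine Submodule.sum_mem _ fun i _ => Submodule.smul_mem _ _ ?_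
  refine Finsupp.single_mem_supported _ _ ?_
  exact (Set.range_comp_subset_range _ σ).trans hσ

theorem bd_bd (n : ℕ) (c : Chain κ (n + 2) X) : bd κ n (bd κ (n + 1) c) = 0 := by
  apply (toSingular_bijective κ n).1
  rw [← toSingular_bd, ← toSingular_bd, map_zero]
  exact congrArg (fun f => f.hom (toSingular κ (n + 2) c))
    ((singularComplex κ X).d_comp_d (n + 2) (n + 1) n)

theorem dd_bd (n : ℕ) (c : Chain κ (n + 1) X) : dd κ n (bd κ n c) = 0 := by
  cases n with
  | zero => rfl
  | succ n => exact bd_bd κ n c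

/-- The chain in `X` obtained from a chain of tuples by composing affine simplices with `σ`. -/
def push {n : ℕ} (σ : Simplex n X) (k : ℕ) :
    TupleChain κ (stdSimplex ℝ (Fin (n + 1))) (k + 1) →ₗ[κ] Chain κ k X :=
  Finsupp.lmapDomain κ κ fun v => σ.comp (aff v)

@[simp]
theorem push_single {n : ℕ} (σ : Simplex n X) (k : ℕ) (v) (a : κ) :
    push κ σ k (Finsupp.single v a) = Finsupp.single (σ.comp (aff v)) a := by
  simp [push, Finsupp.mapDomain_single]

theorem push_mem {n : ℕ} {A : Set X} {σ : Simplex n X} (hσ : σ ∈ simplicesIn n A) (k : ℕ) (c) :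
    push κ σ k c ∈ chainsIn κ k A := by
  induction c using Finsupp.induction_linear with
  | zero => simp
  | add f g hf hg => rw [map_add]; exact Submodule.add_mem _ hf hg
  | single v a =>
    rw [push_single]
    exact Finsupp.single_mem_supported _ _ ((Set.range_comp_subset_range _ σ).trans hσ)

theorem aff_comp_vertices {n m : ℕ} (u : Fin (m + 1) → stdSimplex ℝ (Fin (n + 1))) :
    aff u ∘ vertices m = u := by
  funext j
  exact aff_vertex _ _

theorem bd_push {n : ℕ} (σ : Simplex n X) (k : ℕ) (c) :
    bd κ k (push κ σ (k + 1) c) = push κ σ k (tupleBd κ (k + 1) c) := by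
  refine DFunLike.congr_fun (f := bd κ k ∘ₗ push κ σ (k + 1))
    (g := push κ σ k ∘ₗ tupleBd κ (k + 1)) (TupleChain.hom_ext fun v => ?_) c
  simp only [LinearMap.comp_apply, push_single, bd_single, tupleBd_single, map_sum, map_smul]
  refine Finset.sum_congr rfl fun i _ => ?_
  rw [ContinuousMap.comp_assoc, faceMap_eq_aff, aff_comp_aff, ← Function.comp_assoc,
    aff_comp_vertices]

theorem push_comp_aff {n m : ℕ} (σ : Simplex n X) (u : Fin (m + 1) → stdSimplex ℝ (Fin (n + 1)))
    (k : ℕ) (c) : push κ (σ.comp (aff u)) k c = push κ σ k (tupleMap κ (k + 1) (aff u) c) := by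
  refine DFunLike.congr_fun (f := push κ (σ.comp (aff u)) k)
    (g := push κ σ k ∘ₗ tupleMap κ (k + 1) (aff u)) (TupleChain.hom_ext fun v => ?_) c
  simp only [LinearMap.comp_apply, push_single, tupleMap_single, ContinuousMap.comp_assoc,
    aff_comp_aff]

/-- Barycentric subdivision of singular chains. -/
def sd (n : ℕ) : Chain κ n X →ₗ[κ] Chain κ n X :=
  Finsupp.linearCombination κ fun σ =>
    push κ σ n (subdiv κ bary (n + 1) (Finsupp.single (vertices n) 1))

/-- The homotopy between barycentric subdivision and the identity. -/
def sdHomotopy (n : ℕ) : Chain κ n X →ₗ[κ] Chain κ (n + 1) X :=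
  Finsupp.linearCombination κ fun σ =>
    push κ σ (n + 1) (subdivHomotopy κ bary (n + 1) (Finsupp.single (vertices n) 1))

theorem sd_single (n : ℕ) (σ : Simplex n X) : sd κ n (Finsupp.single σ 1) =
    push κ σ n (subdiv κ bary (n + 1) (Finsupp.single (vertices n) 1)) := by
  simp [sd]

theorem sdHomotopy_single (n : ℕ) (σ : Simplex n X) : sdHomotopy κ n (Finsupp.single σ 1) =
    push κ σ (n + 1) (subdivHomotopy κ bary (n + 1) (Finsupp.single (vertices n) 1)) := by
  simp [sdHomotopy]

/-- Affine maps preserve barycenters, so subdividing `σ ∘ aff v` means subdividing the tuple `v`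
before pushing. As `σ` itself is pushed from `vertices n`, identities for `sd` reduce to identities
for tuples. -/
theorem sd_push {n : ℕ} (σ : Simplex n X) (k : ℕ) (c) :
    sd κ k (push κ σ k c) = push κ σ k (subdiv κ bary (k + 1) c) := by
  refine DFunLike.congr_fun (f := sd κ k ∘ₗ push κ σ k)
    (g := push κ σ k ∘ₗ subdiv κ bary (k + 1)) (TupleChain.hom_ext fun v => ?_) c
  simp only [LinearMap.comp_apply, push_single]
  rw [sd_single, push_comp_aff, tupleMap_subdiv _ (fun k w => aff_bary v k w), tupleMap_single,
    aff_comp_vertices]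

theorem sdHomotopy_push {n : ℕ} (σ : Simplex n X) (k : ℕ) (c) :
    sdHomotopy κ k (push κ σ k c) = push κ σ (k + 1) (subdivHomotopy κ bary (k + 1) c) := by
  refine DFunLike.congr_fun (f := sdHomotopy κ k ∘ₗ push κ σ k)
    (g := push κ σ (k + 1) ∘ₗ subdivHomotopy κ bary (k + 1)) (TupleChain.hom_ext fun v => ?_) c
  simp only [LinearMap.comp_apply, push_single]
  rw [sdHomotopy_single, push_comp_aff, tupleMap_subdivHomotopy _ (fun k w => aff_bary v k w),
    tupleMap_single, aff_comp_vertices]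

theorem push_vertices {n : ℕ} (σ : Simplex n X) :
    push κ σ n (Finsupp.single (vertices n) 1) = Finsupp.single σ 1 := by
  rw [push_single, aff_vertices, ContinuousMap.comp_id]

theorem bd_sd (n : ℕ) (c : Chain κ (n + 1) X) : bd κ n (sd κ (n + 1) c) = sd κ n (bd κ n c) := by
  refine DFunLike.congr_fun (f := bd κ n ∘ₗ sd κ (n + 1))
    (g := sd κ n ∘ₗ bd κ n) (Chain.hom_ext fun σ => ?_) c
  simp only [LinearMap.comp_apply]
  rw [← push_vertices, sd_push, bd_push, tupleBd_subdiv, bd_push, sd_push]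

theorem bd_sdHomotopy_zero (c : Chain κ 0 X) : bd κ 0 (sdHomotopy κ 0 c) = c - sd κ 0 c := by
  refine DFunLike.congr_fun (f := bd κ 0 ∘ₗ sdHomotopy κ 0)
    (g := LinearMap.id - sd κ 0) (Chain.hom_ext fun σ => ?_) c
  simp only [LinearMap.comp_apply, LinearMap.sub_apply, LinearMap.id_apply]
  rw [← push_vertices, sdHomotopy_push, bd_push, tupleBd_subdivHomotopy, sd_push]
  simp [subdivHomotopy]

theorem bd_sdHomotopy (n : ℕ) (c : Chain κ (n + 1) X) : bd κ (n + 1) (sdHomotopy κ (n + 1) c) =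
    c - sd κ (n + 1) c - sdHomotopy κ n (bd κ n c) := by
  refine DFunLike.congr_fun (f := bd κ (n + 1) ∘ₗ sdHomotopy κ (n + 1))
    (g := LinearMap.id - sd κ (n + 1) - sdHomotopy κ n ∘ₗ bd κ n) (Chain.hom_ext fun σ => ?_) c
  simp only [LinearMap.comp_apply, LinearMap.sub_apply, LinearMap.id_apply]
  rw [← push_vertices, sdHomotopy_push, bd_push, tupleBd_subdivHomotopy, sd_push, bd_push,
    sdHomotopy_push, map_sub, map_sub]

theorem bd_sdHomotopy_of_cycle {n : ℕ} {z : Chain κ n X} (hz : dd κ n z = 0) :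
    bd κ n (sdHomotopy κ n z) = z - sd κ n z := by
  cases n with
  | zero => exact bd_sdHomotopy_zero κ z
  | succ n =>
    rw [bd_sdHomotopy, show bd κ n z = 0 from hz, map_zero, sub_zero]

theorem dd_sd {n : ℕ} {z : Chain κ n X} (hz : dd κ n z = 0) : dd κ n (sd κ n z) = 0 := by
  cases n with
  | zero => rfl
  | succ n =>
    change bd κ n _ = 0
    rw [bd_sd, show bd κ n z = 0 from hz, map_zero]

theorem sd_mem {n : ℕ} {A : Set X} {c : Chain κ n X} (hc : c ∈ chainsIn κ n A) :
    sd κ n c ∈ chainsIn κ n A := by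
  refine map_chainsOf_le (fun σ hσ => ?_) hc
  rw [sd_single]
  exact push_mem κ hσ _ _

variable {κ} {ι : Type*} {U : ι → Set X}

theorem chainsIn_le_small (n : ℕ) (i : ι) : chainsIn κ n (U i) ≤ chainsOf κ n (smallSimplices n U) :=
  Finsupp.supported_mono (Set.subset_iUnion (fun i => simplicesIn n (U i)) i)

theorem sd_mem_small {n : ℕ} {c : Chain κ n X} (hc : c ∈ chainsOf κ n (smallSimplices n U)) :
    sd κ n c ∈ chainsOf κ n (smallSimplices n U) := by
  refine map_chainsOf_le (fun σ hσ => ?_) hc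
  obtain ⟨i, hi⟩ := Set.mem_iUnion.1 hσ
  rw [sd_single]
  exact chainsIn_le_small n i (push_mem κ hi _ _)

theorem sdHomotopy_mem_small {n : ℕ} {c : Chain κ n X}
    (hc : c ∈ chainsOf κ n (smallSimplices n U)) :
    sdHomotopy κ n c ∈ chainsOf κ (n + 1) (smallSimplices (n + 1) U) := by
  refine map_chainsOf_le (fun σ hσ => ?_) hc
  obtain ⟨i, hi⟩ := Set.mem_iUnion.1 hσ
  rw [sdHomotopy_single]
  exact chainsIn_le_small _ i (push_mem κ hi _ _)

theorem sdHomotopy_mem {n : ℕ} {A : Set X} {c : Chain κ n X} (hc : c ∈ chainsIn κ n A) :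
    sdHomotopy κ n c ∈ chainsIn κ (n + 1) A := by
  refine map_chainsOf_le (fun σ hσ => ?_) hc
  rw [sdHomotopy_single]
  exact push_mem κ hσ _ _

theorem subdiv_iterate_mesh {n k : ℕ} {D : ℝ} (v : Fin (k + 1) → stdSimplex ℝ (Fin (n + 1)))
    (hv : ∀ i j, dist (v i) (v j) ≤ D) (N : ℕ) :
    (subdiv κ bary (k + 1))^[N] (Finsupp.single v 1) ∈ Finsupp.supported κ κ
      {w | ∀ i j, dist (w i) (w j) ≤ ((k : ℝ) / (k + 1)) ^ N * D} := by
  induction N with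
  | zero =>
    refine Finsupp.single_mem_supported _ _ ?_
    simpa using hv
  | succ N ih =>
    rw [Function.iterate_succ_apply']
    have hle : Finsupp.supported κ κ {w : Fin (k + 1) → stdSimplex ℝ (Fin (n + 1)) |
        ∀ i j, dist (w i) (w j) ≤ ((k : ℝ) / (k + 1)) ^ N * D} ≤
        (Finsupp.supported κ κ {w : Fin (k + 1) → stdSimplex ℝ (Fin (n + 1)) |
        ∀ i j, dist (w i) (w j) ≤ ((k : ℝ) / (k + 1)) ^ (N + 1) * D}).comap
        (subdiv κ bary (k + 1)) := by
      rw [Finsupp.supported_eq_span_single, Submodule.span_le]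
      rintro _ ⟨w, hw, rfl⟩
      refine Finsupp.supported_mono ?_ (subdiv_mesh w)
      rintro u ⟨h1, -⟩ i j
      refine (h1 _ hw i j).trans_eq ?_
      ring
    exact hle ih

/-- For one simplex this is the Lebesgue number lemma with the decay of the mesh. Small chains stay
small under subdivision, so the chains which eventually become small form a subspace. -/
theorem exists_sd_iterate_small {Y : Set X} {O : ι → Set X} (hO : ∀ i, IsOpen (O i))
    (hY : Y ⊆ ⋃ i, O i) (hU : ∀ i, Y ∩ O i ⊆ U i) {n : ℕ} {c : Chain κ n X}
    (hc : c ∈ chainsIn κ n Y) :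
    ∃ N, (sd κ n)^[N] c ∈ chainsOf κ n (smallSimplices n U) := by
  have hiter : ∀ (c : Chain κ n X) (N M : ℕ), N ≤ M →
      (sd κ n)^[N] c ∈ chainsOf κ n (smallSimplices n U) →
      (sd κ n)^[M] c ∈ chainsOf κ n (smallSimplices n U) := by
    intro c N M hNM h
    induction M, hNM using Nat.le_induction with
    | base => exact h
    | succ M _ ih => rw [Function.iterate_succ_apply']; exact sd_mem_small ih
  have hadd : ∀ (N : ℕ), (sd κ (X := X) n)^[N] = ((sd κ n) ^ N : Module.End κ (Chain κ n X)) := by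
    intro N
    exact (Module.End.coe_pow _ _).symm
  let S : Submodule κ (Chain κ n X) :=
    { carrier := {c | ∃ N, (sd κ n)^[N] c ∈ chainsOf κ n (smallSimplices n U)}
      zero_mem' := ⟨0, Submodule.zero_mem _⟩
      add_mem' := by
        rintro a b ⟨N, hN⟩ ⟨M, hM⟩
        refine ⟨N + M, ?_⟩
        have h1 := hiter _ _ (N + M) (by omega) hN
        have h2 := hiter _ _ (N + M) (by omega) hM
        rw [hadd] at h1 h2 ⊢
        rw [map_add]
        exact Submodule.add_mem _ h1 h2
      smul_mem' := by
        rintro a c ⟨N, hN⟩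
        refine ⟨N, ?_⟩
        rw [hadd] at hN ⊢
        rw [map_smul]
        exact Submodule.smul_mem _ _ hN }
  change c ∈ S
  refine map_chainsOf_le (f := LinearMap.id) (fun σ hσ => ?_) hc
  obtain ⟨δ, hδ, hleb⟩ := lebesgue_number_lemma_of_metric (isCompact_univ (X := stdSimplex ℝ
    (Fin (n + 1)))) (c := fun i => σ ⁻¹' (O i)) (fun i => (hO i).preimage σ.continuous)
    (fun x _ => by
      have := hY (hσ ⟨x, rfl⟩)
      simpa using this)
  obtain ⟨N, hN⟩ : ∃ N : ℕ, ((n : ℝ) / (n + 1)) ^ N < δ / 2 :=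
    exists_pow_lt_of_lt_one (by positivity) (by rw [div_lt_one (by positivity)]; linarith)
  refine ⟨N, ?_⟩
  have hpush : ∀ M, (sd κ n)^[M] (Finsupp.single σ 1) =
      push κ σ n ((subdiv κ bary (n + 1))^[M] (Finsupp.single (vertices n) 1)) := by
    intro M
    induction M with
    | zero => exact (push_vertices κ σ).symm
    | succ M ih => rw [Function.iterate_succ_apply', ih, sd_push, Function.iterate_succ_apply']
  rw [LinearMap.id_apply, hpush]
  -- Coordinates lie in `[0, 1]`, so the vertices have mutual sup distance at most `1`.
  have hmesh := subdiv_iterate_mesh (κ := κ) (D := 1) (vertices n) (fun i j => by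
    rw [Subtype.dist_eq, dist_pi_le_iff zero_le_one]
    intro l
    refine (Real.dist_le_of_mem_Icc_01 ?_ ?_)
    · exact mem_Icc_of_mem_stdSimplex (vertices n i).2 l
    · exact mem_Icc_of_mem_stdSimplex (vertices n j).2 l) N
  generalize (subdiv κ bary (n + 1))^[N] (Finsupp.single (vertices n) 1) = d at hmesh
  have hle : Finsupp.supported κ κ {w : Fin (n + 1) → stdSimplex ℝ (Fin (n + 1)) |
        ∀ i j, dist (w i) (w j) ≤ ((n : ℝ) / (n + 1)) ^ N * 1} ≤
        (chainsOf κ n (smallSimplices n U)).comap (push κ σ n) := by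
    rw [Finsupp.supported_eq_span_single, Submodule.span_le]
    rintro _ ⟨w, hw, rfl⟩
    rw [SetLike.mem_coe, Submodule.mem_comap, push_single]
    obtain ⟨i, hi⟩ := hleb (w 0) (Set.mem_univ _)
    refine Finsupp.single_mem_supported _ _ (Set.mem_iUnion.2 ⟨i, ?_⟩)
    rintro _ ⟨x, rfl⟩
    refine hU i ⟨hσ ⟨_, rfl⟩, hi ?_⟩
    rw [Metric.mem_ball, dist_comm]
    refine (dist_aff_le (fun j => hw 0 j) x).trans_lt ?_
    linarith
  exact hle hmesh

/-- Cycles are homologous to small cycles. -/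
theorem exists_small_cycle {Y : Set X} {O : ι → Set X} (hO : ∀ i, IsOpen (O i))
    (hY : Y ⊆ ⋃ i, O i) (hU : ∀ i, Y ∩ O i ⊆ U i) {n : ℕ} {z : Chain κ n X}
    (hc : z ∈ chainsIn κ n Y) (hz : dd κ n z = 0) :
    ∃ z' ∈ chainsOf κ n (smallSimplices n U), dd κ n z' = 0 ∧
      ∃ w ∈ chainsIn κ (n + 1) Y, bd κ n w = z - z' := by
  obtain ⟨N, hN⟩ := exists_sd_iterate_small hO hY hU hc
  refine ⟨_, hN, ?_⟩
  clear hN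
  induction N generalizing z with
  | zero => exact ⟨hz, 0, Submodule.zero_mem _, by simp⟩
  | succ N ih =>
    obtain ⟨h1, w, hw, hwz⟩ := ih (sd_mem κ hc) (dd_sd κ hz)
    refine ⟨h1, w + sdHomotopy κ n z, Submodule.add_mem _ hw (sdHomotopy_mem hc), ?_⟩
    rw [map_add, hwz, bd_sdHomotopy_of_cycle κ hz, Function.iterate_succ_apply]
    abel

/-- A small cycle which bounds is the boundary of a small chain. -/
theorem exists_small_boundary {Y : Set X} {O : ι → Set X} (hO : ∀ i, IsOpen (O i))
    (hY : Y ⊆ ⋃ i, O i) (hU : ∀ i, Y ∩ O i ⊆ U i) {n : ℕ} {w : Chain κ (n + 1) X}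
    (hc : w ∈ chainsIn κ (n + 1) Y) (hz : bd κ n w ∈ chainsOf κ n (smallSimplices n U)) :
    ∃ w' ∈ chainsOf κ (n + 1) (smallSimplices (n + 1) U), bd κ n w' = bd κ n w := by
  obtain ⟨N, hN⟩ := exists_sd_iterate_small hO hY hU hc
  induction N generalizing w with
  | zero => exact ⟨w, hN, rfl⟩
  | succ N ih =>
    obtain ⟨w', hw', h⟩ := ih (sd_mem κ hc) (by rw [bd_sd]; exact sd_mem_small hz) hN
    -- The chain `w'` has boundary `sd (bd w)`. The homotopy from `bd w` to its subdivision is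
    -- small, because `bd w` is, and adding it restores the boundary `bd w`.
    refine ⟨w' + sdHomotopy κ n (bd κ n w), Submodule.add_mem _ hw' (sdHomotopy_mem_small hz), ?_⟩
    rw [map_add, h, bd_sdHomotopy_of_cycle κ (dd_bd κ n w), bd_sd]
    abel

end Subdivision

end CircleValued

end

noncomputable section

open CategoryTheory AlgebraicTopology

namespace CircleValued

/-! ### Homology of subsets by chains of the ambient space. -/

section Subsets

variable (κ : Type v) [Field κ] {X : Type u} [TopologicalSpace X]

/-- The homology of a subset. -/
abbrev setHomology (r : ℕ) (A : Set X) : ModuleCat.{max u v} κ :=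
  (homology.{u, v} κ r).obj (TopCat.of A)

/-- The map in homology induced by an inclusion of subsets. -/
def incl (r : ℕ) {A B : Set X} (h : A ⊆ B) : setHomology κ r A →ₗ[κ] setHomology κ r B :=
  (homologyMap κ r ⟨Set.inclusion h, continuous_inclusion h⟩).hom

variable {κ} in
theorem homologyMap_comp (r : ℕ) {A B C : Type u} [TopologicalSpace A] [TopologicalSpace B]
    [TopologicalSpace C] (f : C(A, B)) (g : C(B, C)) (x) :
    (homologyMap κ r g).hom ((homologyMap κ r f).hom x) = (homologyMap κ r (g.comp f)).hom x :=
  (congrArg (fun f => f.hom x) ((homology κ r).map_comp (TopCat.ofHom f) (TopCat.ofHom g))).symm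

variable {κ} in
theorem homologyMap_id (r : ℕ) {A : Type u} [TopologicalSpace A] (x) :
    (homologyMap κ r (ContinuousMap.id A)).hom x = x :=
  congrArg (fun f => f.hom x) ((homology κ r).map_id (TopCat.of A))

variable {κ} in
@[simp]
theorem incl_incl (r : ℕ) {A B C : Set X} (h : A ⊆ B) (h' : B ⊆ C) (x) :
    incl κ r h' (incl κ r h x) = incl κ r (h.trans h') x :=
  homologyMap_comp r _ _ x

/-- The cycles in a subset. -/
def cyclesIn (r : ℕ) (A : Set X) : Submodule κ (Chain κ r X) :=
  chainsIn κ r A ⊓ LinearMap.ker (dd κ r)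

/-- The inclusion of a subset. -/
def subsetMap (A : Set X) : C(A, X) := ⟨Subtype.val, continuous_subtype_val⟩

theorem comp_subsetMap_injective (n : ℕ) (A : Set X) :
    Function.Injective fun σ : Simplex n A => (subsetMap A).comp σ := by
  intro σ τ h
  ext x
  exact DFunLike.congr_fun h x

/-- The part of a chain which is contained in a subset. -/
def restrictChain (n : ℕ) (A : Set X) : Chain κ n X →ₗ[κ] Chain κ n A :=
  Finsupp.lcomapDomain _ (comp_subsetMap_injective n A)

theorem restrictChain_chainMap (n : ℕ) (A : Set X) (c : Chain κ n A) :
    restrictChain κ n A (chainMap κ n (subsetMap A) c) = c :=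
  Finsupp.comapDomain_mapDomain _ (comp_subsetMap_injective n A) _

theorem chainMap_restrictChain {n : ℕ} {A : Set X} {c : Chain κ n X} (hc : c ∈ chainsIn κ n A) :
    chainMap κ n (subsetMap A) (restrictChain κ n A c) = c := by
  refine Finsupp.mapDomain_comapDomain _ (comp_subsetMap_injective n A) _ ?_
  intro σ hσ
  have h : Set.range σ ⊆ A := hc hσ
  exact ⟨⟨fun x => ⟨σ x, h ⟨x, rfl⟩⟩, by fun_prop⟩, rfl⟩

theorem chainMap_mem (n : ℕ) (A : Set X) (c : Chain κ n A) :
    chainMap κ n (subsetMap A) c ∈ chainsIn κ n A := by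
  induction c using Finsupp.induction_linear with
  | zero => simp
  | add f g hf hg => rw [map_add]; exact Submodule.add_mem _ hf hg
  | single σ a =>
    rw [chainMap, Finsupp.lmapDomain_apply, Finsupp.mapDomain_single]
    refine Finsupp.single_mem_supported _ _ ?_
    rintro _ ⟨x, rfl⟩
    exact (σ x).2

theorem bd_chainMap {Y : Type u} [TopologicalSpace Y] (n : ℕ) (φ : C(X, Y)) (c) :
    bd κ n (chainMap κ (n + 1) φ c) = chainMap κ n φ (bd κ n c) := by
  refine DFunLike.congr_fun (f := bd κ n ∘ₗ chainMap κ (n + 1) φ)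
    (g := chainMap κ n φ ∘ₗ bd κ n) (Chain.hom_ext fun σ => ?_) c
  simp [chainMap, bd_single, Finsupp.mapDomain_single, ContinuousMap.comp_assoc]

theorem dd_chainMap {Y : Type u} [TopologicalSpace Y] (n : ℕ) (φ : C(X, Y)) (c) :
    dd κ n (chainMap κ n φ c) = chainMap κ (n - 1) φ (dd κ n c) := by
  cases n with
  | zero => simp [dd]
  | succ n => exact bd_chainMap κ n φ c

theorem chainMap_subsetMap_injective (n : ℕ) (A : Set X) :
    Function.Injective (chainMap κ n (subsetMap A)) :=
  Function.LeftInverse.injective (restrictChain_chainMap κ n A)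

/-- The homology class of a cycle in a subset. -/
def clsIn (r : ℕ) (A : Set X) : cyclesIn κ r A →ₗ[κ] setHomology κ r A :=
  cls κ r ∘ₗ (restrictChain κ r A).restrict (p := cyclesIn κ r A) (q := LinearMap.ker (dd κ r))
    (fun z hz => by
      rw [LinearMap.mem_ker]
      apply chainMap_subsetMap_injective
      rw [← dd_chainMap, chainMap_restrictChain κ hz.1, map_zero]
      exact hz.2)

theorem clsIn_surjective (r : ℕ) (A : Set X) : Function.Surjective (clsIn κ r A) := by
  refine (cls_surjective κ r).comp ?_
  rintro ⟨z, hz⟩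
  refine ⟨⟨chainMap κ r (subsetMap A) z, chainMap_mem κ r A z, ?_⟩, Subtype.ext ?_⟩
  · rw [SetLike.mem_coe, LinearMap.mem_ker, dd_chainMap, LinearMap.mem_ker.1 hz, map_zero]
  · exact restrictChain_chainMap κ r A z

variable {κ}

/-- Chains of all subsets are kept in the chains of `X`, where chains of different subsets can be
added and their supports intersected. This criterion makes such chains sufficient for homology. -/
theorem clsIn_eq_zero_iff {r : ℕ} {A : Set X} (z : cyclesIn κ r A) :
    clsIn κ r A z = 0 ↔ ∃ w ∈ chainsIn κ (r + 1) A, bd κ r w = z.1 := by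
  refine (cls_eq_zero_iff κ _).trans ?_
  constructor
  · rintro ⟨w, hw⟩
    refine ⟨chainMap κ _ (subsetMap A) w, chainMap_mem κ _ A w, ?_⟩
    rw [bd_chainMap, hw]
    exact chainMap_restrictChain κ z.2.1
  · rintro ⟨w, hw, hz⟩
    refine ⟨restrictChain κ _ A w, chainMap_subsetMap_injective κ _ A ?_⟩
    rw [← bd_chainMap, chainMap_restrictChain κ hw, hz]
    exact (chainMap_restrictChain κ z.2.1).symm

theorem clsIn_eq_iff {r : ℕ} {A : Set X} (z z' : cyclesIn κ r A) :
    clsIn κ r A z = clsIn κ r A z' ↔ ∃ w ∈ chainsIn κ (r + 1) A, bd κ r w = z.1 - z'.1 := by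
  rw [← sub_eq_zero, ← map_sub, clsIn_eq_zero_iff]
  rfl

theorem cyclesIn_mono {r : ℕ} {A B : Set X} (h : A ⊆ B) : cyclesIn κ r A ≤ cyclesIn κ r B :=
  inf_le_inf_right _ (chainsIn_mono h)

theorem incl_clsIn {r : ℕ} {A B : Set X} (h : A ⊆ B) (z : cyclesIn κ r A) :
    incl κ r h (clsIn κ r A z) = clsIn κ r B ⟨z.1, cyclesIn_mono h z.2⟩ := by
  refine homologyMap_cls κ _ _ _ ?_
  apply chainMap_subsetMap_injective
  refine (chainMap_restrictChain κ (chainsIn_mono h z.2.1)).trans ?_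
  refine (chainMap_restrictChain κ z.2.1).symm.trans ?_
  change _ = (chainMap κ r (subsetMap B) ∘ₗ chainMap κ r _) _
  rw [chainMap, chainMap, chainMap, ← Finsupp.lmapDomain_comp]
  rfl

theorem chainsIn_empty (n : ℕ) {c : Chain κ n X} (hc : c ∈ chainsIn κ n ∅) : c = 0 := by
  have : simplicesIn n (∅ : Set X) = ∅ := by
    ext σ
    simp [simplicesIn, Set.range_eq_empty_iff]
  rw [chainsIn, chainsOf, this, Finsupp.supported_empty] at hc
  exact hc

theorem setHomology_empty (r : ℕ) {A : Set X} (hA : A = ∅) :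
    Subsingleton (setHomology κ r A) := by
  subst hA
  refine ⟨fun x y => ?_⟩
  obtain ⟨a, rfl⟩ := clsIn_surjective κ r _ x
  obtain ⟨b, rfl⟩ := clsIn_surjective κ r _ y
  congr 1
  ext1
  rw [chainsIn_empty r a.2.1, chainsIn_empty r b.2.1]

end Subsets

/-! ### The Mayer-Vietoris sequence of a linear cover -/

section Rotate

variable {m : ℕ}

theorem finRotate_val_of_lt {i : Fin m} (h : i.val + 1 < m) : (finRotate m i).val = i.val + 1 := by
  obtain _ | n := m
  · exact i.elim0
  · rw [finRotate_apply, Fin.val_add_one_of_lt]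
    rw [Fin.lt_def, Fin.val_last]; omega

theorem finRotate_val_of_eq {i : Fin m} (h : i.val + 1 = m) : (finRotate m i).val = 0 := by
  obtain _ | n := m
  · exact i.elim0
  · have : i = Fin.last n := by ext; simp; omega
    rw [this, finRotate_last]; rfl

/-- The value `0` spreads upward from the first index; the relation that wraps around from the last
index is not needed. -/
theorem eq_zero_of_eq_finRotate {M : Type*} [Zero M] {e : Fin m → M}
    (h0 : ∀ i, i.val = 0 → e i = 0) (h : ∀ i, e i = e (finRotate m i)) : e = 0 := by
  have : ∀ n (hn : n < m), e ⟨n, hn⟩ = 0 := by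
    intro n
    induction n with
    | zero => exact fun hn => h0 _ rfl
    | succ n ih =>
      intro hn
      have h1 := h ⟨n, by omega⟩
      rw [ih] at h1
      rw [h1]
      congr 1
      ext
      rw [finRotate_val_of_lt (i := ⟨n, by omega⟩) hn]
  funext i
  exact this i.1 i.2

/-- The partial sums of a finite family, up to sign. -/
def partialSum {κ M : Type*} [Field κ] [AddCommGroup M] [Module κ M] :
    (Fin m → M) →ₗ[κ] (Fin m → M) :=
  LinearMap.pi fun j => - ∑ i ∈ Finset.Iio j, LinearMap.proj i

theorem partialSum_apply {κ M : Type*} [Field κ] [AddCommGroup M] [Module κ M] (c : Fin m → M)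
    (j : Fin m) : partialSum (κ := κ) c j = - ∑ i ∈ Finset.Iio j, c i := by
  simp [partialSum]

/-- The difference telescopes. At the last index the successor is `0`, with an empty partial sum,
and the formula holds there because the total sum is zero. -/
theorem partialSum_sub {κ M : Type*} [Field κ] [AddCommGroup M] [Module κ M] {c : Fin m → M}
    (hc : ∑ i, c i = 0) (i : Fin m) :
    partialSum (κ := κ) c i - partialSum (κ := κ) c (finRotate m i) = c i := by
  rw [partialSum_apply, partialSum_apply]
  rcases Nat.lt_or_ge (i.val + 1) m with h | h
  · have : Finset.Iio (finRotate m i) = insert i (Finset.Iio i) := by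
      ext j
      simp only [Finset.mem_Iio, Finset.mem_insert, Fin.lt_def, Fin.ext_iff, finRotate_val_of_lt h]
      omega
    rw [this, Finset.sum_insert (by simp)]
    abel
  · have hi : i.val + 1 = m := by omega
    have h1 : Finset.Iio (finRotate m i) = ∅ := by
      ext j
      simp only [Finset.mem_Iio, Fin.lt_def, finRotate_val_of_eq hi]
      simp
    have h2 : Finset.univ = insert i (Finset.Iio i) := by
      ext j
      simp only [Finset.mem_Iio, Finset.mem_insert, Fin.lt_def, Fin.ext_iff, Finset.mem_univ,
        true_iff]
      omega
    rw [h1]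
    rw [h2, Finset.sum_insert (by simp)] at hc
    simp only [Finset.sum_empty, neg_zero, sub_zero]
    exact (eq_neg_of_add_eq_zero_left hc).symm

end Rotate

variable {X : Type u} [TopologicalSpace X]

/-- A relatively open cover `U` of `Y` whose nerve is a segment. The set `V i` is the intersection
of `U (i - 1)` and `U i`. -/
structure IsLinearCover {m : ℕ} (Y : Set X) (U V : Fin m → Set X) : Prop where
  sub : ∀ i, U i ⊆ Y
  cover : Y ⊆ ⋃ i, U i
  isOpen : ∀ i, ∃ O, IsOpen O ∧ U i = Y ∩ O
  left : ∀ i, V i ⊆ U i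
  right : ∀ i, V (finRotate m i) ⊆ U i
  inter : ∀ i j, i.val + 1 = j.val → U i ∩ U j ⊆ V j
  disjoint : ∀ i j, i.val + 2 ≤ j.val → U i ∩ U j = ∅
  first : ∀ i, i.val = 0 → V i = ∅

namespace IsLinearCover

variable {m : ℕ} {Y : Set X} {U V : Fin m → Set X} (h : IsLinearCover Y U V)
  (κ : Type v) [Field κ]

theorem sum_mem_small {n : ℕ} {c : Fin m → Chain κ n X} (hc : ∀ i, c i ∈ chainsIn κ n (U i)) :
    ∑ i, c i ∈ chainsOf κ n (smallSimplices n U) :=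
  Submodule.sum_mem _ fun i _ => chainsIn_le_small n i (hc i)

variable {κ} in
theorem exists_sum_of_mem_small {n : ℕ} {c : Chain κ n X}
    (hc : c ∈ chainsOf κ n (smallSimplices n U)) :
    ∃ d : Fin m → Chain κ n X, (∀ i, d i ∈ chainsIn κ n (U i)) ∧ ∑ i, d i = c := by
  rw [chainsOf, smallSimplices, Finsupp.supported_iUnion] at hc
  obtain ⟨μ, hμ⟩ := (Submodule.mem_iSup_iff_exists_finsupp _ _).1 hc
  refine ⟨fun i => μ i, hμ.1, ?_⟩
  rw [← hμ.2, Finsupp.sum_fintype _ _ (fun _ => rfl)]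

-- As the total is zero, the partial sum `-∑_{i<j} c i` is also `∑_{i≥j} c i`. A simplex occurring
-- in it lies in some `U i` with `i < j` and in some `U i'` with `i' ≥ j`. These are disjoint unless
-- `i + 1 = j = i'`, and then meet inside `V j`.
include h in
variable {κ} in
theorem partialSum_mem {n : ℕ} {c : Fin m → Chain κ n X} (hc : ∀ i, c i ∈ chainsIn κ n (U i))
    (hsum : ∑ i, c i = 0) (j : Fin m) : partialSum (κ := κ) c j ∈ chainsIn κ n (V j) := by
  have h1 : partialSum (κ := κ) c j ∈ chainsOf κ n (⋃ i : Set.Iio j, simplicesIn n (U i)) := by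
    rw [partialSum_apply]
    refine Submodule.neg_mem _ (Submodule.sum_mem _ fun i hi => ?_)
    refine Finsupp.supported_mono ?_ (hc i)
    exact Set.subset_iUnion (fun i : Set.Iio j => simplicesIn n (U i)) ⟨i, Finset.mem_Iio.1 hi⟩
  have h2 : partialSum (κ := κ) c j ∈ chainsOf κ n (⋃ i : Set.Ici j, simplicesIn n (U i)) := by
    have : partialSum (κ := κ) c j = ∑ i ∈ Finset.Ici j, c i := by
      rw [partialSum_apply, neg_eq_iff_add_eq_zero, ← hsum, ← Finset.sum_union]
      · congr 1
        ext i
        simpa using lt_or_ge i j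
      · rw [Finset.disjoint_left]
        intro i hi hi'
        exact absurd (Finset.mem_Iio.1 hi) (not_lt.2 (Finset.mem_Ici.1 hi'))
    rw [this]
    refine Submodule.sum_mem _ fun i hi => ?_
    refine Finsupp.supported_mono ?_ (hc i)
    exact Set.subset_iUnion (fun i : Set.Ici j => simplicesIn n (U i)) ⟨i, Finset.mem_Ici.1 hi⟩
  have h3 := Submodule.mem_inf.2 ⟨h1, h2⟩
  rw [← Finsupp.supported_inter] at h3
  refine Finsupp.supported_mono ?_ h3
  rintro σ ⟨hσ, hσ'⟩
  obtain ⟨⟨i, hi⟩, hσi⟩ := Set.mem_iUnion.1 hσ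
  obtain ⟨⟨i', hi'⟩, hσi'⟩ := Set.mem_iUnion.1 hσ'
  have hlt : i.val < j.val := hi
  have hle : j.val ≤ i'.val := hi'
  have hsub : Set.range σ ⊆ U i ∩ U i' := Set.subset_inter hσi hσi'
  rcases Nat.lt_or_ge (i.val + 1) i'.val with hij | hij
  · rw [h.disjoint i i' hij] at hsub
    exact absurd (hsub ⟨Classical.arbitrary _, rfl⟩) (Set.notMem_empty _)
  · obtain rfl : i' = j := Fin.ext (by omega)
    exact hsub.trans (h.inter i i' (by omega))

include h in
theorem exists_isOpen : ∃ O : Fin m → Set X, (∀ i, IsOpen (O i)) ∧ Y ⊆ ⋃ i, O i ∧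
    ∀ i, Y ∩ O i ⊆ U i := by
  choose O hO hU using h.isOpen
  refine ⟨O, hO, h.cover.trans (Set.iUnion_mono fun i => ?_), fun i => (hU i).ge⟩
  rw [hU i]
  exact Set.inter_subset_right

/-- The difference of the two restrictions from the intersections to the members of the cover. -/
def diffMap (r : ℕ) :
    (∀ i, setHomology κ r (V i)) →ₗ[κ] ∀ i, setHomology κ r (U i) :=
  LinearMap.pi fun i => incl κ r (h.left i) ∘ₗ LinearMap.proj i -
    incl κ r (h.right i) ∘ₗ LinearMap.proj (finRotate m i)

/-- The sum map from the members of the cover to the whole. -/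
def sumMap (r : ℕ) : (∀ i, setHomology κ r (U i)) →ₗ[κ] setHomology κ r Y :=
  ∑ i, incl κ r (h.sub i) ∘ₗ LinearMap.proj i

variable {κ}

theorem diffMap_apply (r : ℕ) (x) (i : Fin m) : h.diffMap κ r x i =
    incl κ r (h.left i) (x i) - incl κ r (h.right i) (x (finRotate m i)) := rfl

theorem sumMap_apply (r : ℕ) (x) : h.sumMap κ r x = ∑ i, incl κ r (h.sub i) (x i) := by
  simp [sumMap]

theorem sumMap_diffMap (r : ℕ) (x) : h.sumMap κ r (h.diffMap κ r x) = 0 := by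
  rw [sumMap_apply]
  simp only [diffMap_apply, map_sub, incl_incl, Finset.sum_sub_distrib]
  rw [sub_eq_zero]
  refine (Equiv.sum_comp (finRotate m)
    fun i => incl κ r ((h.left i).trans (h.sub i)) (x i)).symm.trans ?_
  rfl

theorem sumMap_clsIn (r : ℕ) (z : ∀ i, cyclesIn κ r (U i)) :
    h.sumMap κ r (fun i => clsIn κ r _ (z i)) =
      clsIn κ r Y ⟨∑ i, (z i).1, Submodule.sum_mem _ fun i _ => cyclesIn_mono (h.sub i) (z i).2⟩ := by
  rw [sumMap_apply]
  simp only [incl_clsIn]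
  rw [← map_sum]
  congr 1
  ext1
  simp

theorem exists_clsIn {r : ℕ} {A : Fin m → Set X} (x : ∀ i, setHomology κ r (A i)) :
    ∃ z : ∀ i, cyclesIn κ r (A i), x = fun i => clsIn κ r _ (z i) := by
  choose z hz using fun i => clsIn_surjective κ r (A i) (x i)
  exact ⟨z, funext fun i => (hz i).symm⟩

include h in
/-- A family of chains whose sum bounds can be corrected to a family with sum zero. -/
theorem exists_correction {r : ℕ} {c : Fin m → Chain κ r X} (hc : ∀ i, c i ∈ chainsIn κ r (U i))
    {w : Chain κ (r + 1) X} (hw : w ∈ chainsIn κ (r + 1) Y) (hwc : bd κ r w = ∑ i, c i) :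
    ∃ d : Fin m → Chain κ (r + 1) X, (∀ i, d i ∈ chainsIn κ (r + 1) (U i)) ∧
      ∑ i, (c i - bd κ r (d i)) = 0 := by
  obtain ⟨O, hO, hY, hU⟩ := h.exists_isOpen
  obtain ⟨w', hw', hbd⟩ := exists_small_boundary hO hY hU hw (by
    rw [hwc]; exact sum_mem_small κ hc)
  obtain ⟨d, hd, rfl⟩ := exists_sum_of_mem_small hw'
  refine ⟨d, hd, ?_⟩
  rw [Finset.sum_sub_distrib, ← map_sum, hbd, hwc, sub_self]

/-- After the correction the representing cycles have sum zero, and their partial sums are chains in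
the `V i` with the right differences. The boundaries of neighboring partial sums agree and the first
one vanishes, so the partial sums are cycles. -/
theorem exists_diffMap_of_sumMap_eq_zero {r : ℕ} {x} (hx : h.sumMap κ r x = 0) :
    ∃ y, h.diffMap κ r y = x := by
  obtain ⟨z, rfl⟩ := exists_clsIn x
  rw [sumMap_clsIn, clsIn_eq_zero_iff] at hx
  obtain ⟨w, hw, hwz⟩ := hx
  obtain ⟨d, hd, hsum⟩ := h.exists_correction (fun i => (z i).2.1) hw hwz
  let e := partialSum (κ := κ) fun i => (z i).1 - bd κ r (d i)
  have he : ∀ i, e i ∈ chainsIn κ r (V i) := h.partialSum_mem (fun i => Submodule.sub_mem _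
    (z i).2.1 (bd_mem κ (hd i))) hsum
  have hdiff : ∀ i, e i - e (finRotate m i) = (z i).1 - bd κ r (d i) := partialSum_sub hsum
  have hcyc : (fun i => dd κ r (e i)) = 0 := by
    refine eq_zero_of_eq_finRotate (fun i hi => ?_) fun i => ?_
    · have := he i
      rw [h.first i hi] at this
      rw [chainsIn_empty r this, map_zero]
    · rw [← sub_eq_zero, ← map_sub, hdiff, map_sub, dd_bd, sub_zero]
      exact (z i).2.2
  refine ⟨fun i => clsIn κ r _ ⟨e i, he i, congrFun hcyc i⟩, ?_⟩
  funext i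
  rw [diffMap_apply, incl_clsIn, incl_clsIn, ← map_sub, clsIn_eq_iff]
  refine ⟨- d i, Submodule.neg_mem _ (hd i), ?_⟩
  rw [map_neg]
  change _ = (e i - e (finRotate m i)) - (z i).1
  rw [hdiff]
  abel

/-- A small chain splits into chains in the members of the cover, and in degree `0` each of these is
automatically a cycle. -/
theorem sumMap_zero_surjective : Function.Surjective (h.sumMap κ 0) := by
  intro x
  obtain ⟨z, rfl⟩ := clsIn_surjective κ 0 Y x
  obtain ⟨O, hO, hY, hU⟩ := h.exists_isOpen
  obtain ⟨z', hz', hdd, w, hw, hwz⟩ := exists_small_cycle hO hY hU z.2.1 z.2.2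
  obtain ⟨d, hd, rfl⟩ := exists_sum_of_mem_small hz'
  refine ⟨fun i => clsIn κ 0 _ ⟨d i, hd i, rfl⟩, ?_⟩
  rw [sumMap_clsIn]
  symm
  rw [clsIn_eq_iff]
  exact ⟨w, hw, hwz⟩

theorem _root_.CircleValued.nonempty_equiv_of_ker_eq {L M N : Type*} [AddCommGroup L] [Module κ L]
    [AddCommGroup M] [Module κ M] [AddCommGroup N] [Module κ N] (p : L →ₗ[κ] M) (q : L →ₗ[κ] N)
    (hp : Function.Surjective p) (hq : Function.Surjective q)
    (h : LinearMap.ker p = LinearMap.ker q) : Nonempty (M ≃ₗ[κ] N) :=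
  ⟨((p.quotKerEquivOfSurjective hp).symm.trans (Submodule.quotEquivOfEq _ _ h)).trans
    (q.quotKerEquivOfSurjective hq)⟩

/-- The Mayer-Vietoris sequence at the connecting homomorphism. -/
theorem nonempty_quotient_equiv_ker (r : ℕ) :
    Nonempty ((setHomology κ (r + 1) Y ⧸ LinearMap.range (h.sumMap κ (r + 1))) ≃ₗ[κ]
      LinearMap.ker (h.diffMap κ r)) := by
  -- `D` consists of the decompositions of small cycles. It maps onto the left side by the class of
  -- the sum (`p`) and onto the right side by the partial sums of the boundaries (`q`, the
  -- connecting homomorphism). The two kernels agree, so the isomorphism arises without a choice of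
  -- decompositions.
  obtain ⟨D, hD⟩ : ∃ D : Submodule κ (Fin m → Chain κ (r + 1) X), ∀ c, c ∈ D ↔
      (∀ i, c i ∈ chainsIn κ (r + 1) (U i)) ∧ ∑ i, bd κ r (c i) = 0 := by
    refine ⟨Submodule.pi Set.univ (fun i => chainsIn κ (r + 1) (U i)) ⊓
      LinearMap.ker (∑ i, bd κ r ∘ₗ LinearMap.proj i), fun c => ?_⟩
    simp [Submodule.mem_pi]
  let sumL : D →ₗ[κ] cyclesIn κ (r + 1) Y :=
    LinearMap.codRestrict _ ((∑ i, LinearMap.proj i) ∘ₗ D.subtype) (fun c => by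
      obtain ⟨h1, h2⟩ := (hD c.1).1 c.2
      refine ⟨?_, ?_⟩
      · simp only [LinearMap.comp_apply, LinearMap.sum_apply]
        exact Submodule.sum_mem _ fun i _ => chainsIn_mono (h.sub i) (h1 i)
      · change bd κ r _ = 0
        simp only [LinearMap.comp_apply, LinearMap.sum_apply, map_sum]
        exact h2)
  have hsumL : ∀ c, (sumL c).1 = ∑ i, c.1 i := by
    intro c
    simp [sumL]
  let p : D →ₗ[κ] (setHomology κ (r + 1) Y ⧸ LinearMap.range (h.sumMap κ (r + 1))) :=
    Submodule.mkQ _ ∘ₗ clsIn κ (r + 1) Y ∘ₗ sumL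
  let E : D →ₗ[κ] (Fin m → Chain κ r X) :=
    partialSum ∘ₗ (LinearMap.pi fun i => bd κ r ∘ₗ LinearMap.proj i) ∘ₗ D.subtype
  have hEd : ∀ c : D, E c = partialSum (κ := κ) fun i => bd κ r (c.1 i) := fun c => rfl
  have hE1 : ∀ c i, E c i ∈ chainsIn κ r (V i) := by
    intro c i
    obtain ⟨h1, h2⟩ := (hD c.1).1 c.2
    exact h.partialSum_mem (fun i => bd_mem κ (h1 i)) h2 i
  have hE2 : ∀ c i, E c i - E c (finRotate m i) = bd κ r (c.1 i) := by
    intro c i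
    obtain ⟨h1, h2⟩ := (hD c.1).1 c.2
    exact partialSum_sub h2 i
  have hE3 : ∀ c i, dd κ r (E c i) = 0 := by
    intro c
    refine congrFun (f := fun i => dd κ r (E c i)) (eq_zero_of_eq_finRotate (fun i hi => ?_) ?_)
    · have := hE1 c i
      rw [h.first i hi] at this
      rw [chainsIn_empty r this, map_zero]
    · intro i
      rw [← sub_eq_zero, ← map_sub, hE2, dd_bd]
  have hEuniq : ∀ (c : D) (g : Fin m → Chain κ r X), (∀ i, i.val = 0 → g i = 0) →
      (∀ i, g i - g (finRotate m i) = bd κ r (c.1 i)) → E c = g := by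
    intro c g hg0 hg
    rw [← sub_eq_zero]
    refine eq_zero_of_eq_finRotate (fun i hi => ?_) fun i => ?_
    · have := hE1 c i
      rw [h.first i hi] at this
      rw [Pi.sub_apply, chainsIn_empty r this, hg0 i hi, sub_zero]
    · rw [Pi.sub_apply, Pi.sub_apply, sub_eq_sub_iff_sub_eq_sub, hE2, hg]
  have hfirst : ∀ {n : ℕ} {g : Fin m → Chain κ n X}, (∀ i, g i ∈ chainsIn κ n (V i)) →
      ∀ i, i.val = 0 → g i = 0 := by
    intro n g hg i hi
    have := hg i
    rw [h.first i hi] at this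
    exact chainsIn_empty n this
  let q0 : D →ₗ[κ] ∀ i, setHomology κ r (V i) :=
    LinearMap.pi fun i => clsIn κ r (V i) ∘ₗ
      LinearMap.codRestrict _ (LinearMap.proj i ∘ₗ E) (fun c => ⟨hE1 c i, LinearMap.mem_ker.2 (hE3 c i)⟩)
  have hq0 : ∀ c i, q0 c i = clsIn κ r (V i) ⟨E c i, hE1 c i, hE3 c i⟩ := fun c i => rfl
  let q : D →ₗ[κ] LinearMap.ker (h.diffMap κ r) := LinearMap.codRestrict _ q0 (fun c => by
    rw [LinearMap.mem_ker]
    funext i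
    rw [diffMap_apply, hq0, hq0, incl_clsIn, incl_clsIn, ← map_sub, Pi.zero_apply,
      clsIn_eq_zero_iff]
    exact ⟨c.1 i, ((hD c.1).1 c.2).1 i, (hE2 c i).symm⟩)
  have hp : Function.Surjective p := by
    refine (Submodule.mkQ_surjective _).comp ?_
    intro x
    obtain ⟨z, rfl⟩ := clsIn_surjective κ _ Y x
    obtain ⟨O, hO, hY, hU⟩ := h.exists_isOpen
    obtain ⟨z', hz', hdd, w, hw, hwz⟩ := exists_small_cycle hO hY hU z.2.1 z.2.2
    obtain ⟨d, hd, rfl⟩ := exists_sum_of_mem_small hz'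
    refine ⟨⟨d, (hD d).2 ⟨hd, ?_⟩⟩, ?_⟩
    · rw [← map_sum]; exact hdd
    · symm
      rw [LinearMap.comp_apply, clsIn_eq_iff]
      refine ⟨w, hw, ?_⟩
      rw [hwz, hsumL]
  -- Cycles `e i` whose classes are killed by the difference map satisfy `e i - e (i+1) = ∂ (c i)`.
  -- Cyclically these differences add up to zero, so `c` is in `D` and goes to the class of `e`.
  have hq : Function.Surjective q := by
    rintro ⟨x, hx⟩
    obtain ⟨e, rfl⟩ := exists_clsIn x
    have hx' : ∀ i, ∃ w ∈ chainsIn κ (r + 1) (U i),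
        bd κ r w = (e i).1 - (e (finRotate m i)).1 := by
      intro i
      have := congrFun (LinearMap.mem_ker.1 hx) i
      rw [diffMap_apply, incl_clsIn, incl_clsIn, ← map_sub, Pi.zero_apply,
        clsIn_eq_zero_iff] at this
      exact this
    choose c hc hce using hx'
    have hcD : c ∈ D := by
      refine (hD c).2 ⟨hc, ?_⟩
      simp only [hce, Finset.sum_sub_distrib]
      rw [Equiv.sum_comp (finRotate m) (fun i => (e i).1), sub_self]
    refine ⟨⟨c, hcD⟩, Subtype.ext ?_⟩
    have hEe := hEuniq ⟨c, hcD⟩ (fun i => (e i).1) (hfirst fun i => (e i).2.1)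
      (fun i => (hce i).symm)
    funext i
    refine (hq0 _ i).trans ?_
    congr 1
    exact Subtype.ext (congrFun hEe i)
  have hker : LinearMap.ker p = LinearMap.ker q := by
    ext c
    obtain ⟨h1, h2⟩ := (hD c.1).1 c.2
    have hqc : c ∈ LinearMap.ker q ↔ ∀ i, ∃ w ∈ chainsIn κ (r + 1) (V i), bd κ r w = E c i := by
      rw [LinearMap.mem_ker, ← Subtype.coe_inj]
      refine funext_iff.trans (forall_congr' fun i => ?_)
      exact clsIn_eq_zero_iff _
    have hpc : c ∈ LinearMap.ker p ↔ ∃ z : ∀ i, cyclesIn κ (r + 1) (U i),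
        ∃ w ∈ chainsIn κ (r + 2) Y, bd κ (r + 1) w = ∑ i, (c.1 i - (z i).1) := by
      rw [LinearMap.mem_ker, LinearMap.comp_apply, Submodule.mkQ_apply,
        Submodule.Quotient.mk_eq_zero, LinearMap.comp_apply]
      constructor
      · rintro ⟨y, hy⟩
        obtain ⟨z, rfl⟩ := exists_clsIn y
        rw [sumMap_clsIn, eq_comm, clsIn_eq_iff] at hy
        obtain ⟨w, hw, hwz⟩ := hy
        refine ⟨z, w, hw, ?_⟩
        rw [hwz, hsumL, Finset.sum_sub_distrib]
      · rintro ⟨z, w, hw, hwz⟩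
        refine ⟨fun i => clsIn κ _ _ (z i), ?_⟩
        rw [sumMap_clsIn, eq_comm, clsIn_eq_iff]
        refine ⟨w, hw, ?_⟩
        rw [hwz, hsumL, Finset.sum_sub_distrib]
    rw [hqc, hpc]
    constructor
    · rintro ⟨z, w, hw, hwz⟩
      obtain ⟨d, hd, hsum⟩ := h.exists_correction
        (fun i => Submodule.sub_mem _ (h1 i) (z i).2.1) hw hwz
      -- If the class comes from cycles `z i` of the members, the corrected family has sum zero, and
      -- its partial sums `g` bound the partial sums `E c` of the boundaries.
      let g := partialSum (κ := κ) fun i => c.1 i - (z i).1 - bd κ (r + 1) (d i)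
      have hg : ∀ i, g i ∈ chainsIn κ (r + 1) (V i) := h.partialSum_mem (fun i =>
        Submodule.sub_mem _ (Submodule.sub_mem _ (h1 i) (z i).2.1) (bd_mem κ (hd i))) hsum
      have hgd : ∀ i, g i - g (finRotate m i) = c.1 i - (z i).1 - bd κ (r + 1) (d i) :=
        partialSum_sub hsum
      have hEg := hEuniq c (fun i => bd κ r (g i)) (hfirst fun i => bd_mem κ (hg i)) (fun i => by
        rw [← map_sub, hgd, map_sub, map_sub, bd_bd, show bd κ r (z i).1 = 0 from (z i).2.2]
        simp)
      intro i
      exact ⟨g i, hg i, (congrFun hEg i).symm⟩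
    · intro hw
      choose w hw hwE using hw
      -- Subtracting differences of the chains `w i` bounded by `E c` makes each `c i` a cycle in
      -- its member and leaves the cyclic sum unchanged.
      refine ⟨fun i => ⟨c.1 i - (w i - w (finRotate m i)), ?_, ?_⟩, 0, Submodule.zero_mem _, ?_⟩
      · exact Submodule.sub_mem _ (h1 i) (Submodule.sub_mem _ (chainsIn_mono (h.left i) (hw i))
          (chainsIn_mono (h.right i) (hw _)))
      · change bd κ r _ = 0
        rw [map_sub, map_sub, hwE, hwE, hE2, sub_self]
      · simp only [sub_sub_cancel, Finset.sum_sub_distrib, map_zero]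
        rw [Equiv.sum_comp (finRotate m) w, sub_self]
  exact nonempty_equiv_of_ker_eq (κ := κ) (L := D)
    (M := setHomology κ (r + 1) Y ⧸ LinearMap.range (h.sumMap κ (r + 1)))
    (N := LinearMap.ker (h.diffMap κ r)) p q hp hq hker

end IsLinearCover

end CircleValued

end

noncomputable section

open CategoryTheory AlgebraicTopology Topology
open scoped ContinuousMap

namespace CircleValued

/-! ### Inclusions which induce isomorphisms in homology. -/

section HomologyIso

variable (κ : Type v) [Field κ] {X : Type u} [TopologicalSpace X]

/-- The inclusion of `A` in `B` induces isomorphisms in homology. -/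
def HomologyIso (A B : Set X) : Prop := ∃ h : A ⊆ B, ∀ r, Function.Bijective (incl κ r h)

variable {κ}

theorem HomologyIso.trans {A B C : Set X} (h : HomologyIso κ A B) (h' : HomologyIso κ B C) :
    HomologyIso κ A C := by
  obtain ⟨h1, h2⟩ := h
  obtain ⟨h3, h4⟩ := h'
  refine ⟨h1.trans h3, fun r => ?_⟩
  convert (h4 r).comp (h2 r) using 1
  funext x
  exact (incl_incl r h1 h3 x).symm

theorem HomologyIso.of_left {A B C : Set X} (h : HomologyIso κ A B) (h' : HomologyIso κ A C)
    (hBC : B ⊆ C) : HomologyIso κ B C := by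
  obtain ⟨h1, h2⟩ := h
  obtain ⟨h3, h4⟩ := h'
  refine ⟨hBC, fun r => ?_⟩
  rw [← Function.Bijective.of_comp_iff _ (h2 r)]
  convert h4 r using 1
  funext x
  exact incl_incl r h1 hBC x

/-- Excision, for two relatively open subsets. -/
theorem HomologyIso.union {A B Y : Set X} (hY : A ∪ B = Y) (hA : ∃ O, IsOpen O ∧ A = Y ∩ O)
    (hB : ∃ O, IsOpen O ∧ B = Y ∩ O) (h : HomologyIso κ (A ∩ B) B) : HomologyIso κ A Y := by
  obtain ⟨hi, hbij⟩ := h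
  have hc : IsLinearCover (m := 2) Y ![A, B] ![∅, A ∩ B] := by
    constructor
    · intro i; subst hY; fin_cases i <;> simp
    · subst hY
      rintro x (hx | hx)
      · exact Set.mem_iUnion.2 ⟨0, hx⟩
      · exact Set.mem_iUnion.2 ⟨1, hx⟩
    · intro i
      fin_cases i
      · exact hA
      · exact hB
    · intro i; fin_cases i <;> simp
    · intro i; fin_cases i <;> simp
    · intro i j hij
      fin_cases i <;> fin_cases j <;> simp_all
    · intro i j hij
      omega
    · intro i hi
      obtain rfl : i = 0 := Fin.ext hi
      rfl
  have he : ∀ r, Subsingleton (setHomology κ r ((![∅, A ∩ B] : Fin 2 → Set X) 0)) :=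
    fun r => setHomology_empty r rfl
  -- The coordinate `1` of the difference map is the inclusion of `A ∩ B` in `B` alone, because the
  -- successor of `1` is `0` and the set there is empty.
  have hdiff : ∀ r x, hc.diffMap κ r x 1 = 0 → x = 0 := by
    intro r x hx
    have h0 : x 0 = 0 := (he r).elim _ _
    have h1 : x 1 = 0 := by
      have h2 := hc.diffMap_apply r x 1
      rw [hx] at h2
      have h3 : x (finRotate 2 1) = 0 := h0
      rw [h3, map_zero, sub_zero] at h2
      exact (hbij r).1 (h2.symm.trans (map_zero _).symm)
    funext i
    fin_cases i
    · exact h0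
    · exact h1
  have hsurj : ∀ r, Function.Surjective (hc.sumMap κ r) := by
    intro r
    cases r with
    | zero => exact hc.sumMap_zero_surjective
    | succ r =>
      obtain ⟨e⟩ := hc.nonempty_quotient_equiv_ker (κ := κ) r
      have : Subsingleton (LinearMap.ker (hc.diffMap κ r)) := by
        refine ⟨fun x y => Subtype.ext ?_⟩
        rw [hdiff r x.1 (by rw [LinearMap.mem_ker.1 x.2]; rfl),
          hdiff r y.1 (by rw [LinearMap.mem_ker.1 y.2]; rfl)]
      have := e.toEquiv.subsingleton
      exact LinearMap.range_eq_top.1 (Submodule.Quotient.subsingleton_iff.1 this)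
  have hAY : A ⊆ Y := hY ▸ Set.subset_union_left
  refine ⟨hAY, fun r => ⟨?_, ?_⟩⟩
  · rw [← LinearMap.ker_eq_bot, LinearMap.ker_eq_bot']
    intro a ha
    -- A class `a` dying in `Y` gives the pair `(a, 0)` in the kernel of the sum map. It is the
    -- difference of some `y`, and its zero in the second place forces `y = 0`.
    let x : ∀ i : Fin 2, setHomology κ r ((![A, B] : Fin 2 → Set X) i) :=
      Fin.cons a (Fin.cons 0 finZeroElim)
    have hx : hc.sumMap κ r x = 0 := by
      rw [hc.sumMap_apply, Fin.sum_univ_two]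
      refine (congrArg₂ (· + ·) ha (map_zero _)).trans (add_zero _)
    obtain ⟨y, hy⟩ := hc.exists_diffMap_of_sumMap_eq_zero hx
    have hy0 : y = 0 := hdiff r y (by rw [hy]; rfl)
    rw [hy0, map_zero] at hy
    exact (congrFun hy 0).symm
  · intro y
    obtain ⟨x, rfl⟩ := hsurj r y
    rw [hc.sumMap_apply, Fin.sum_univ_two]
    obtain ⟨e, he⟩ := (hbij r).2 (x 1)
    refine ⟨(show setHomology κ r A from x 0) + incl κ r Set.inter_subset_left e, ?_⟩
    rw [map_add, incl_incl, ← he]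
    congr 1
    exact (incl_incl r hi _ e).symm

/-- Homology is compactly supported. -/
theorem HomologyIso.of_compact {A B : Set X} (hAB : A ⊆ B)
    (h : ∀ K : Set X, IsCompact K → K ⊆ B → ∃ A', A' ⊆ B ∧ K ⊆ A' ∧ HomologyIso κ A A') :
    HomologyIso κ A B := by
  have hsupp : ∀ (n : ℕ) (c : Chain κ n X), c ∈ chainsIn κ n B →
      ∃ A', A' ⊆ B ∧ HomologyIso κ A A' ∧ c ∈ chainsIn κ n A' := by
    intro n c hc
    obtain ⟨A', h1, h2, h3⟩ := h (⋃ σ ∈ c.support, Set.range σ)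
      (c.support.isCompact_biUnion fun σ _ => isCompact_range σ.continuous)
      (Set.iUnion₂_subset fun σ hσ => hc hσ)
    refine ⟨A', h1, h3, fun σ hσ => ?_⟩
    exact (Set.subset_iUnion₂ (s := fun (σ : Simplex n X) (_ : σ ∈ c.support) => Set.range σ)
      σ hσ).trans h2
  refine ⟨hAB, fun r => ⟨?_, ?_⟩⟩
  · rw [← LinearMap.ker_eq_bot, LinearMap.ker_eq_bot']
    intro x hx
    obtain ⟨z, rfl⟩ := clsIn_surjective κ r A x
    rw [incl_clsIn, clsIn_eq_zero_iff] at hx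
    obtain ⟨w, hw, hwz⟩ := hx
    obtain ⟨A', h1, ⟨h2, h3⟩, h4⟩ := hsupp _ w hw
    apply (h3 r).1
    rw [incl_clsIn, map_zero, clsIn_eq_zero_iff]
    exact ⟨w, h4, hwz⟩
  · intro y
    obtain ⟨z, rfl⟩ := clsIn_surjective κ r B y
    obtain ⟨A', h1, ⟨h2, h3⟩, h4⟩ := hsupp _ z.1 z.2.1
    obtain ⟨x, hx⟩ := (h3 r).2 (clsIn κ r A' ⟨z.1, h4, z.2.2⟩)
    refine ⟨x, ?_⟩
    rw [← incl_incl r h2 h1, hx, incl_clsIn]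

theorem homologyMap_eq_of_homotopic {A B : Type u} [TopologicalSpace A] [TopologicalSpace B]
    {f g : C(A, B)} (h : f.Homotopic g) (r : ℕ) : homologyMap κ r f = homologyMap κ r g := by
  obtain ⟨H⟩ := h
  exact TopCat.Homotopy.congr_homologyMap_singularChainComplexFunctor
    (f := TopCat.ofHom f) (g := TopCat.ofHom g) H (ModuleCat.of κ (ULift.{u} κ)) r

theorem HomologyIso.of_homotopyEquiv {A B : Set X} (e : A ≃ₕ B) (he : ∀ x, (e x : X) = x) :
    HomologyIso κ A B := by
  have hAB : A ⊆ B := fun x hx => by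
    have h := (e ⟨x, hx⟩).2
    rwa [he ⟨x, hx⟩] at h
  refine ⟨hAB, fun r => ?_⟩
  have h1 : (⟨Set.inclusion hAB, continuous_inclusion hAB⟩ : C(A, B)) = e.toFun := by
    ext x
    exact (he x).symm
  rw [incl, h1]
  refine Function.bijective_iff_has_inverse.2 ⟨(homologyMap κ r e.invFun).hom, fun x => ?_,
    fun x => ?_⟩
  · rw [homologyMap_comp, homologyMap_eq_of_homotopic e.left_inv, homologyMap_id]
  · rw [homologyMap_comp, homologyMap_eq_of_homotopic e.right_inv, homologyMap_id]

/-- Over a subset which contracts to a point `w`, the total space of a homotopically trivial map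
has the homology of the fiber. -/
theorem HomologyIso.of_fiberwise {B : Type*} [TopologicalSpace B] {g : X → B} {U : Set B} {y : B}
    (hU : FiberwiseHomotopyEquivalent (U.restrictPreimage g)
      (Prod.snd : (g ⁻¹' {y}) × U → U))
    {W : Set B} (hW : W ⊆ U) {w : B} (hw : w ∈ W) (K : unitInterval × (g ⁻¹' W : Set X) → B)
    (hK : Continuous K) (hKW : ∀ p, K p ∈ W) (hK0 : ∀ x, K (0, x) = w)
    (hK1 : ∀ x, K (1, x) = g x) : HomologyIso κ (g ⁻¹' {w}) (g ⁻¹' W) := by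
  obtain ⟨l, k, hl, hk, ⟨H⟩, -⟩ := hU
  have hl' : ∀ e, ((l e).2 : B) = g e := fun e => congrArg Subtype.val (hl e)
  have hk' : ∀ e, g (k e) = e.2 := fun e => congrArg Subtype.val (hk e)
  have hH : ∀ t e, g (H (t, e)) = g e := fun t e => congrArg Subtype.val (H.prop' t e)
  have hsub : g ⁻¹' {w} ⊆ g ⁻¹' W := by
    rintro x (rfl : g x = w)
    exact hw
  let toU : C((g ⁻¹' W : Set X), (g ⁻¹' U : Set X)) :=
    ⟨Set.inclusion (Set.preimage_mono hW), continuous_inclusion _⟩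
  -- The inverse of the inclusion trivializes by `l`, replaces the base coordinate by `w` and
  -- returns by `k`. The homotopy to the identity has two stages: `K` moves the base coordinate
  -- back, which leads to `k ∘ l`, and the fiberwise homotopy `H` leads on to the identity. As `H`
  -- preserves fibers, it also works over `w` alone.
  let ρ : C((g ⁻¹' W : Set X), (g ⁻¹' {w} : Set X)) :=
    ⟨fun x => ⟨k ((l (toU x)).1, ⟨w, hW hw⟩), hk' _⟩, by fun_prop⟩
  let ι : C((g ⁻¹' {w} : Set X), (g ⁻¹' W : Set X)) :=
    ⟨Set.inclusion hsub, continuous_inclusion hsub⟩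
  let mid : C((g ⁻¹' W : Set X), (g ⁻¹' W : Set X)) :=
    ⟨fun x => ⟨k (l (toU x)), by
      change g _ ∈ W
      rw [hk', hl']; exact x.2⟩, by fun_prop⟩
  have h1 : (ι.comp ρ).Homotopic mid := by
    refine ⟨⟨⟨fun p => ⟨k ((l (toU p.2)).1, ⟨K p, hW (hKW p)⟩), by
      change g _ ∈ W
      rw [hk']; exact hKW p⟩, by fun_prop⟩, fun x => ?_, fun x => ?_⟩⟩
    · apply Subtype.ext
      change (k ((l (toU x)).1, ⟨K (0, x), _⟩) : X) = k ((l (toU x)).1, ⟨w, _⟩)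
      simp only [hK0]
    · apply Subtype.ext
      change (k ((l (toU x)).1, ⟨K (1, x), _⟩) : X) = k (l (toU x))
      congr 2
      refine Prod.ext rfl (Subtype.ext ?_)
      rw [hl']
      exact hK1 x
  have h2 : mid.Homotopic (ContinuousMap.id _) := by
    refine ⟨⟨⟨fun p => ⟨H (p.1, toU p.2), by
      change g _ ∈ W
      rw [hH]; exact p.2.2⟩, by fun_prop⟩, fun x => ?_, fun x => ?_⟩⟩
    · apply Subtype.ext
      change (H (0, toU x) : X) = _
      rw [H.apply_zero]
      rfl
    · apply Subtype.ext
      change (H (1, toU x) : X) = _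
      rw [H.apply_one]
      rfl
  have h3 : (ρ.comp ι).Homotopic (ContinuousMap.id _) := by
    refine ⟨⟨⟨fun p => ⟨H (p.1, toU (ι p.2)), by
      change g _ = w
      rw [hH]; exact p.2.2⟩, by fun_prop⟩, fun x => ?_, fun x => ?_⟩⟩
    · apply Subtype.ext
      change (H (0, toU (ι x)) : X) = k ((l (toU (ι x))).1, ⟨w, _⟩)
      rw [H.apply_zero]
      change (k (l (toU (ι x))) : X) = _
      congr 2
      refine Prod.ext rfl (Subtype.ext ?_)
      rw [hl']
      exact x.2
    · apply Subtype.ext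
      change (H (1, toU (ι x)) : X) = _
      rw [H.apply_one]
      rfl
  refine ⟨hsub, fun r => ?_⟩
  refine Function.bijective_iff_has_inverse.2 ⟨(homologyMap κ r ρ).hom, fun x => ?_, fun x => ?_⟩
  · refine (homologyMap_comp r ι ρ x).trans ?_
    rw [homologyMap_eq_of_homotopic h3, homologyMap_id]
  · refine (homologyMap_comp r ρ ι x).trans ?_
    rw [homologyMap_eq_of_homotopic (h1.trans h2), homologyMap_id]

end HomologyIso

end CircleValued

end

noncomputable section

open Topology Set
open scoped ContinuousMap

namespace CircleValued

/-! ### Homology of the parts of a space over intervals of values. -/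

section Intervals

variable (κ : Type v) [Field κ] {X : Type u} [TopologicalSpace X]

/-- The fibers over the points of `V` have the homology of the part over `V`. -/
def HomologyTrivialOn (F : X → ℝ) (V : Set ℝ) : Prop :=
  ∀ z ∈ V, HomologyIso κ (F ⁻¹' {z}) (F ⁻¹' V)

/-- The map is homologically trivial over all small intervals near `y`. -/
def LocallyHomologyTrivialAt (F : X → ℝ) (y : ℝ) : Prop :=
  ∃ ε > 0, ∀ V : Set ℝ, V.OrdConnected → V ⊆ Ioo (y - ε) (y + ε) → HomologyTrivialOn κ F V

variable {κ} {F : X → ℝ}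

theorem HomologyTrivialOn.homologyIso {V W : Set ℝ} (hV : HomologyTrivialOn κ F V)
    (hW : HomologyTrivialOn κ F W) (h : V ⊆ W) (hne : V.Nonempty) :
    HomologyIso κ (F ⁻¹' V) (F ⁻¹' W) := by
  obtain ⟨z, hz⟩ := hne
  exact (hV z hz).of_left (hW z (h hz)) (preimage_mono h)

theorem homologyIso_union (hF : Continuous F) {A B Y : Set ℝ} (hY : A ∪ B = Y)
    (hA : ∃ O, IsOpen O ∧ A = Y ∩ O) (hB : ∃ O, IsOpen O ∧ B = Y ∩ O)
    (h : HomologyIso κ (F ⁻¹' (A ∩ B)) (F ⁻¹' B)) : HomologyIso κ (F ⁻¹' A) (F ⁻¹' Y) := by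
  refine HomologyIso.union (B := F ⁻¹' B) (by rw [← preimage_union, hY]) ?_ ?_ h
  · obtain ⟨O, hO, rfl⟩ := hA
    exact ⟨F ⁻¹' O, hO.preimage hF, rfl⟩
  · obtain ⟨O, hO, rfl⟩ := hB
    exact ⟨F ⁻¹' O, hO.preimage hF, rfl⟩

/-- The overlap and the two pieces all have the homology of a fiber over a point of the overlap. So
the overlap includes isomorphically in each piece, and excision makes each piece include
isomorphically in the whole. -/
theorem homologyTrivialOn_union (hF : Continuous F) {V : Set ℝ} {c c' : ℝ} (hc : c < c')
    (hA : HomologyTrivialOn κ F (V ∩ Iio c')) (hB : HomologyTrivialOn κ F (V ∩ Ioi c))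
    (hAB : HomologyTrivialOn κ F (V ∩ Ioo c c')) (hne : (V ∩ Ioo c c').Nonempty) :
    HomologyTrivialOn κ F V := by
  have hY : V ∩ Iio c' ∪ V ∩ Ioi c = V := by
    rw [← inter_union_distrib_left, inter_eq_left]
    intro x _
    rcases lt_or_ge x c' with h | h
    · exact Or.inl h
    · exact Or.inr (hc.trans_le h)
  have hY' : V ∩ Ioi c ∪ V ∩ Iio c' = V := by rw [union_comm, hY]
  have hI : V ∩ Iio c' ∩ (V ∩ Ioi c) = V ∩ Ioo c c' := by
    ext x; simp only [mem_inter_iff, mem_Iio, mem_Ioi, mem_Ioo]; tauto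
  have hI' : V ∩ Ioi c ∩ (V ∩ Iio c') = V ∩ Ioo c c' := by rw [inter_comm, hI]
  have h1 : HomologyIso κ (F ⁻¹' (V ∩ Iio c')) (F ⁻¹' V) := by
    refine homologyIso_union hF hY ⟨_, isOpen_Iio, rfl⟩ ⟨_, isOpen_Ioi, rfl⟩ ?_
    rw [hI]
    exact hAB.homologyIso hB (inter_subset_inter_right _ fun x hx => hx.1) hne
  have h2 : HomologyIso κ (F ⁻¹' (V ∩ Ioi c)) (F ⁻¹' V) := by
    refine homologyIso_union hF hY' ⟨_, isOpen_Ioi, rfl⟩ ⟨_, isOpen_Iio, rfl⟩ ?_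
    rw [hI']
    exact hAB.homologyIso hA (inter_subset_inter_right _ fun x hx => hx.2) hne
  intro z hz
  rw [← hY] at hz
  rcases hz with hz | hz
  · exact (hA z hz).trans h1
  · exact (hB z hz).trans h2

/-- A Lebesgue number makes the map trivial over all subintervals of length `2η`. Longer ones are
built in steps of `η`: each time an interval of length at most `2η` is glued on along an overlap of
length at most `η`. -/
theorem homologyTrivialOn_Icc (hF : Continuous F) {a b : ℝ}
    (h : ∀ y ∈ Icc a b, LocallyHomologyTrivialAt κ F y) {V : Set ℝ} (hV : V.OrdConnected)
    (hVab : V ⊆ Icc a b) : HomologyTrivialOn κ F V := by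
  choose! ε hε hloc using h
  obtain ⟨δ, hδ, hleb⟩ := lebesgue_number_lemma_of_metric (isCompact_Icc (a := a) (b := b))
    (c := fun y : Icc a b => Ioo (y.1 - ε y) (y.1 + ε y)) (fun y => isOpen_Ioo) (fun y hy =>
      mem_iUnion.2 ⟨⟨y, hy⟩, by have := hε y hy; constructor <;> simp only <;> linarith⟩)
  let η := δ / 3
  have hη : 0 < η := by positivity
  have hηδ : 2 * η < δ := by simp only [η]; linarith
  have hsmall : ∀ W : Set ℝ, W.OrdConnected → W ⊆ Icc a b → ∀ p, W ⊆ Icc p (p + 2 * η) →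
      HomologyTrivialOn κ F W := by
    intro W hW hWab p hWp z hz
    obtain ⟨y, hy⟩ := hleb z (hWab hz)
    refine hloc y y.2 W hW (fun x hx => hy ?_) z hz
    have h1 := hWp hx
    have h2 := hWp hz
    rw [Metric.mem_ball, Real.dist_eq, abs_lt]
    constructor <;> linarith [h1.1, h1.2, h2.1, h2.2]
  have hmain : ∀ n : ℕ, ∀ W : Set ℝ, W.OrdConnected → W ⊆ Icc a b →
      W ⊆ Icc a (a + (n + 1) * η) → HomologyTrivialOn κ F W := by
    intro n
    induction n with
    | zero =>
      intro W hW hWab hWn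
      refine hsmall W hW hWab a (hWn.trans (Icc_subset_Icc_right ?_))
      push_cast
      linarith
    | succ n ih =>
      intro W hW hWab hWn
      let c := a + n * η
      let c' := a + (n + 1) * η
      have hc : c < c' := by simp only [c, c']; linarith
      have hcc : a + ((n + 1 : ℕ) + 1) * η = c + 2 * η := by simp only [c]; push_cast; ring
      have hc' : c' = c + η := by simp only [c, c']; ring
      rw [hcc] at hWn
      have hA : HomologyTrivialOn κ F (W ∩ Iio c') :=
        ih _ (hW.inter ordConnected_Iio) (inter_subset_left.trans hWab)
          fun x hx => ⟨(hWn hx.1).1, le_of_lt hx.2⟩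
      have hB : HomologyTrivialOn κ F (W ∩ Ioi c) :=
        hsmall _ (hW.inter ordConnected_Ioi) (inter_subset_left.trans hWab) c
          fun x hx => ⟨le_of_lt hx.2, (hWn hx.1).2⟩
      have hAB : HomologyTrivialOn κ F (W ∩ Ioo c c') :=
        hsmall _ (hW.inter ordConnected_Ioo) (inter_subset_left.trans hWab) c
          fun x hx => ⟨le_of_lt hx.2.1, (hWn hx.1).2⟩
      -- If `W` has no point in the overlap, order connectedness puts it entirely at or below `c`,
      -- or entirely at or above `c`, and one of the two cases already treated applies.
      by_cases hne : (W ∩ Ioo c c').Nonempty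
      · exact homologyTrivialOn_union hF hc hA hB hAB hne
      · by_cases hlow : W ⊆ Iic c
        · refine ih W hW hWab fun x hx => ⟨(hWn hx).1, ?_⟩
          exact (hlow hx).trans hc.le
        · obtain ⟨y, hy, hyc⟩ := not_subset.1 hlow
          refine hsmall W hW hWab c fun x hx => ⟨?_, (hWn hx).2⟩
          by_contra hx'
          refine hne ⟨min y ((c + c') / 2), hW.out hx hy ⟨?_, min_le_left _ _⟩, ?_, ?_⟩
          · exact le_min (by simp only [mem_Iic] at hyc; linarith) (by linarith)
          · exact lt_min (not_le.1 hyc) (by linarith)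
          · exact (min_le_right _ _).trans_lt (by linarith)
  obtain ⟨n, hn⟩ := exists_nat_gt ((b - a) / η)
  refine hmain n V hV hVab (hVab.trans (Icc_subset_Icc_right ?_))
  rw [div_lt_iff₀ hη] at hn
  nlinarith

/-- Over an interval without critical values, all fibers have the homology of the total space. -/
theorem homologyTrivialOn_of_locally (hF : Continuous F) {V : Set ℝ} (hV : V.OrdConnected)
    (h : ∀ y ∈ V, LocallyHomologyTrivialAt κ F y) : HomologyTrivialOn κ F V := by
  intro z hz
  refine HomologyIso.of_compact (preimage_mono (singleton_subset_iff.2 hz)) fun K hK hKV => ?_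
  -- Adding `z` makes the compact interval spanned by the values of `K` contain the point whose
  -- fiber is considered.
  have hcomp : IsCompact (insert z (F '' K)) := (hK.image hF).insert z
  have hsub : insert z (F '' K) ⊆ V := insert_subset hz (image_subset_iff.2 hKV)
  obtain ⟨a, ha, hamin⟩ := hcomp.exists_isLeast ⟨z, mem_insert _ _⟩
  obtain ⟨b, hb, hbmax⟩ := hcomp.exists_isGreatest ⟨z, mem_insert _ _⟩
  have hab : Icc a b ⊆ V := hV.out (hsub ha) (hsub hb)
  refine ⟨F ⁻¹' Icc a b, preimage_mono hab, fun x hx => ?_, ?_⟩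
  · have : F x ∈ insert z (F '' K) := mem_insert_of_mem _ ⟨x, hx, rfl⟩
    exact ⟨hamin this, hbmax this⟩
  · exact homologyTrivialOn_Icc hF (fun y hy => h y (hab hy)) ordConnected_Icc subset_rfl z
      ⟨hamin (mem_insert _ _), hbmax (mem_insert _ _)⟩

/-- The pieces added on either side of `s` contain regular values only. Over them the homology is
constant, so excision permits adding first the part above `s` and then the part below. -/
theorem homologyIso_Ioo_of_critical (hF : Continuous F) {V : Set ℝ} (hV : V.OrdConnected)
    {s c c' : ℝ} (hs : s ∈ Ioo c c') (hM : Ioo c c' ⊆ V)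
    (h : ∀ y ∈ V, y ≠ s → LocallyHomologyTrivialAt κ F y) :
    HomologyIso κ (F ⁻¹' Ioo c c') (F ⁻¹' V) := by
  obtain ⟨hs1, hs2⟩ := hs
  have hup : ∀ W : Set ℝ, W.OrdConnected → W ⊆ V ∩ Ioi s → HomologyTrivialOn κ F W :=
    fun W hW hWV => homologyTrivialOn_of_locally hF hW fun y hy =>
      h y (hWV hy).1 (ne_of_gt (hWV hy).2)
  have hlow : ∀ W : Set ℝ, W.OrdConnected → W ⊆ V ∩ Iio s → HomologyTrivialOn κ F W :=
    fun W hW hWV => homologyTrivialOn_of_locally hF hW fun y hy =>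
      h y (hWV hy).1 (ne_of_lt (hWV hy).2)
  have h1 : HomologyIso κ (F ⁻¹' Ioo c c') (F ⁻¹' (V ∩ Ioi c)) := by
    refine homologyIso_union hF (B := V ∩ Ioi s) ?_ ⟨Iio c', isOpen_Iio, ?_⟩
      ⟨Ioi s, isOpen_Ioi, ?_⟩ ?_
    · ext x
      simp only [mem_union, mem_Ioo, mem_inter_iff, mem_Ioi]
      constructor
      · rintro (hx | hx)
        · exact ⟨hM hx, hx.1⟩
        · exact ⟨hx.1, hs1.trans hx.2⟩
      · rintro ⟨hx, hx'⟩
        rcases lt_or_ge x c' with h' | h'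
        · exact Or.inl ⟨hx', h'⟩
        · exact Or.inr ⟨hx, hs2.trans_le h'⟩
    · ext x
      simp only [mem_Ioo, mem_inter_iff, mem_Ioi, mem_Iio]
      exact ⟨fun hx => ⟨⟨hM hx, hx.1⟩, hx.2⟩, fun hx => ⟨hx.1.2, hx.2⟩⟩
    · ext x
      simp only [mem_inter_iff, mem_Ioi]
      exact ⟨fun hx => ⟨⟨hx.1, hs1.trans hx.2⟩, hx.2⟩, fun hx => ⟨hx.1.1, hx.2⟩⟩
    · have : Ioo c c' ∩ (V ∩ Ioi s) = Ioo s c' := by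
        ext x
        simp only [mem_Ioo, mem_inter_iff, mem_Ioi]
        exact ⟨fun hx => ⟨hx.2.2, hx.1.2⟩, fun hx =>
          ⟨⟨hs1.trans hx.1, hx.2⟩, hM ⟨hs1.trans hx.1, hx.2⟩, hx.1⟩⟩
      rw [this]
      have hsub : Ioo s c' ⊆ V ∩ Ioi s := fun x hx => ⟨hM ⟨hs1.trans hx.1, hx.2⟩, hx.1⟩
      exact (hup _ ordConnected_Ioo hsub).homologyIso
        (hup _ (hV.inter ordConnected_Ioi) subset_rfl) hsub (nonempty_Ioo.2 hs2)
  refine h1.trans ?_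
  refine homologyIso_union hF (B := V ∩ Iio s) ?_ ⟨Ioi c, isOpen_Ioi, rfl⟩
      ⟨Iio s, isOpen_Iio, rfl⟩ ?_
  · rw [← inter_union_distrib_left, inter_eq_left]
    intro x _
    rcases lt_or_ge x s with h' | h'
    · exact Or.inr h'
    · exact Or.inl (hs1.trans_le h')
  · have : V ∩ Ioi c ∩ (V ∩ Iio s) = Ioo c s := by
      ext x
      simp only [mem_Ioo, mem_inter_iff, mem_Ioi, mem_Iio]
      exact ⟨fun hx => ⟨hx.1.2, hx.2.2⟩, fun hx =>
        ⟨⟨hM ⟨hx.1, hx.2.trans hs2⟩, hx.1⟩, hM ⟨hx.1, hx.2.trans hs2⟩, hx.2⟩⟩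
    rw [this]
    have hsub : Ioo c s ⊆ V ∩ Iio s := fun x hx => ⟨hM ⟨hx.1, hx.2.trans hs2⟩, hx.2⟩
    exact (hlow _ ordConnected_Ioo hsub).homologyIso
      (hlow _ (hV.inter ordConnected_Iio) subset_rfl) hsub (nonempty_Ioo.2 hs1)

/-- Over an interval with a single critical value, the total space has the homology of the critical
fiber. -/
theorem homologyIso_of_critical (hF : Continuous F) {s : ℝ}
    (hgood : ∀ W ∈ 𝓝 s, ∃ U ∈ 𝓝 s, U ⊆ W ∧ U.OrdConnected ∧ HomologyIso κ (F ⁻¹' {s}) (F ⁻¹' U))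
    {V : Set ℝ} (hV : V.OrdConnected) (hVs : V ∈ 𝓝 s)
    (h : ∀ y ∈ V, y ≠ s → LocallyHomologyTrivialAt κ F y) :
    HomologyIso κ (F ⁻¹' {s}) (F ⁻¹' V) := by
  obtain ⟨U, hU, hUV, hUc, hiso⟩ := hgood V hVs
  obtain ⟨c, c', hs, hM⟩ := mem_nhds_iff_exists_Ioo_subset.1 hU
  -- The good neighborhood `U` and `V` are compared through a common open interval around `s`.
  have h1 := homologyIso_Ioo_of_critical hF hUc hs hM fun y hy => h y (hUV hy)
  have h2 := homologyIso_Ioo_of_critical hF hV hs (hM.trans hUV) h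
  exact hiso.trans (h1.of_left h2 (preimage_mono hUV))

end Intervals

/-! ### Real valued maps as circle valued maps -/

section Arctan

/-- The identification of `ℝ` with `(0, 2π)`. -/
def angleParam (y : ℝ) : ℝ := 2 * Real.arctan y + Real.pi

theorem angleParam_mem (y : ℝ) : angleParam y ∈ Ioo 0 (2 * Real.pi) := by
  have h1 := Real.neg_pi_div_two_lt_arctan y
  have h2 := Real.arctan_lt_pi_div_two y
  constructor <;> unfold angleParam <;> linarith

theorem continuous_angleParam : Continuous angleParam := by
  unfold angleParam
  fun_prop

theorem angleParam_injective : Function.Injective angleParam := by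
  intro x y h
  unfold angleParam at h
  exact Real.arctan_injective (by linarith)

theorem isOpenMap_angleParam : IsOpenMap angleParam := by
  have h : StrictMono angleParam := fun x y hxy => by
    unfold angleParam
    linarith [Real.arctan_strictMono hxy]
  intro U hU
  rw [isOpen_iff_mem_nhds]
  rintro _ ⟨x, hx, rfl⟩
  obtain ⟨a, b, ⟨ha, hb⟩, hab⟩ := mem_nhds_iff_exists_Ioo_subset.1 (hU.mem_nhds hx)
  have h1 : Ioo (angleParam ((a + x) / 2)) (angleParam ((x + b) / 2)) ⊆ angleParam '' U := by
    intro y hy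
    obtain ⟨z, hz, rfl⟩ := intermediate_value_Icc (by linarith) continuous_angleParam.continuousOn
      (Ioo_subset_Icc_self hy)
    refine ⟨z, hab ⟨by linarith [hz.1], by linarith [hz.2]⟩, rfl⟩
  exact Filter.mem_of_superset (Ioo_mem_nhds (h (by linarith)) (h (by linarith))) h1

theorem exists_angleParam_eq {y : ℝ} (hy : y ∈ Ioo 0 (2 * Real.pi)) : ∃ x, angleParam x = y := by
  refine ⟨Real.tan ((y - Real.pi) / 2), ?_⟩
  rw [angleParam, Real.arctan_tan] <;> linarith [hy.1, hy.2]

/-- The difference is a multiple of `2π` with absolute value below `2π`. One interval includes the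
end `2π`, since critical angles are allowed to take that value. -/
theorem angle_coe_injOn {x y : ℝ} (hx : x ∈ Ioo 0 (2 * Real.pi)) (hy : y ∈ Ioc 0 (2 * Real.pi))
    (h : (x : Real.Angle) = y) : x = y := by
  obtain ⟨k, hk⟩ := Real.Angle.angle_eq_iff_two_pi_dvd_sub.1 h
  have hpi := Real.pi_pos
  have h1 : (k : ℝ) < 1 := by
    by_contra hk1
    nlinarith [hx.2, hy.1]
  have h2 : (-1 : ℝ) < k := by
    by_contra hk1
    nlinarith [hx.1, hy.2]
  have : k = 0 := by
    have h1' : k < 1 := by exact_mod_cast h1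
    have h2' : -1 < k := by exact_mod_cast h2
    omega
  rw [this] at hk
  simp at hk
  linarith

variable {X : Type u} {f : X → ℝ}

/-- The circle valued map attached to `f`, as a map to `(0, 2π)`. -/
def realLift (f : X → ℝ) (x : X) : ℝ := angleParam (f x)

theorem realLift_mem (f : X → ℝ) (x : X) : realLift f x ∈ Ioo 0 (2 * Real.pi) := angleParam_mem _

/-- Since `f'` avoids the angle `0`, preimages of such arcs are preimages of intervals under
`realLift f`, and the arguments can be made over `ℝ`. -/
theorem toCircleValued_preimage {V : Set ℝ} (hV : V ⊆ Ioo 0 (2 * Real.pi)) :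
    toCircleValued f ⁻¹' ((fun y : ℝ => (y : Real.Angle)) '' V) = realLift f ⁻¹' V := by
  ext x
  constructor
  · rintro ⟨y, hy, h⟩
    have h2 : (realLift f x : Real.Angle) = (y : Real.Angle) := h.symm
    have := angle_coe_injOn (realLift_mem f x) (Ioo_subset_Ioc_self (hV hy)) h2
    rw [mem_preimage, this]
    exact hy
  · intro hx
    exact ⟨_, hx, rfl⟩

theorem fiber_eq {y : ℝ} (hy : y ∈ Ioo 0 (2 * Real.pi)) :
    toCircleValued f ⁻¹' {(y : Real.Angle)} = realLift f ⁻¹' {y} := by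
  rw [← toCircleValued_preimage (singleton_subset_iff.2 hy), image_singleton]

variable {κ : Type v} [Field κ] [TopologicalSpace X]

/-- An interval contracts linearly to any of its points. The contraction required by
`HomologyIso.of_fiberwise` is written in terms of the real value of a point of the total space,
which avoids inverting the parametrization of the arc. -/
theorem locallyHomologyTrivialAt_of_isFibrationAt (hf : Continuous f) {y : ℝ}
    (hy : y ∈ Ioo 0 (2 * Real.pi)) (h : IsFibrationAt (toCircleValued f) (y : Real.Angle)) :
    LocallyHomologyTrivialAt κ (realLift f) y := by
  obtain ⟨U, hU, hfib⟩ := h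
  have hcont : Continuous fun y : ℝ => (y : Real.Angle) := Real.Angle.continuous_coe
  have h1 : (fun y : ℝ => (y : Real.Angle)) ⁻¹' U ∩ Ioo 0 (2 * Real.pi) ∈ 𝓝 y :=
    Filter.inter_mem (hcont.continuousAt hU) (Ioo_mem_nhds hy.1 hy.2)
  obtain ⟨ε, hε, hball⟩ := Metric.mem_nhds_iff.1 h1
  rw [Real.ball_eq_Ioo] at hball
  refine ⟨ε, hε, fun V hV hVε z hz => ?_⟩
  have hV0 : V ⊆ Ioo 0 (2 * Real.pi) := fun x hx => (hball (hVε hx)).2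
  rw [← toCircleValued_preimage hV0, ← fiber_eq (hV0 hz)]
  have hmem : ∀ x : (toCircleValued f ⁻¹' ((fun y : ℝ => (y : Real.Angle)) '' V) : Set X),
      realLift f x ∈ V := by
    intro x
    exact (toCircleValued_preimage hV0).subset x.2
  have hF : Continuous (realLift f) := continuous_angleParam.comp hf
  refine HomologyIso.of_fiberwise hfib (W := (fun y : ℝ => (y : Real.Angle)) '' V) ?_ ⟨z, hz, rfl⟩
    (fun p => ((((p.1 : ℝ) * realLift f p.2 + (1 - p.1) * z : ℝ)) : Real.Angle)) ?_ ?_ ?_ ?_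
  · rintro _ ⟨x, hx, rfl⟩
    exact (hball (hVε hx)).1
  · refine hcont.comp ?_
    fun_prop
  · intro p
    refine ⟨_, ?_, rfl⟩
    exact hV.convex (hmem p.2) hz p.1.2.1 (by linarith [p.1.2.2]) (by ring)
  · intro x
    simp
  · intro x
    simp [toCircleValued, realLift, angleParam]

/-- Of the contractibility of a good neighborhood only connectedness is used: it makes the
neighborhood an interval. -/
theorem exists_good_neighborhood (hf : IsGood f) {y : ℝ} (hy : y ∈ Ioo 0 (2 * Real.pi))
    {W : Set ℝ} (hW : W ∈ 𝓝 y) :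
    ∃ U ∈ 𝓝 y, U ⊆ W ∧ U.OrdConnected ∧
      HomologyIso κ (realLift f ⁻¹' {y}) (realLift f ⁻¹' U) := by
  obtain ⟨y, rfl⟩ := exists_angleParam_eq hy
  obtain ⟨U, hU, hUW, hUc, e, he⟩ := hf y _ (continuous_angleParam.continuousAt hW)
  refine ⟨angleParam '' U, isOpenMap_angleParam.image_mem_nhds hU, image_subset_iff.2 hUW, ?_, ?_⟩
  · have hconn : IsPreconnected U := isPreconnected_iff_preconnectedSpace.2 inferInstance
    exact (hconn.image _ continuous_angleParam.continuousOn).ordConnected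
  · have h1 : realLift f ⁻¹' {angleParam y} = f ⁻¹' {y} := by
      ext x
      exact angleParam_injective.eq_iff
    have h2 : realLift f ⁻¹' (angleParam '' U) = f ⁻¹' U := by
      ext x
      exact angleParam_injective.mem_set_image
    rw [h1, h2]
    exact HomologyIso.of_homotopyEquiv e he

end Arctan

end CircleValued

end

noncomputable section

open Topology Set
open scoped ContinuousMap

namespace CircleValued

/-! ### Critical values -/

section Critical

theorem FiberwiseHomotopyEquivalent.congr {E E' B E₁ E₁' B₁ : Type*} [TopologicalSpace E]
    [TopologicalSpace E'] [TopologicalSpace E₁] [TopologicalSpace E₁']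
    {p : E → B} {q : E' → B} {p₁ : E₁ → B₁} {q₁ : E₁' → B₁}
    (h : FiberwiseHomotopyEquivalent p q) (e : E ≃ₜ E₁) (e' : E' ≃ₜ E₁') (b : B → B₁)
    (hp : ∀ x, p₁ (e x) = b (p x)) (hq : ∀ x, q₁ (e' x) = b (q x)) :
    FiberwiseHomotopyEquivalent p₁ q₁ := by
  obtain ⟨l, k, hl, hk, ⟨H⟩, ⟨H'⟩⟩ := h
  have hp' : ∀ x, p₁ x = b (p (e.symm x)) := fun x => by rw [← hp, e.apply_symm_apply]
  have hq' : ∀ x, q₁ x = b (q (e'.symm x)) := fun x => by rw [← hq, e'.apply_symm_apply]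
  refine ⟨⟨fun x => e' (l (e.symm x)), by fun_prop⟩, ⟨fun x => e (k (e'.symm x)), by fun_prop⟩,
    fun x => ?_, fun x => ?_, ⟨⟨⟨⟨fun z => e (H (z.1, e.symm z.2)), by fun_prop⟩, fun x => ?_,
      fun x => ?_⟩, fun t x => ?_⟩⟩, ⟨⟨⟨⟨fun z => e' (H' (z.1, e'.symm z.2)), by fun_prop⟩,
      fun x => ?_, fun x => ?_⟩, fun t x => ?_⟩⟩⟩
  · change q₁ (e' _) = _
    rw [hq, hl, hp']
  · change p₁ (e _) = _
    rw [hp, hk, hq']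
  · change e (H (0, e.symm x)) = e (k (e'.symm (e' (l (e.symm x)))))
    rw [H.apply_zero, e'.symm_apply_apply]
    rfl
  · change e (H (1, e.symm x)) = x
    rw [H.apply_one]
    exact e.apply_symm_apply x
  · change p₁ (e (H (t, e.symm x))) = p₁ x
    rw [hp, hp']
    exact congrArg b (H.prop' t (e.symm x))
  · change e' (H' (0, e'.symm x)) = e' (l (e.symm (e (k (e'.symm x)))))
    rw [H'.apply_zero, e.symm_apply_apply]
    rfl
  · change e' (H' (1, e'.symm x)) = x
    rw [H'.apply_one]
    exact e'.apply_symm_apply x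
  · change q₁ (e' (H' (t, e'.symm x))) = q₁ x
    rw [hq, hq']
    exact congrArg b (H'.prop' t (e'.symm x))

theorem continuous_of_isEmpty_right {C A A' : Type*} [TopologicalSpace C] [TopologicalSpace A]
    [TopologicalSpace A'] [IsEmpty A] (f : C × A → A') : Continuous f :=
  continuous_iff_continuousAt.2 fun z => isEmptyElim z.2

theorem FiberwiseHomotopyEquivalent.of_isEmpty {E E' B : Type*} [TopologicalSpace E]
    [TopologicalSpace E'] [IsEmpty E] [IsEmpty E'] (p : E → B) (q : E' → B) :
    FiberwiseHomotopyEquivalent p q :=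
  ⟨⟨isEmptyElim, continuous_of_discreteTopology⟩, ⟨isEmptyElim, continuous_of_discreteTopology⟩,
    isEmptyElim, isEmptyElim,
    ⟨⟨⟨⟨fun z => isEmptyElim z.2, continuous_of_isEmpty_right _⟩, isEmptyElim, isEmptyElim⟩,
      fun _ => isEmptyElim⟩⟩,
    ⟨⟨⟨⟨fun z => isEmptyElim z.2, continuous_of_isEmpty_right _⟩, isEmptyElim, isEmptyElim⟩,
      fun _ => isEmptyElim⟩⟩⟩

/-- Local triviality is transported by open embeddings. -/
theorem IsFibrationAt.of_isOpenEmbedding {X Y X₁ Y₁ : Type*} [TopologicalSpace X]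
    [TopologicalSpace Y] [TopologicalSpace X₁] [TopologicalSpace Y₁] {f : X → Y} {f₁ : X₁ → Y₁}
    {i : X₁ → X} (hi : IsEmbedding i) {ψ : Y₁ → Y} (hψ : IsOpenEmbedding ψ)
    (hcomm : ∀ x, f (i x) = ψ (f₁ x)) (hrange : ∀ x, f x ∈ range ψ → x ∈ range i) {y : Y₁}
    (h : IsFibrationAt f₁ y) : IsFibrationAt f (ψ y) := by
  obtain ⟨U, hU, hfib⟩ := h
  refine ⟨ψ '' U, hψ.isOpenMap.image_mem_nhds hU, ?_⟩
  have hset : ∀ A : Set Y₁, f ⁻¹' (ψ '' A) = i '' (f₁ ⁻¹' A) := by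
    intro A
    ext x
    constructor
    · rintro ⟨a, ha, hax⟩
      obtain ⟨x₁, rfl⟩ := hrange x ⟨a, hax⟩
      rw [hcomm] at hax
      refine ⟨x₁, ?_, rfl⟩
      rw [mem_preimage, ← hψ.injective hax]
      exact ha
    · rintro ⟨x₁, hx₁, rfl⟩
      exact ⟨f₁ x₁, hx₁, (hcomm x₁).symm⟩
  let e₀ : ∀ A : Set Y₁, (f₁ ⁻¹' A : Set X₁) ≃ₜ (f ⁻¹' (ψ '' A) : Set X) := fun A =>
    (hi.homeomorphImage (f₁ ⁻¹' A)).trans (Homeomorph.setCongr (hset A).symm)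
  have he₀ : ∀ A x, (e₀ A x : X) = i x := fun A x => rfl
  have hy : f ⁻¹' (ψ '' {y}) = f ⁻¹' {ψ y} := by rw [image_singleton]
  refine hfib.congr (e₀ U) (((e₀ {y}).trans (Homeomorph.setCongr hy)).prodCongr
    (hψ.isEmbedding.homeomorphImage U)) (fun u => ⟨ψ u, u, u.2, rfl⟩) ?_ ?_
  · intro x
    apply Subtype.ext
    exact (congrArg f (he₀ U x)).trans (hcomm x)
  · rintro ⟨x, u⟩
    rfl

variable {X : Type u} [TopologicalSpace X]

theorem isOpenEmbedding_angle :
    IsOpenEmbedding fun y : ℝ => ((angleParam y : ℝ) : Real.Angle) := by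
  refine .of_continuous_injective_isOpenMap
    (Real.Angle.continuous_coe.comp continuous_angleParam) ?_ ?_
  · intro x y h
    exact angleParam_injective (angle_coe_injOn (angleParam_mem x)
      (Ioo_subset_Ioc_self (angleParam_mem y)) h)
  · exact IsOpenMap.comp (g := fun y : ℝ => (y : Real.Angle))
      (QuotientAddGroup.isOpenMap_coe (N := AddSubgroup.zmultiples (2 * Real.pi)))
      isOpenMap_angleParam

theorem isFibrationAt_toCircleValued {f : X → ℝ} {S : Set ℝ} (hS : IsClosed S)
    (hfib : IsFibration (Sᶜ.restrictPreimage f)) {y : ℝ} (hy : y ∉ S) :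
    IsFibrationAt (toCircleValued f) ((angleParam y : ℝ) : Real.Angle) := by
  have hψ : IsOpenEmbedding ((fun y : ℝ => ((angleParam y : ℝ) : Real.Angle)) ∘
      (Subtype.val : (Sᶜ : Set ℝ) → ℝ)) :=
    isOpenEmbedding_angle.comp hS.isOpen_compl.isOpenEmbedding_subtypeVal
  have := IsFibrationAt.of_isOpenEmbedding (f := toCircleValued f)
    (i := (Subtype.val : (f ⁻¹' Sᶜ : Set X) → X)) IsEmbedding.subtypeVal hψ
    (f₁ := Sᶜ.restrictPreimage f) (fun x => rfl) ?_ (hfib ⟨y, hy⟩)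
  · exact this
  rintro x' ⟨y, hy⟩
  have : y.1 = f x' := isOpenEmbedding_angle.injective hy
  refine ⟨⟨x', ?_⟩, rfl⟩
  rw [mem_preimage, ← this]
  exact y.2

variable {f : X → ℝ}

/-- Near a value which is not critical, all values are attained. -/
theorem exists_eq_of_isFibrationAt {y : ℝ} (hy : y ∈ Ioo 0 (2 * Real.pi))
    (h : IsFibrationAt (toCircleValued f) (y : Real.Angle)) {x₀ : X} (hx₀ : realLift f x₀ = y) :
    ∃ ε > 0, ∀ y' ∈ Ioo (y - ε) (y + ε), ∃ x, realLift f x = y' := by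
  obtain ⟨U, hU, l, k, -, hk, -⟩ := h
  have h1 : (fun y : ℝ => (y : Real.Angle)) ⁻¹' U ∩ Ioo 0 (2 * Real.pi) ∈ 𝓝 y :=
    Filter.inter_mem (Real.Angle.continuous_coe.continuousAt hU) (Ioo_mem_nhds hy.1 hy.2)
  obtain ⟨ε, hε, hball⟩ := Metric.mem_nhds_iff.1 h1
  rw [Real.ball_eq_Ioo] at hball
  refine ⟨ε, hε, fun y' hy' => ?_⟩
  have hmem : x₀ ∈ toCircleValued f ⁻¹' {(y : Real.Angle)} := by rw [fiber_eq hy]; exact hx₀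
  -- The local trivialization takes the point `x₀` of the fiber over `y` to a point over `y'`.
  refine ⟨k (⟨x₀, hmem⟩, ⟨y', (hball hy').1⟩), ?_⟩
  have := congrArg Subtype.val (hk (⟨x₀, hmem⟩, ⟨y', (hball hy').1⟩))
  exact angle_coe_injOn (realLift_mem f _) (Ioo_subset_Ioc_self (hball hy').2) this

variable [CompactSpace X]

/-- The image is compact, hence closed; over its complement both total spaces are empty, and the
condition of a fibration holds trivially. -/
theorem mem_range_of_critical (hf : Continuous f) {θ : Real.Angle}
    (hθ : θ ∈ criticalValues (toCircleValued f)) : θ ∈ range (toCircleValued f) := by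
  by_contra h
  refine hθ ⟨(range (toCircleValued f))ᶜ, ?_, ?_⟩
  · refine IsOpen.mem_nhds (isOpen_compl_iff.2 (isCompact_range ?_).isClosed) h
    exact Real.Angle.continuous_coe.comp (continuous_angleParam.comp hf)
  · have h1 : IsEmpty (toCircleValued f ⁻¹' (range (toCircleValued f))ᶜ : Set X) :=
      ⟨fun x => x.2 ⟨x.1, rfl⟩⟩
    have h2 : IsEmpty (toCircleValued f ⁻¹' {θ} : Set X) := ⟨fun x => h ⟨x.1, x.2⟩⟩
    exact FiberwiseHomotopyEquivalent.of_isEmpty _ _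

/-- Critical values are attained and come from `S`; the closed discrete set `S` meets the compact
image of `f` in a finite set. -/
theorem criticalValues_finite (hf : IsTame f) : (criticalValues (toCircleValued f)).Finite := by
  obtain ⟨S, hS, hSd, hfib⟩ := hf.fibration
  have hfin : (S ∩ range f).Finite := by
    have hc : IsCompact (S ∩ range f) := (isCompact_range hf.continuous).inter_left hS
    refine hc.finite ?_
    exact (isDiscrete_iff_discreteTopology.2 hSd).mono inter_subset_left
  refine (hfin.image fun y : ℝ => ((angleParam y : ℝ) : Real.Angle)).subset ?_
  intro θ hθ
  obtain ⟨x, rfl⟩ := mem_range_of_critical hf.continuous hθ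
  refine ⟨f x, ⟨?_, x, rfl⟩, rfl⟩
  by_contra hx
  exact hθ (isFibrationAt_toCircleValued hS hfib hx)

/-- If the least value were regular, slightly smaller values would be attained as well. This makes
`s₁` the minimum, so that `t₁` has an empty fiber. -/
theorem exists_critical_min [Nonempty X] (hf : Continuous f) :
    ∃ y ∈ Ioo 0 (2 * Real.pi), (y : Real.Angle) ∈ criticalValues (toCircleValued f) ∧
      ∀ x, y ≤ realLift f x := by
  obtain ⟨x₀, -, hx₀⟩ := isCompact_univ.exists_isMinOn univ_nonempty
    (continuous_angleParam.comp hf).continuousOn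
  have hmin : ∀ x, realLift f x₀ ≤ realLift f x := fun x => hx₀ (mem_univ x)
  refine ⟨_, realLift_mem f x₀, fun h => ?_, hmin⟩
  obtain ⟨ε, hε, h⟩ := exists_eq_of_isFibrationAt (realLift_mem f x₀) h rfl
  obtain ⟨x, hx⟩ := h (realLift f x₀ - ε / 2) ⟨by linarith, by linarith⟩
  linarith [hmin x]

theorem exists_critical_max [Nonempty X] (hf : Continuous f) :
    ∃ y ∈ Ioo 0 (2 * Real.pi), (y : Real.Angle) ∈ criticalValues (toCircleValued f) ∧
      ∀ x, realLift f x ≤ y := by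
  obtain ⟨x₀, -, hx₀⟩ := isCompact_univ.exists_isMaxOn univ_nonempty
    (continuous_angleParam.comp hf).continuousOn
  have hmax : ∀ x, realLift f x ≤ realLift f x₀ := fun x => hx₀ (mem_univ x)
  refine ⟨_, realLift_mem f x₀, fun h => ?_, hmax⟩
  obtain ⟨ε, hε, h⟩ := exists_eq_of_isFibrationAt (realLift_mem f x₀) h rfl
  obtain ⟨x, hx⟩ := h (realLift f x₀ + ε / 2) ⟨by linarith, by linarith⟩
  linarith [hmax x]

end Critical

end CircleValued

end

noncomputable section

open Topology Set
open scoped ContinuousMap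

namespace CircleValued

/-! ### The difference map of a representation -/

section Diff

variable {κ : Type v} [Field κ] {m : ℕ}

/-- The map `(x_i) ↦ (α_i x_i - β_i x_{i+1})`. -/
def CyclicRep.diff (ρ : CyclicRep.{v, w} κ m) : (∀ i, ρ.odd i) →ₗ[κ] ∀ i, ρ.even i :=
  LinearMap.pi fun i => ρ.α i ∘ₗ LinearMap.proj i - ρ.β i ∘ₗ LinearMap.proj (finRotate m i)

theorem CyclicRep.diff_apply (ρ : CyclicRep.{v, w} κ m) (x) (i : Fin m) :
    ρ.diff x i = ρ.α i (x i) - ρ.β i (x (finRotate m i)) := rfl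

theorem map_range_of_comm {L L' M M' : Type*} [AddCommGroup L] [Module κ L] [AddCommGroup L']
    [Module κ L'] [AddCommGroup M] [Module κ M] [AddCommGroup M'] [Module κ M'] (p : L →ₗ[κ] M)
    (p' : L' →ₗ[κ] M') (e : L ≃ₗ[κ] L') (e' : M ≃ₗ[κ] M') (h : ∀ x, e' (p x) = p' (e x)) :
    (LinearMap.range p).map (e' : M →ₗ[κ] M') = LinearMap.range p' := by
  ext y
  constructor
  · rintro ⟨_, ⟨x, rfl⟩, rfl⟩
    exact ⟨e x, (h x).symm⟩
  · rintro ⟨x, rfl⟩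
    refine ⟨p (e.symm x), ⟨_, rfl⟩, ?_⟩
    rw [LinearEquiv.coe_coe, h, e.apply_symm_apply]

theorem map_ker_of_comm {L L' M M' : Type*} [AddCommGroup L] [Module κ L] [AddCommGroup L']
    [Module κ L'] [AddCommGroup M] [Module κ M] [AddCommGroup M'] [Module κ M'] (p : L →ₗ[κ] M)
    (p' : L' →ₗ[κ] M') (e : L ≃ₗ[κ] L') (e' : M ≃ₗ[κ] M') (h : ∀ x, e' (p x) = p' (e x)) :
    (LinearMap.ker p).map (e : L →ₗ[κ] L') = LinearMap.ker p' := by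
  ext y
  constructor
  · rintro ⟨x, hx, rfl⟩
    rw [SetLike.mem_coe, LinearMap.mem_ker] at hx
    rw [LinearMap.mem_ker, LinearEquiv.coe_coe, ← h, hx, map_zero]
  · intro hy
    refine ⟨e.symm y, ?_, e.apply_symm_apply y⟩
    rw [SetLike.mem_coe, LinearMap.mem_ker, ← e'.map_eq_zero_iff, h, e.apply_symm_apply]
    exact hy

end Diff

/-! ### Homology of the parts of a space over a subdivided interval -/

section Frame

/-- A function `F` with values in `(0, 2π)` and with critical values among the `s i`. -/
structure IsFrame (κ : Type v) [Field κ] {X : Type u} [TopologicalSpace X] (F : X → ℝ) {m : ℕ}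
    (s t : Fin m → ℝ) : Prop where
  continuous : Continuous F
  mem : ∀ x, F x ∈ Ioo 0 (2 * Real.pi)
  interlaced : Interlaced s t
  critical_mem : ∀ i, s i ∈ Ioo 0 (2 * Real.pi)
  good : ∀ i, ∀ W ∈ 𝓝 (s i), ∃ U ∈ 𝓝 (s i), U ⊆ W ∧ U.OrdConnected ∧
    HomologyIso κ (F ⁻¹' {s i}) (F ⁻¹' U)
  regular : ∀ y ∈ Ioo 0 (2 * Real.pi), (∀ i, y ≠ s i) → LocallyHomologyTrivialAt κ F y
  pos : 0 < m
  le_value : ∀ x (i : Fin m), i.val = 0 → s i ≤ F x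
  value_le : ∀ x (i : Fin m), i.val + 1 = m → F x ≤ s i

variable {m : ℕ}

/-- The gap to the left of `s i`. -/
def gap (s : Fin m → ℝ) (i : Fin m) : Set ℝ :=
  {y | y ∈ Ioo 0 (2 * Real.pi) ∧ ∀ j, (j < i → s j < y) ∧ (i ≤ j → y < s j)}

/-- The two gaps next to `s i`, with `s i`. -/
def star (s : Fin m → ℝ) (i : Fin m) : Set ℝ :=
  {y | y ∈ Ioo 0 (2 * Real.pi) ∧ ∀ j, (j < i → s j < y) ∧ (i < j → y < s j)}

theorem gap_subset_star (s : Fin m → ℝ) (i : Fin m) : gap s i ⊆ star s i :=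
  fun _ hy => ⟨hy.1, fun j => ⟨(hy.2 j).1, fun hij => (hy.2 j).2 hij.le⟩⟩

theorem ordConnected_gap (s : Fin m → ℝ) (i : Fin m) : (gap s i).OrdConnected :=
  ⟨fun _ hx _ hy _ hz => ⟨⟨hx.1.1.trans_le hz.1, hz.2.trans_lt hy.1.2⟩, fun j =>
    ⟨fun hj => ((hx.2 j).1 hj).trans_le hz.1, fun hj => hz.2.trans_lt ((hy.2 j).2 hj)⟩⟩⟩

theorem ordConnected_star (s : Fin m → ℝ) (i : Fin m) : (star s i).OrdConnected :=
  ⟨fun _ hx _ hy _ hz => ⟨⟨hx.1.1.trans_le hz.1, hz.2.trans_lt hy.1.2⟩, fun j =>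
    ⟨fun hj => ((hx.2 j).1 hj).trans_le hz.1, fun hj => hz.2.trans_lt ((hy.2 j).2 hj)⟩⟩⟩

theorem isOpen_star (s : Fin m → ℝ) (i : Fin m) : IsOpen (star s i) := by
  have : star s i = Ioo 0 (2 * Real.pi) ∩
      ⋂ j, ((⋂ _ : j < i, Ioi (s j)) ∩ ⋂ _ : i < j, Iio (s j)) := by
    ext y
    simp [star]
  rw [this]
  exact isOpen_Ioo.inter (isOpen_iInter_of_finite fun j =>
    (isOpen_iInter_of_finite fun _ => isOpen_Ioi).inter
      (isOpen_iInter_of_finite fun _ => isOpen_Iio))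

theorem Interlaced.strictMono {s t : Fin m → ℝ} (h : Interlaced s t) : StrictMono s :=
  fun i j hij => (h.lt_next i j hij).trans (h.lt j)

theorem Interlaced.strictMono' {s t : Fin m → ℝ} (h : Interlaced s t) : StrictMono t :=
  fun i j hij => (h.lt i).trans (h.lt_next i j hij)

theorem Interlaced.lt_two_pi {s t : Fin m → ℝ} (h : Interlaced s t) (i : Fin m) :
    t i < 2 * Real.pi := (h.lt i).trans_le (h.le i)

theorem Interlaced.mem_gap {s t : Fin m → ℝ} (h : Interlaced s t) (i : Fin m) : t i ∈ gap s i :=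
  ⟨⟨h.pos i, h.lt_two_pi i⟩, fun j => ⟨h.lt_next j i, fun hij =>
    (h.lt i).trans_le (h.strictMono.monotone hij)⟩⟩

variable {κ : Type v} [Field κ] {X : Type u} [TopologicalSpace X] {F : X → ℝ} {s t : Fin m → ℝ}

namespace IsFrame

variable (hF : IsFrame κ F s t)

include hF

theorem critical_mem_star (i : Fin m) : s i ∈ star s i :=
  ⟨hF.critical_mem i, fun _ => ⟨fun hj => hF.interlaced.strictMono hj,
    fun hj => hF.interlaced.strictMono hj⟩⟩

/-- The first critical value is the minimum. This is where the cycle is cut open: the gap joining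
the last index to the first has no points of `X` over it. -/
theorem preimage_gap_eq_empty {i : Fin m} (hi : i.val = 0) : F ⁻¹' gap s i = ∅ := by
  refine eq_empty_of_forall_notMem fun x hx => ?_
  exact absurd (hF.le_value x i hi) (not_le.2 ((hx.2 i).2 le_rfl))

theorem preimage_gap_rotate_subset (i : Fin m) :
    F ⁻¹' gap s (finRotate m i) ⊆ F ⁻¹' star s i := by
  rcases Nat.lt_or_ge (i.val + 1) m with hi | hi
  · have hrot := finRotate_val_of_lt hi
    refine fun x hx => ⟨hx.1, fun j => ⟨fun hj => (hx.2 j).1 ?_, fun hj => (hx.2 j).2 ?_⟩⟩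
    · rw [Fin.lt_def] at hj ⊢
      omega
    · rw [Fin.lt_def] at hj
      rw [Fin.le_def]
      omega
  · rw [hF.preimage_gap_eq_empty (finRotate_val_of_eq (le_antisymm i.2 hi))]
    exact empty_subset _

theorem isLinearCover :
    IsLinearCover univ (fun i => F ⁻¹' star s i) fun i => F ⁻¹' gap s i where
  sub _ := subset_univ _
  cover x _ := by
    classical
    -- The star of the greatest critical value `≤ F x` contains `F x`; there is such a value because
    -- the first one is the minimum.
    obtain ⟨i, hi, hmax⟩ := (Finset.univ.filter fun i => s i ≤ F x).exists_maximal
      ⟨⟨0, hF.pos⟩, by simpa using hF.le_value x ⟨0, hF.pos⟩ rfl⟩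
    simp only [Finset.mem_filter, Finset.mem_univ, true_and] at hi hmax
    refine mem_iUnion.2 ⟨i, hF.mem x, fun j => ⟨fun hj => ?_, fun hj => ?_⟩⟩
    · exact (hF.interlaced.strictMono hj).trans_le hi
    · by_contra h
      exact absurd (hmax (not_lt.1 h) hj.le) (not_le.2 hj)
  isOpen i := ⟨_, (isOpen_star s i).preimage hF.continuous, (univ_inter _).symm⟩
  left i := preimage_mono (gap_subset_star s i)
  right := hF.preimage_gap_rotate_subset
  inter i j hij x hx := by
    refine ⟨hx.1.1, fun k => ⟨(hx.2.2 k).1, fun hk => (hx.1.2 k).2 ?_⟩⟩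
    rw [Fin.le_def] at hk
    rw [Fin.lt_def]
    omega
  disjoint i j hij := by
    refine eq_empty_of_forall_notMem fun x hx => ?_
    let k : Fin m := ⟨i.val + 1, by omega⟩
    have h1 := (hx.1.2 k).2 (Fin.lt_def.2 (by simp [k]))
    have h2 := (hx.2.2 k).1 (Fin.lt_def.2 (by simp only [k]; omega))
    exact lt_asymm h1 h2
  first _ := hF.preimage_gap_eq_empty

theorem homologyIso_gap {y : ℝ} {i : Fin m} (hy : y ∈ gap s i) :
    HomologyIso κ (F ⁻¹' {y}) (F ⁻¹' gap s i) := by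
  refine homologyTrivialOn_of_locally hF.continuous (ordConnected_gap s i) ?_ y hy
  refine fun z hz => hF.regular z hz.1 fun j => ?_
  rcases lt_or_ge j i with hj | hj
  · exact ((hz.2 j).1 hj).ne'
  · exact ((hz.2 j).2 hj).ne

theorem homologyIso_of_subset_star {i : Fin m} {V : Set ℝ} (hV : V.OrdConnected)
    (hVs : V ∈ 𝓝 (s i)) (hsub : V ⊆ star s i) : HomologyIso κ (F ⁻¹' {s i}) (F ⁻¹' V) := by
  refine homologyIso_of_critical hF.continuous (hF.good i) hV hVs fun z hz hzi => ?_
  refine hF.regular z (hsub hz).1 fun j => ?_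
  rcases lt_trichotomy j i with hj | rfl | hj
  · exact (((hsub hz).2 j).1 hj).ne'
  · exact hzi
  · exact (((hsub hz).2 j).2 hj).ne

theorem homologyIso_star (i : Fin m) : HomologyIso κ (F ⁻¹' {s i}) (F ⁻¹' star s i) :=
  hF.homologyIso_of_subset_star (ordConnected_star s i)
    ((isOpen_star s i).mem_nhds (hF.critical_mem_star i)) subset_rfl

/-- For the last index `nextAngle` is `t₁ + 2π`, beyond the range of `F`; the intersection with `(0,
2π)` cuts off the excess. -/
theorem Icc_subset_star (i : Fin m) :
    Icc (t i) (nextAngle t i) ∩ Ioo 0 (2 * Real.pi) ⊆ star s i := by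
  refine fun y hy => ⟨hy.2, fun j => ⟨fun hj => ?_, fun hj => ?_⟩⟩
  · exact (hF.interlaced.lt_next j i hj).trans_le hy.1.1
  · have hi : i.val + 1 < m := by
      rw [Fin.lt_def] at hj
      omega
    have h1 : nextAngle t i = t (finRotate m i) := by
      simp [nextAngle, carry, hi.ne]
    have h2 : finRotate m i ≤ j := by
      rw [Fin.le_def, finRotate_val_of_lt hi]
      exact hj
    exact (hy.1.2.trans (h1.le.trans (hF.interlaced.strictMono'.monotone h2))).trans_lt
      (hF.interlaced.lt j)

theorem preimage_Icc (i : Fin m) :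
    F ⁻¹' (Icc (t i) (nextAngle t i) ∩ Ioo 0 (2 * Real.pi)) = F ⁻¹' Icc (t i) (nextAngle t i) := by
  ext x
  exact ⟨fun h => h.1, fun h => ⟨h, hF.mem x⟩⟩

theorem homologyIso_Icc (i : Fin m) :
    HomologyIso κ (F ⁻¹' {s i}) (F ⁻¹' Icc (t i) (nextAngle t i)) := by
  rw [← hF.preimage_Icc i]
  refine hF.homologyIso_of_subset_star (ordConnected_Icc.inter ordConnected_Ioo)
    (Filter.inter_mem ?_ ?_) (hF.Icc_subset_star i)
  · exact Icc_mem_nhds (hF.interlaced.lt i) (hF.interlaced.lt_nextAngle i)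
  · exact Ioo_mem_nhds (hF.critical_mem i).1 (hF.critical_mem i).2

theorem preimage_Icc_subset_star (i : Fin m) :
    F ⁻¹' Icc (t i) (nextAngle t i) ⊆ F ⁻¹' star s i := by
  rw [← hF.preimage_Icc i]
  exact preimage_mono (hF.Icc_subset_star i)

/-- The parameter of a point of the infinite cyclic covering is the value of `F`. -/
theorem eq_of_coe_eq {i : Fin m} {x : X} {τ : ℝ} (hτ : τ ∈ Icc (t i) (nextAngle t i))
    (h : (F x : Real.Angle) = τ) : F x = τ := by
  rcases le_or_gt τ (2 * Real.pi) with hle | hlt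
  · exact angle_coe_injOn (hF.mem x) ⟨(hF.interlaced.pos i).trans_le hτ.1, hle⟩ h
  · exfalso
    -- A parameter `τ > 2π` occurs only at the last index, and then `τ - 2π ≤ t₁ < s₁` lies below
    -- every value of `F`.
    have hi : i.val + 1 = m := by
      by_contra hi
      have h1 : nextAngle t i = t (finRotate m i) := by
        simp [nextAngle, carry, hi]
      exact absurd (hτ.2.trans h1.le)
        (not_le.2 ((hF.interlaced.lt_two_pi _).trans hlt))
    have h1 : nextAngle t i = t (finRotate m i) + 2 * Real.pi := by
      simp [nextAngle, carry, hi]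
    have h2 : τ - 2 * Real.pi ≤ t (finRotate m i) := by linarith [hτ.2]
    have h3 : F x = τ - 2 * Real.pi := by
      refine angle_coe_injOn (hF.mem x) ⟨by linarith, ?_⟩ ?_
      · exact h2.trans (hF.interlaced.lt_two_pi _).le
      · rw [h, Real.Angle.coe_sub, Real.Angle.coe_two_pi, sub_zero]
    linarith [hF.le_value x _ (finRotate_val_of_eq hi), hF.interlaced.lt (finRotate m i)]

end IsFrame

end Frame

end CircleValued

end

noncomputable section

open Topology Set
open scoped ContinuousMap CategoryTheory

namespace CircleValued

/-! ### The representation of a tame map -/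

section FiberRep

variable {κ : Type v} [Field κ]

theorem homologyMap_bijective_of_homeomorph (r : ℕ) {A B : Type u} [TopologicalSpace A]
    [TopologicalSpace B] (e : A ≃ₜ B) :
    Function.Bijective (homologyMap κ r (e : C(A, B))).hom := by
  refine Function.bijective_iff_has_inverse.2
    ⟨(homologyMap κ r (e.symm : C(B, A))).hom, fun x => ?_, fun x => ?_⟩
  · rw [homologyMap_comp, Homeomorph.symm_comp_toContinuousMap, homologyMap_id]
  · rw [homologyMap_comp, Homeomorph.toContinuousMap_comp_symm, homologyMap_id]

theorem hom_compInv {L M N : ModuleCat.{w} κ} (f : L ⟶ M) (j : N ⟶ M)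
    (hj : Function.Bijective j.hom) (x : L) : j.hom (compInv κ f j x) = f.hom x := by
  have hiso : CategoryTheory.IsIso j := (CategoryTheory.ConcreteCategory.isIso_iff_bijective j).2 hj
  rw [compInv, dif_pos hiso]
  have : (f ≫ CategoryTheory.inv j) ≫ j = f := by simp
  exact congrArg (fun φ : L ⟶ M => φ.hom x) this

variable {X : Type u} [TopologicalSpace X] {f : X → ℝ} {m : ℕ} {s t : Fin m → ℝ}

/-- Critical angles are attained, which excludes `s i = 2π`. Minimum and maximum of `realLift f`
occur among the `s i`, so by monotonicity they are bounded by the first and the last one. -/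
theorem isFrame_of_isTame [CompactSpace X] [Nonempty X] (hf : IsTame f) (h : Interlaced s t)
    (hs : range (fun i => (s i : Real.Angle)) = criticalValues (toCircleValued f)) :
    IsFrame κ (realLift f) s t := by
  have hcrit : ∀ i, (s i : Real.Angle) ∈ criticalValues (toCircleValued f) := fun i => by
    rw [← hs]
    exact ⟨i, rfl⟩
  have hIoc : ∀ i, s i ∈ Ioc 0 (2 * Real.pi) := fun i => ⟨(h.pos i).trans (h.lt i), h.le i⟩
  have hmem : ∀ i, s i ∈ Ioo 0 (2 * Real.pi) := fun i => by
    obtain ⟨x, hx⟩ := mem_range_of_critical hf.continuous (hcrit i)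
    rw [← angle_coe_injOn (realLift_mem f x) (hIoc i) hx]
    exact realLift_mem f x
  have hex : ∀ y ∈ Ioo 0 (2 * Real.pi), (y : Real.Angle) ∈ criticalValues (toCircleValued f) →
      ∃ i, y = s i := fun y hy hc => by
    rw [← hs] at hc
    obtain ⟨i, hi⟩ := hc
    exact ⟨i, angle_coe_injOn hy (hIoc i) hi.symm⟩
  obtain ⟨y, hy, hyc, hmin⟩ := exists_critical_min hf.continuous
  obtain ⟨z, hz, hzc, hmax⟩ := exists_critical_max hf.continuous
  obtain ⟨i, rfl⟩ := hex y hy hyc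
  obtain ⟨j, rfl⟩ := hex z hz hzc
  refine ⟨continuous_angleParam.comp hf.continuous, realLift_mem f, h, hmem,
    fun i W hW => exists_good_neighborhood hf.good (hmem i) hW, fun y hy hne => ?_,
    i.pos, fun x k hk => ?_, fun x k hk => ?_⟩
  · refine locallyHomologyTrivialAt_of_isFibrationAt hf.continuous hy ?_
    by_contra hc
    obtain ⟨i, hi⟩ := hex y hy hc
    exact hne i hi
  · refine (h.strictMono.monotone ?_).trans (hmin x)
    rw [Fin.le_def]
    omega
  · refine (hmax x).trans (h.strictMono.monotone ?_)
    rw [Fin.le_def]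
    omega

theorem rank_setHomology_univ {X : Type u} [TopologicalSpace X] (r : ℕ) :
    Module.rank κ (setHomology κ r (univ : Set X)) = betti κ r X := by
  exact (LinearEquiv.ofBijective _ (homologyMap_bijective_of_homeomorph (κ := κ) r
    (Homeomorph.Set.univ X))).rank_eq

theorem betti_fiber_empty (r : ℕ) {θ : Real.Angle} (hθ : toCircleValued f ⁻¹' {θ} = ∅) :
    betti κ r (Fiber (toCircleValued f) θ) = 0 := by
  have := setHomology_empty (κ := κ) r hθ
  exact rank_subsingleton' κ _

namespace IsFrame

variable (hF : IsFrame κ (realLift f) s t)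

include hF

/-- The part of the infinite cyclic covering around `s i` is a part of the space itself. -/
def coverHomeo (i : Fin m) : (realLift f ⁻¹' Icc (t i) (nextAngle t i) : Set X) ≃ₜ
    CoverPart (toCircleValued f) (t i) (nextAngle t i) where
  toFun x := ⟨(x.1, realLift f x.1), rfl, x.2⟩
  invFun z := ⟨z.1.1, by
    rw [mem_preimage, hF.eq_of_coe_eq z.2.2 z.2.1]
    exact z.2.2⟩
  left_inv _ := rfl
  right_inv z := Subtype.ext (Prod.ext rfl (hF.eq_of_coe_eq z.2.2 z.2.1))
  continuous_toFun := by
    have := hF.continuous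
    fun_prop
  continuous_invFun := by fun_prop

theorem fiber_subset {i : Fin m} {τ : ℝ} {θ : Real.Angle} (hτ : τ ∈ Icc (t i) (nextAngle t i))
    (hθ : θ = (τ : Real.Angle)) :
    toCircleValued f ⁻¹' {θ} ⊆ realLift f ⁻¹' Icc (t i) (nextAngle t i) := by
  intro x hx
  rw [mem_preimage, hF.eq_of_coe_eq hτ (Eq.trans hx hθ)]
  exact hτ

theorem homologyMap_fiberInclusion (r : ℕ) {i : Fin m} {τ : ℝ} {θ : Real.Angle}
    (hτ : τ ∈ Icc (t i) (nextAngle t i)) (hθ : θ = (τ : Real.Angle)) (x) :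
    (homologyMap κ r (fiberInclusion (toCircleValued f) hτ hθ)).hom x =
      (homologyMap κ r (hF.coverHomeo i : C(_, _))).hom (incl κ r (hF.fiber_subset hτ hθ) x) := by
  have : fiberInclusion (toCircleValued f) hτ hθ = (hF.coverHomeo i : C(_, _)).comp
      ⟨Set.inclusion (hF.fiber_subset hτ hθ), continuous_inclusion _⟩ := by
    ext1 y
    exact Subtype.ext (Prod.ext rfl (hF.eq_of_coe_eq hτ (Eq.trans y.2 hθ)).symm)
  rw [incl, homologyMap_comp, this]

theorem fiber_critical (i : Fin m) :
    toCircleValued f ⁻¹' {(s i : Real.Angle)} = realLift f ⁻¹' {s i} :=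
  fiber_eq (hF.critical_mem i)

/-- Hence the maps `compInv` in `fiberRep` never take the default value `0`. -/
theorem homologyMap_critical_bijective (r : ℕ) {i : Fin m}
    (hτ : s i ∈ Icc (t i) (nextAngle t i)) :
    Function.Bijective (homologyMap κ r (fiberInclusion (toCircleValued f) hτ rfl)).hom := by
  have h1 : HomologyIso κ (toCircleValued f ⁻¹' {(s i : Real.Angle)})
      (realLift f ⁻¹' Icc (t i) (nextAngle t i)) := by
    rw [hF.fiber_critical]
    exact hF.homologyIso_Icc i
  have h2 := (homologyMap_bijective_of_homeomorph (κ := κ) r (hF.coverHomeo i)).comp (h1.2 r)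
  convert h2 using 1
  ext x
  exact hF.homologyMap_fiberInclusion r hτ rfl x

/-- The inverse in `α` and `β` goes back from the part over `[t_i, t_{i+1}]` to the critical fiber.
That part lies in the part over the star, and after passing to the latter only plain inclusions
remain. -/
theorem incl_compInv (r : ℕ) {i : Fin m} {τ : ℝ} {θ : Real.Angle}
    (hs : s i ∈ Icc (t i) (nextAngle t i)) (hτ : τ ∈ Icc (t i) (nextAngle t i))
    (hθ : θ = (τ : Real.Angle)) (hsU : toCircleValued f ⁻¹' {(s i : Real.Angle)} ⊆
      realLift f ⁻¹' star s i) (hτU : toCircleValued f ⁻¹' {θ} ⊆ realLift f ⁻¹' star s i) (x) :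
    incl κ r hsU (compInv κ (homologyMap κ r (fiberInclusion (toCircleValued f) hτ hθ))
      (homologyMap κ r (fiberInclusion (toCircleValued f) hs rfl)) x) = incl κ r hτU x := by
  have h1 := hom_compInv (homologyMap κ r (fiberInclusion (toCircleValued f) hτ hθ))
    (homologyMap κ r (fiberInclusion (toCircleValued f) hs rfl))
    (hF.homologyMap_critical_bijective r hs) x
  rw [hF.homologyMap_fiberInclusion, hF.homologyMap_fiberInclusion] at h1
  have h2 := (homologyMap_bijective_of_homeomorph (κ := κ) r (hF.coverHomeo i)).1 h1
  have h3 := congrArg (incl κ r (hF.preimage_Icc_subset_star i)) h2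
  rwa [incl_incl, incl_incl] at h3

theorem homologyIso_fiber_gap (i : Fin m) :
    HomologyIso κ (toCircleValued f ⁻¹' {(t i : Real.Angle)}) (realLift f ⁻¹' gap s i) := by
  rw [fiber_eq (hF.interlaced.mem_gap i).1]
  exact hF.homologyIso_gap (hF.interlaced.mem_gap i)

theorem homologyIso_fiber_star (i : Fin m) :
    HomologyIso κ (toCircleValued f ⁻¹' {(s i : Real.Angle)}) (realLift f ⁻¹' star s i) := by
  rw [hF.fiber_critical]
  exact hF.homologyIso_star i

/-- The homology of the fiber over `t i` is that of the gap. -/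
def oddEquiv (r : ℕ) (i : Fin m) :
    (fiberRep κ (toCircleValued f) hF.interlaced r).odd i ≃ₗ[κ]
      setHomology κ r (realLift f ⁻¹' gap s i) :=
  LinearEquiv.ofBijective (incl κ r (hF.homologyIso_fiber_gap i).1)
    ((hF.homologyIso_fiber_gap i).2 r)

/-- The homology of the fiber over `s i` is that of its star. -/
def evenEquiv (r : ℕ) (i : Fin m) :
    (fiberRep κ (toCircleValued f) hF.interlaced r).even i ≃ₗ[κ]
      setHomology κ r (realLift f ⁻¹' star s i) :=
  LinearEquiv.ofBijective (incl κ r (hF.homologyIso_fiber_star i).1)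
    ((hF.homologyIso_fiber_star i).2 r)

theorem evenEquiv_α (r : ℕ) (i : Fin m) (x) : hF.evenEquiv r i
    ((fiberRep κ (toCircleValued f) hF.interlaced r).α i x) =
      incl κ r (hF.isLinearCover.left i) (hF.oddEquiv r i x) := by
  refine (hF.incl_compInv r _ _ rfl _
    ((hF.homologyIso_fiber_gap i).1.trans (hF.isLinearCover.left i)) x).trans ?_
  exact (incl_incl r _ _ x).symm

theorem evenEquiv_β (r : ℕ) (i : Fin m) (x) : hF.evenEquiv r i
    ((fiberRep κ (toCircleValued f) hF.interlaced r).β i x) =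
      incl κ r (hF.isLinearCover.right i) (hF.oddEquiv r (finRotate m i) x) := by
  refine (hF.incl_compInv r _ _ _ _
    ((hF.homologyIso_fiber_gap _).1.trans (hF.isLinearCover.right i)) x).trans ?_
  exact (incl_incl r _ _ x).symm

/-- This links algebra and topology: the difference map of `ρ_r` is that of the Mayer-Vietoris
sequence of the stars, so its kernel and cokernel compute the homology of `X`. -/
theorem diff_comm (r : ℕ) (x) :
    LinearEquiv.piCongrRight (hF.evenEquiv r)
      ((fiberRep κ (toCircleValued f) hF.interlaced r).diff x) =
      hF.isLinearCover.diffMap κ r (LinearEquiv.piCongrRight (hF.oddEquiv r) x) := by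
  ext i
  rw [IsLinearCover.diffMap_apply, LinearEquiv.piCongrRight_apply, CyclicRep.diff_apply, map_sub,
    hF.evenEquiv_α, hF.evenEquiv_β]
  rfl

theorem ker_sumMap (r : ℕ) : LinearMap.ker (hF.isLinearCover.sumMap κ r) =
    LinearMap.range (hF.isLinearCover.diffMap κ r) := by
  ext x
  constructor
  · intro hx
    obtain ⟨y, hy⟩ := hF.isLinearCover.exists_diffMap_of_sumMap_eq_zero hx
    exact ⟨y, hy⟩
  · rintro ⟨y, rfl⟩
    exact hF.isLinearCover.sumMap_diffMap r y

theorem rank_range_sumMap (r : ℕ) :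
    Module.rank κ (LinearMap.range (hF.isLinearCover.sumMap κ r)) =
      Module.rank κ ((∀ i, (fiberRep κ (toCircleValued f) hF.interlaced r).even i) ⧸
        LinearMap.range (fiberRep κ (toCircleValued f) hF.interlaced r).diff) := by
  have e := (Submodule.Quotient.equiv _ _ (LinearEquiv.piCongrRight (hF.evenEquiv r))
    (map_range_of_comm _ _ _ _ (hF.diff_comm r))).trans
      (Submodule.quotEquivOfEq _ _ (hF.ker_sumMap r).symm)
  exact (e.trans (LinearMap.quotKerEquivRange _)).rank_eq.symm

theorem betti_zero : betti κ 0 X =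
    Module.rank κ ((∀ i, (fiberRep κ (toCircleValued f) hF.interlaced 0).even i) ⧸
      LinearMap.range (fiberRep κ (toCircleValued f) hF.interlaced 0).diff) := by
  rw [← rank_setHomology_univ, ← hF.rank_range_sumMap,
    LinearMap.range_eq_top.2 hF.isLinearCover.sumMap_zero_surjective, rank_top]

/-- By exactness the image of the sum map is the cokernel of the difference map in degree `r + 1`,
and the quotient by this image is the kernel in degree `r`. Ranks over a field add up, also infinite
ones. -/
theorem betti_succ (r : ℕ) : betti κ (r + 1) X =
    Module.rank κ ((∀ i, (fiberRep κ (toCircleValued f) hF.interlaced (r + 1)).even i) ⧸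
      LinearMap.range (fiberRep κ (toCircleValued f) hF.interlaced (r + 1)).diff) +
    Module.rank κ (LinearMap.ker (fiberRep κ (toCircleValued f) hF.interlaced r).diff) := by
  obtain ⟨e⟩ := hF.isLinearCover.nonempty_quotient_equiv_ker (κ := κ) r
  have e' := LinearEquiv.ofSubmodules (LinearEquiv.piCongrRight (hF.oddEquiv r)) _ _
    (map_ker_of_comm _ _ _ _ (hF.diff_comm r))
  rw [← rank_setHomology_univ, ← hF.rank_range_sumMap, e'.rank_eq, ← e.rank_eq]
  exact ((add_comm _ _).trans (Submodule.rank_quotient_add_rank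
    (LinearMap.range (hF.isLinearCover.sumMap κ (r + 1))))).symm

theorem subsingleton_odd (r : ℕ) {i : Fin m} (hi : i.val = 0) :
    Subsingleton ((fiberRep κ (toCircleValued f) hF.interlaced r).odd i) :=
  have := setHomology_empty (κ := κ) r (hF.preimage_gap_eq_empty hi)
  (hF.oddEquiv r i).toEquiv.subsingleton

theorem betti_fiber_gap (r : ℕ) {i : Fin m} {y : ℝ} (hy : y ∈ gap s i) :
    betti κ r (Fiber (toCircleValued f) (y : Real.Angle)) =
      Module.rank κ ((fiberRep κ (toCircleValued f) hF.interlaced r).odd i) := by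
  have h : HomologyIso κ (toCircleValued f ⁻¹' {(y : Real.Angle)}) (realLift f ⁻¹' gap s i) := by
    rw [fiber_eq hy.1]
    exact hF.homologyIso_gap hy
  exact ((LinearEquiv.ofBijective _ (h.2 r)).trans (hF.oddEquiv r i).symm).rank_eq

end IsFrame

end FiberRep

end CircleValued

end

noncomputable section

open Set

namespace CircleValued

/-! ### Kernels and cokernels of direct sums -/

section DirectSum

variable {κ : Type v} [Field κ] {ι : Type w}

section MapRange

variable {M N : ι → Type w'} [∀ b, AddCommGroup (M b)] [∀ b, AddCommGroup (N b)]
  [∀ b, Module κ (M b)] [∀ b, Module κ (N b)] (D : ∀ b, M b →ₗ[κ] N b)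

theorem mapRange_mem_range_iff (y : Π₀ b, N b) :
    y ∈ LinearMap.range (DFinsupp.mapRange.linearMap D) ↔ ∀ b, y b ∈ LinearMap.range (D b) := by
  classical
  constructor
  · rintro ⟨x, rfl⟩ b
    exact ⟨x b, rfl⟩
  · intro h
    choose x hx using h
    -- Preimages are used on the support of `y` only, to keep the support finite.
    refine ⟨DFinsupp.mk y.support fun b => x b, ?_⟩
    ext b
    rw [DFinsupp.mapRange.linearMap_apply, DFinsupp.mapRange_apply, DFinsupp.mk_apply]
    split_ifs with hb
    · exact hx b
    · rw [map_zero, DFinsupp.notMem_support_iff.1 hb]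

theorem rank_dfinsupp : Module.rank κ (Π₀ b, M b) = Cardinal.sum fun b => Module.rank κ (M b) :=
  rank_directSum (R := κ) M

theorem rank_quotient_range_mapRange :
    Module.rank κ ((Π₀ b, N b) ⧸ LinearMap.range (DFinsupp.mapRange.linearMap D)) =
      Cardinal.sum fun b => Module.rank κ (N b ⧸ LinearMap.range (D b)) := by
  have hker : LinearMap.ker (DFinsupp.mapRange.linearMap fun b => (LinearMap.range (D b)).mkQ) =
      LinearMap.range (DFinsupp.mapRange.linearMap D) := by
    ext y
    rw [mapRange_mem_range_iff, LinearMap.mem_ker, DFinsupp.ext_iff]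
    exact forall_congr' fun b => Submodule.Quotient.mk_eq_zero _
  have hsurj : LinearMap.range (DFinsupp.mapRange.linearMap
      fun b => (LinearMap.range (D b)).mkQ) = ⊤ := by
    rw [eq_top_iff]
    intro y _
    exact (mapRange_mem_range_iff _ y).2 fun b => Submodule.mkQ_surjective _ (y b)
  rw [← rank_dfinsupp, ← hker]
  exact (LinearMap.quotKerEquivOfSurjective _ (LinearMap.range_eq_top.1 hsurj)).rank_eq

theorem rank_ker_mapRange :
    Module.rank κ (LinearMap.ker (DFinsupp.mapRange.linearMap D)) =
      Cardinal.sum fun b => Module.rank κ (LinearMap.ker (D b)) := by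
  have hrange : LinearMap.range (DFinsupp.mapRange.linearMap
      fun b => (LinearMap.ker (D b)).subtype) = LinearMap.ker (DFinsupp.mapRange.linearMap D) := by
    ext y
    rw [mapRange_mem_range_iff, LinearMap.mem_ker, DFinsupp.ext_iff]
    refine forall_congr' fun b => ?_
    rw [Submodule.range_subtype]
    rfl
  have hinj : Function.Injective (DFinsupp.mapRange.linearMap
      fun b => (LinearMap.ker (D b)).subtype) := by
    intro x y h
    ext b
    exact DFunLike.congr_fun h b
  rw [← rank_dfinsupp, ← hrange]
  exact (LinearEquiv.ofInjective _ hinj).rank_eq.symm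

end MapRange

/-- Finite products commute with direct sums. -/
def piDFinsuppEquiv {α : Type*} [Fintype α] [DecidableEq α] (M : ι → α → Type w')
    [∀ b i, AddCommGroup (M b i)] [∀ b i, Module κ (M b i)] :
    (Π₀ b, ∀ i, M b i) ≃ₗ[κ] ∀ i, Π₀ b, M b i :=
  LinearEquiv.ofBijective
    (LinearMap.pi fun i => DFinsupp.mapRange.linearMap fun b => LinearMap.proj i) (by
      constructor
      · intro x y h
        ext b i
        exact DFunLike.congr_fun (congrFun h i) b
      · intro y
        refine ⟨∑ i, DFinsupp.mapRange.linearMap (fun b => LinearMap.single κ _ i) (y i), ?_⟩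
        ext i b
        simp [DFinsupp.finsetSum_apply])

namespace CyclicRep

variable {m : ℕ}

theorem directSum_diff (ρ : ι → CyclicRep.{v, w'} κ m) (x : Π₀ b, ∀ i, (ρ b).odd i) :
    piDFinsuppEquiv (κ := κ) (fun b i => (ρ b).even i)
      (DFinsupp.mapRange.linearMap (fun b => (ρ b).diff) x) =
      (directSum ρ).diff (piDFinsuppEquiv (κ := κ) (fun b i => (ρ b).odd i) x) := by
  ext i b
  rfl

theorem rank_ker_directSum_diff (ρ : ι → CyclicRep.{v, w'} κ m) :
    Module.rank κ (LinearMap.ker (directSum ρ).diff) =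
      Cardinal.sum fun b => Module.rank κ (LinearMap.ker (ρ b).diff) := by
  rw [← rank_ker_mapRange]
  exact (LinearEquiv.ofSubmodules _ _ _
    (map_ker_of_comm _ _ _ _ (directSum_diff ρ))).rank_eq.symm

theorem rank_coker_directSum_diff (ρ : ι → CyclicRep.{v, w'} κ m) :
    Module.rank κ ((∀ i, (directSum ρ).even i) ⧸ LinearMap.range (directSum ρ).diff) =
      Cardinal.sum fun b =>
        Module.rank κ ((∀ i, (ρ b).even i) ⧸ LinearMap.range (ρ b).diff) := by
  rw [← rank_quotient_range_mapRange]
  exact (Submodule.Quotient.equiv _ _ _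
    (map_range_of_comm _ _ _ _ (directSum_diff ρ))).rank_eq.symm

variable {ρ σ : CyclicRep.{v, w} κ m}

theorem Iso.diff_comm (e : ρ.Iso σ) (x) : LinearEquiv.piCongrRight e.even (ρ.diff x) =
    σ.diff (LinearEquiv.piCongrRight e.odd x) := by
  ext i
  rw [LinearEquiv.piCongrRight_apply, diff_apply, map_sub, e.comm_α, e.comm_β]
  rfl

theorem Iso.rank_ker_diff (e : ρ.Iso σ) :
    Module.rank κ (LinearMap.ker ρ.diff) = Module.rank κ (LinearMap.ker σ.diff) :=
  (LinearEquiv.ofSubmodules _ _ _ (map_ker_of_comm _ _ _ _ e.diff_comm)).rank_eq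

theorem Iso.rank_coker_diff (e : ρ.Iso σ) :
    Module.rank κ ((∀ i, ρ.even i) ⧸ LinearMap.range ρ.diff) =
      Module.rank κ ((∀ i, σ.even i) ⧸ LinearMap.range σ.diff) :=
  (Submodule.Quotient.equiv _ _ _ (map_range_of_comm _ _ _ _ e.diff_comm)).rank_eq

/-- A representation does not change if a zero representation is added. -/
def Iso.ofProd {σ' : CyclicRep.{v, w} κ m} (e : ρ.Iso (σ.prod σ'))
    (ho : ∀ i, Subsingleton (σ'.odd i)) (he : ∀ i, Subsingleton (σ'.even i)) : ρ.Iso σ where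
  odd i := (e.odd i).trans (LinearEquiv.ofBijective (LinearMap.fst κ (σ.odd i) (σ'.odd i))
    ⟨fun _ _ h => Prod.ext h ((ho i).elim _ _), Prod.fst_surjective⟩)
  even i := (e.even i).trans (LinearEquiv.ofBijective (LinearMap.fst κ (σ.even i) (σ'.even i))
    ⟨fun _ _ h => Prod.ext h ((he i).elim _ _), Prod.fst_surjective⟩)
  comm_α i x := congrArg Prod.fst (e.comm_α i x)
  comm_β i x := congrArg Prod.fst (e.comm_β i x)

end CyclicRep

end DirectSum

/-! ### Representations which vanish at one vertex -/

section Vanishing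

variable {κ : Type v} [Field κ] {m : ℕ} {s t : Fin m → ℝ}

theorem subsingleton_of_baseChange {M : Type w} [AddCommGroup M] [Module κ M] (K : Type v) [Field K]
    [Algebra κ K] (h : Subsingleton (TensorProduct κ K M)) : Subsingleton M := by
  have h1 : Module.rank K (TensorProduct κ K M) = 0 := rank_subsingleton' K _
  rw [Module.rank_baseChange, Cardinal.lift_eq_zero] at h1
  exact rank_zero_iff.1 h1

/-- If a representation vanishes at an odd vertex, it has no Jordan cells and is the sum of the
representations of its bar codes. -/
theorem HasInvariants.isEmpty_and_iso {ρ : CyclicRep.{v, max w v} κ m} {ι ι' : Type (max w v)}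
    {B : ι → BarCode s} {J : ι' → JordanCell (AlgebraicClosure κ)} (h : HasInvariants t ρ B J)
    {i : Fin m} (hi : Subsingleton (ρ.odd i)) :
    IsEmpty ι' ∧ Nonempty (ρ.Iso (CyclicRep.directSum fun b => (B b).rep κ t)) := by
  obtain ⟨ρ', ⟨e⟩, ⟨e'⟩⟩ := h
  have h1 : Subsingleton (ρ'.odd i) := by
    refine ⟨fun x y => ?_⟩
    have : ((0, x) : ((CyclicRep.directSum fun b => (B b).rep κ t).prod ρ').odd i) = (0, y) :=
      (e.odd i).symm.toEquiv.subsingleton.elim _ _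
    exact congrArg Prod.snd this
  have h2 : Subsingleton ((ρ'.baseChange (AlgebraicClosure κ)).odd i) :=
    inferInstanceAs (Subsingleton (TensorProduct κ (AlgebraicClosure κ) (ρ'.odd i)))
  -- A Jordan cell has a non-zero space at every vertex, also at the one where `ρ` vanishes.
  have h3 : IsEmpty ι' := by
    classical
    refine ⟨fun j => ?_⟩
    have := (e'.odd i).symm.toEquiv.subsingleton
    have h4 : Subsingleton (Π₀ j, Fin (J j).size → AlgebraicClosure κ) := this
    have h5 := DFunLike.congr_fun (h4.elim (DFinsupp.single j fun _ => 1) 0) j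
    rw [DFinsupp.single_eq_same] at h5
    exact one_ne_zero (congrFun h5 ⟨0, (J j).size_pos⟩)
  have h6 : Subsingleton (Π₀ j, Fin (J j).size → AlgebraicClosure κ) :=
    ⟨fun x y => DFinsupp.ext fun j => h3.elim j⟩
  -- Without Jordan cells `ρ'` vanishes after extension of scalars, hence vanishes itself.
  exact ⟨h3, ⟨e.ofProd (fun k => subsingleton_of_baseChange (AlgebraicClosure κ)
    ((e'.odd k).toEquiv.subsingleton_congr.2 h6)) fun k =>
      subsingleton_of_baseChange (AlgebraicClosure κ)
        ((e'.even k).toEquiv.subsingleton_congr.2 h6)⟩⟩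

end Vanishing

end CircleValued

end

noncomputable section

open Set

namespace CircleValued

/-! ### Bar codes without full turns -/

theorem Interlaced.regular_mem_Ioc {m : ℕ} {s t : Fin m → ℝ} (h : Interlaced s t) (i : Fin m) :
    t i ∈ Ioc 0 (2 * Real.pi) := ⟨h.pos i, (h.lt_two_pi i).le⟩

theorem Interlaced.critical_mem_Ioc {m : ℕ} {s t : Fin m → ℝ} (h : Interlaced s t) (i : Fin m) :
    s i ∈ Ioc 0 (2 * Real.pi) := ⟨(h.pos i).trans (h.lt i), h.le i⟩

namespace BarCode

variable {m : ℕ} {s t : Fin m → ℝ} (b : BarCode s)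

theorem mem_interval {τ : ℝ} : τ ∈ b.interval ↔
    (b.first < τ ∨ (b.leftClosed = true ∧ τ = b.first)) ∧
    (τ < b.last ∨ (b.rightClosed = true ∧ τ = b.last)) := Iff.rfl

theorem interval_subset : b.interval ⊆ Icc b.first b.last := by
  rintro τ ⟨h1 | ⟨-, h1⟩, h2 | ⟨-, h2⟩⟩
  · exact ⟨h1.le, h2.le⟩
  · exact ⟨h1.le, h2.le⟩
  · exact ⟨h1.ge, h2.le⟩
  · exact ⟨h1.ge, h2.le⟩

theorem interval_nonempty : b.interval.Nonempty := b.nonempty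

/-- A bar code which avoids a regular angle makes no full turn. -/
theorem turns_eq_zero (h : Interlaced s t) {i : Fin m} (hi : i.val = 0)
    (hno : ∀ n : ℤ, t i + 2 * Real.pi * n ∉ b.interval) : b.turns = 0 := by
  by_contra hne
  -- After a full turn `t₁ + 2π` would be interior to the bar code: it exceeds `2π ≥ s_left`, and
  -- `t₁ < s_right`.
  refine hno 1 ⟨Or.inl ?_, Or.inl ?_⟩
  · have h1 := h.le b.left
    have h2 := h.pos i
    rw [first]
    push_cast
    linarith
  · have h1 : t i < s b.right := (h.lt i).trans_le (h.strictMono.monotone (by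
      rw [Fin.le_def]
      omega))
    have h2 : (1 : ℝ) ≤ b.turns := by exact_mod_cast Nat.one_le_iff_ne_zero.2 hne
    have h3 : 2 * Real.pi * 1 ≤ 2 * Real.pi * b.turns :=
      mul_le_mul_of_nonneg_left h2 Real.two_pi_pos.le
    rw [last]
    push_cast
    linarith

variable {b}

theorem last_eq (hb : b.turns = 0) : b.last = s b.right := by
  simp [last, hb]

theorem interval_subset_Ioc (h : Interlaced s t) (hb : b.turns = 0) :
    b.interval ⊆ Ioc 0 (2 * Real.pi) := by
  intro τ hτ
  have h1 := b.interval_subset hτ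
  rw [last_eq hb] at h1
  exact ⟨((h.pos _).trans (h.lt _)).trans_le h1.1, h1.2.trans (h.le _)⟩

theorem add_mem_interval_iff (h : Interlaced s t) (hb : b.turns = 0) {a : ℝ}
    (ha : a ∈ Ioc 0 (2 * Real.pi)) (n : ℤ) :
    a + 2 * Real.pi * n ∈ b.interval ↔ n = 0 ∧ a ∈ b.interval := by
  constructor
  · intro hn
    have h1 := interval_subset_Ioc h hb hn
    have h2 : n = 0 := by
      have hpi := Real.two_pi_pos
      by_contra hne
      rcases lt_or_gt_of_ne hne with h3 | h3
      · have h4 : (n : ℝ) ≤ -1 := by exact_mod_cast (by omega : n ≤ -1)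
        nlinarith [h1.1, ha.2]
      · have h4 : (1 : ℝ) ≤ n := by exact_mod_cast (by omega : 1 ≤ n)
        nlinarith [h1.2, ha.1]
    refine ⟨h2, ?_⟩
    simpa [h2] using hn
  · rintro ⟨rfl, hn⟩
    simpa using hn

theorem left_le_right (h : Interlaced s t) (hb : b.turns = 0) : b.left ≤ b.right := by
  obtain ⟨τ, hτ⟩ := b.interval_nonempty
  have h1 := b.interval_subset hτ
  rw [last_eq hb] at h1
  exact h.strictMono.le_iff_le.1 (h1.1.trans h1.2)

/-- An interval with equal ends is non-empty only if it is closed at both. -/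
theorem bothClosed_of_eq (hb : b.turns = 0) (hlr : b.left = b.right) : b.BothClosed := by
  obtain ⟨τ, hτ⟩ := b.interval_nonempty
  have h1 := b.interval_subset hτ
  rw [mem_interval] at hτ
  have h2 : b.last = b.first := by rw [last_eq hb, ← hlr, first]
  rw [h2] at hτ h1
  have h3 : τ = b.first := le_antisymm h1.2 h1.1
  simpa [BothClosed, h3] using hτ

/-- The ends of a bar code are critical values, so it contains a gap entirely or misses it. -/
theorem mem_interval_of_mem_gap (hb : b.turns = 0) {y : ℝ} {i : Fin m}
    (hy : y ∈ gap s i) : y ∈ b.interval ↔ b.left < i ∧ i ≤ b.right := by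
  have h1 : ∀ j, s j < y ↔ j < i := fun j =>
    ⟨fun hj => not_le.1 fun hij => lt_asymm hj ((hy.2 j).2 hij), (hy.2 j).1⟩
  have h2 : ∀ j, y < s j ↔ i ≤ j := fun j =>
    ⟨fun hj => not_lt.1 fun hij => lt_asymm hj ((hy.2 j).1 hij), (hy.2 j).2⟩
  have h3 : ∀ j, y ≠ s j := fun j => by
    rcases lt_or_ge j i with hj | hj
    · exact ((h1 j).2 hj).ne'
    · exact ((h2 j).2 hj).ne
  rw [mem_interval, last_eq hb, first, h1, h2]
  simp [h3]

theorem critical_mem_interval (h : Interlaced s t) (hb : b.turns = 0) {i : Fin m} :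
    s i ∈ b.interval ↔ (b.left < i ∨ (b.leftClosed = true ∧ i = b.left)) ∧
      (i < b.right ∨ (b.rightClosed = true ∧ i = b.right)) := by
  rw [mem_interval, last_eq hb, first, h.strictMono.lt_iff_lt, h.strictMono.lt_iff_lt,
    h.strictMono.injective.eq_iff, h.strictMono.injective.eq_iff]

end BarCode

/-! ### The difference map of a bar code -/

section BarDiff

variable {κ : Type v} [Field κ]

/-- The sum of the coordinates. -/
def total (I : Set ℝ) (a : ℝ) : PointSpace κ I a →ₗ[κ] κ :=
  Finsupp.linearCombination κ fun _ => 1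

theorem total_single {I : Set ℝ} {a : ℝ} (n : {n : ℤ // a + 2 * Real.pi * n ∈ I}) (x : κ) :
    total I a (Finsupp.single n x) = x := by
  simp [total]

/-- A bar code without full turns has at most one point on each ray. On its point spaces `total` is
therefore a coordinate that needs no case distinction. -/
theorem total_injective {I : Set ℝ} {a : ℝ} (h : Subsingleton {n : ℤ // a + 2 * Real.pi * n ∈ I}) :
    Function.Injective (total (κ := κ) I a) := by
  rw [← LinearMap.ker_eq_bot, LinearMap.ker_eq_bot']
  intro x hx
  ext n
  have h1 : x = Finsupp.single n (x n) := by
    ext k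
    rw [Subsingleton.elim k n, Finsupp.single_eq_same]
  rw [h1, total_single] at hx
  exact hx

open Classical in
theorem total_pointMap {I : Set ℝ} {a b : ℝ} (h : ∀ n : ℤ, a + 2 * Real.pi * n ∈ I → n = 0)
    (x : PointSpace κ I a) :
    total I b (pointMap κ I a b 0 x) = if b ∈ I then total I a x else 0 := by
  induction x using Finsupp.induction_linear with
  | zero => simp
  | add x y hx hy =>
    rw [map_add, map_add, map_add, hx, hy]
    split_ifs <;> simp
  | single n x =>
    rw [total_single, pointMap, Finsupp.linearCombination_single, map_smul]
    have hn := h n.1 n.2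
    have h1 : b + 2 * Real.pi * ((n.1 - 0 : ℤ) : ℝ) = b := by rw [hn]; simp
    by_cases hb : b ∈ I
    · rw [dif_pos (by rwa [h1]), if_pos hb, total_single, smul_eq_mul, mul_one]
    · rw [dif_neg (by rwa [h1]), if_neg hb, map_zero, smul_zero]

variable {m : ℕ} {s t : Fin m → ℝ} {b : BarCode s}

theorem finrank_pointSpace (h : Interlaced s t) (hb : b.turns = 0) {a : ℝ}
    (ha : a ∈ Ioc 0 (2 * Real.pi)) [Decidable (a ∈ b.interval)] :
    Module.finrank κ (PointSpace κ b.interval a) = if a ∈ b.interval then 1 else 0 := by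
  classical
  have hfin : Subsingleton {n : ℤ // a + 2 * Real.pi * n ∈ b.interval} :=
    ⟨fun x y => Subtype.ext (((BarCode.add_mem_interval_iff h hb ha _).1 x.2).1.trans
      ((BarCode.add_mem_interval_iff h hb ha _).1 y.2).1.symm)⟩
  have := Fintype.ofFinite {n : ℤ // a + 2 * Real.pi * n ∈ b.interval}
  rw [Module.finrank_finsupp_self]
  split_ifs with hmem
  · have : Nonempty {n : ℤ // a + 2 * Real.pi * n ∈ b.interval} := ⟨⟨0, by simpa using hmem⟩⟩
    exact Fintype.card_eq_one_iff_nonempty_unique.2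
      ⟨⟨⟨Classical.arbitrary _⟩, fun _ => Subsingleton.elim _ _⟩⟩
  · have : IsEmpty {n : ℤ // a + 2 * Real.pi * n ∈ b.interval} :=
      ⟨fun n => hmem ((BarCode.add_mem_interval_iff h hb ha _).1 n.2).2⟩
    exact Fintype.card_eq_zero

namespace BarCode

variable (h : Interlaced s t) (hb : b.turns = 0)
include h hb

theorem t_mem_interval (i : Fin m) : t i ∈ b.interval ↔ b.left < i ∧ i ≤ b.right :=
  mem_interval_of_mem_gap hb (h.mem_gap i)

theorem subsingleton_index {a : ℝ} (ha : a ∈ Ioc 0 (2 * Real.pi)) :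
    Subsingleton {n : ℤ // a + 2 * Real.pi * n ∈ b.interval} :=
  ⟨fun x y => Subtype.ext (((add_mem_interval_iff h hb ha _).1 x.2).1.trans
    ((add_mem_interval_iff h hb ha _).1 y.2).1.symm)⟩

theorem total_eq_zero {a : ℝ} (ha : a ∈ Ioc 0 (2 * Real.pi)) (hI : a ∉ b.interval)
    (x : PointSpace κ b.interval a) : total b.interval a x = 0 := by
  have : IsEmpty {n : ℤ // a + 2 * Real.pi * n ∈ b.interval} :=
    ⟨fun n => hI ((add_mem_interval_iff h hb ha _).1 n.2).2⟩
  rw [Subsingleton.elim x 0, map_zero]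

/-- The coordinates at the odd vertices. -/
def coord (κ : Type v) [Field κ] (t : Fin m → ℝ) (b : BarCode s) (x : ∀ i, (b.rep κ t).odd i)
    (k : ℕ) : κ :=
  if hk : k < m then total b.interval (t ⟨k, hk⟩) (x ⟨k, hk⟩) else 0

theorem coord_eq_zero (x : ∀ i, (b.rep κ t).odd i) {k : ℕ}
    (hk : k ≤ b.left.val ∨ b.right.val < k) : coord κ t b x k = 0 := by
  unfold coord
  split_ifs with hkm
  · refine total_eq_zero h hb (h.regular_mem_Ioc _) ?_ _
    rw [t_mem_interval h hb, Fin.lt_def, Fin.le_def]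
    simp only
    omega
  · rfl

-- Coordinates are indexed by natural numbers, with value `0` from `m` on. Since the bar code does
-- not contain `t₁`, the cyclic successor may thus be replaced by `i + 1`.
open Classical in
theorem total_diff (x : ∀ i, (b.rep κ t).odd i) (i : Fin m) :
    total b.interval (s i) ((b.rep κ t).diff x i) =
      if s i ∈ b.interval then coord κ t b x i - coord κ t b x (i + 1) else 0 := by
  have hα : total b.interval (s i) ((b.rep κ t).α i (x i)) =
      if s i ∈ b.interval then coord κ t b x i else 0 := by
    have h1 : coord κ t b x i = total b.interval (t i) (x i) := by simp [coord]
    rw [h1]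
    exact total_pointMap (fun n hn => ((add_mem_interval_iff h hb (h.regular_mem_Ioc i) n).1 hn).1) _
  have hβ : total b.interval (s i) ((b.rep κ t).β i (x (finRotate m i))) =
      if s i ∈ b.interval then coord κ t b x (i + 1) else 0 := by
    rcases Nat.lt_or_ge (i.val + 1) m with hi | hi
    · have h2 : finRotate m i = ⟨i.val + 1, hi⟩ := Fin.ext (finRotate_val_of_lt hi)
      have h1 : coord κ t b x (i + 1) = total b.interval (t (finRotate m i)) (x (finRotate m i)) := by
        rw [h2]
        simp [coord, hi]
      rw [h1]
      have hc : carry i = 0 := by simp [carry, hi.ne]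
      change total b.interval (s i) (pointMap κ b.interval (t (finRotate m i)) (s i) (carry i) _) = _
      rw [hc]
      exact total_pointMap (fun n hn => ((add_mem_interval_iff h hb (h.regular_mem_Ioc _) n).1 hn).1) _
    · have h3 : t (finRotate m i) ∉ b.interval := by
        rw [t_mem_interval h hb, Fin.lt_def, finRotate_val_of_eq (le_antisymm i.2 hi)]
        omega
      have : IsEmpty {n : ℤ // t (finRotate m i) + 2 * Real.pi * n ∈ b.interval} :=
        ⟨fun n => h3 ((add_mem_interval_iff h hb (h.regular_mem_Ioc _) _).1 n.2).2⟩
      have h4 : x (finRotate m i) = 0 :=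
        Subsingleton.elim (α := PointSpace κ b.interval (t (finRotate m i))) _ _
      have h5 : coord κ t b x (i + 1) = 0 := by simp [coord, not_lt.2 hi]
      rw [h4, h5, ite_self]
      exact (congrArg _ (map_zero _)).trans (map_zero _)
  rw [CyclicRep.diff_apply]
  refine (map_sub (total b.interval (s i)) _ _).trans ((congrArg₂ _ hα hβ).trans ?_)
  split_ifs <;> simp

theorem diff_eq_zero_iff (x : ∀ i, (b.rep κ t).odd i) : (b.rep κ t).diff x = 0 ↔
    ∀ i, s i ∈ b.interval → coord κ t b x i = coord κ t b x (i + 1) := by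
  classical
  have h1 : (b.rep κ t).diff x = 0 ↔
      ∀ i, total b.interval (s i) ((b.rep κ t).diff x i) = 0 := by
    refine ⟨fun hx i => by rw [hx]; exact map_zero _, fun hx => funext fun i => ?_⟩
    exact total_injective (subsingleton_index h hb (h.critical_mem_Ioc i))
      ((hx i).trans (map_zero _).symm)
  rw [h1]
  refine forall_congr' fun i => ?_
  rw [total_diff h hb]
  by_cases hi : s i ∈ b.interval <;> simp [hi, sub_eq_zero]

theorem eq_zero_of_coord {x : ∀ i, (b.rep κ t).odd i}
    (hx : ∀ k, b.left.val < k → k ≤ b.right.val → coord κ t b x k = 0) : x = 0 := by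
  funext i
  refine total_injective (subsingleton_index h hb (h.regular_mem_Ioc i))
    (Eq.trans ?_ (map_zero _).symm)
  have h1 : coord κ t b x i = total b.interval (t i) (x i) := by simp [coord]
  rw [← h1]
  by_cases hk : b.left.val < i.val ∧ i.val ≤ b.right.val
  · exact hx _ hk.1 hk.2
  · exact coord_eq_zero h hb x (by omega)

/-- On the kernel the coordinates `k` and `k + 1` agree for each critical angle `s k` of the bar
code. A closed left end brings in the vanishing coordinate at `b.left`, and zero spreads to the
right; a closed right end brings in the one at `b.right + 1`, and zero spreads to the left. -/
theorem ker_diff_eq_bot (ho : ¬ b.BothOpen) : LinearMap.ker (b.rep κ t).diff = ⊥ := by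
  rw [LinearMap.ker_eq_bot']
  intro x hx
  rw [diff_eq_zero_iff h hb] at hx
  have hr := b.right.2
  have hlr : b.left.val ≤ b.right.val := left_le_right h hb
  have hstep : ∀ k, (b.left.val < k ∨ (b.leftClosed = true ∧ k = b.left.val)) →
      (k < b.right.val ∨ (b.rightClosed = true ∧ k = b.right.val)) →
      coord κ t b x k = coord κ t b x (k + 1) := by
    intro k h1 h2
    have hk : k < m := by omega
    refine hx ⟨k, hk⟩ ((critical_mem_interval h hb).2 ?_)
    simpa [Fin.lt_def, Fin.ext_iff] using ⟨h1, h2⟩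
  by_cases hl : b.leftClosed = true
  · have hzero : ∀ k, k ≤ b.right.val → coord κ t b x k = 0 := by
      intro k
      induction k with
      | zero => exact fun _ => coord_eq_zero h hb x (Or.inl (Nat.zero_le _))
      | succ k ih =>
        intro hk
        rcases Nat.lt_or_ge k b.left.val with hkl | hkl
        · exact coord_eq_zero h hb x (Or.inl hkl)
        · rw [← hstep k (by rcases hkl.eq_or_lt with h | h; exacts [Or.inr ⟨hl, h.symm⟩, Or.inl h])
            (Or.inl hk)]
          exact ih (by omega)
    exact eq_zero_of_coord h hb fun k _ hk => hzero k hk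
  · have hrc : b.rightClosed = true := by
      by_contra hrc
      exact ho ⟨by simpa using hl, by simpa using hrc⟩
    have hzero : ∀ n k, k + n = b.right.val + 1 → b.left.val < k → coord κ t b x k = 0 := by
      intro n
      induction n with
      | zero => exact fun k hk _ => coord_eq_zero h hb x (Or.inr (by omega))
      | succ n ih =>
        intro k hk hkl
        rw [hstep k (Or.inl hkl)
          (by rcases Nat.eq_zero_or_pos n with h | h
              exacts [Or.inr ⟨hrc, by omega⟩, Or.inl (by omega)])]
        exact ih (k + 1) (by omega) (by omega)
    exact eq_zero_of_coord h hb fun k hk hk' => hzero (b.right.val + 1 - k) k (by omega) hk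

/-- With both ends open, all equations are between neighboring coordinates inside the bar code, so
the constant families form the kernel. -/
theorem finrank_ker_diff_of_bothOpen (ho : b.BothOpen) :
    Module.finrank κ (LinearMap.ker (b.rep κ t).diff) = 1 := by
  classical
  have hr := b.right.2
  have hlr : b.left.val < b.right.val := by
    refine lt_of_le_of_ne (left_le_right h hb) fun hne => ?_
    have := (bothClosed_of_eq hb (Fin.ext hne)).1
    rw [ho.1] at this
    exact Bool.false_ne_true this
  let x : ∀ i, (b.rep κ t).odd i := fun i =>
    if hi : t i ∈ b.interval then
      (Finsupp.single ⟨0, by simpa using hi⟩ 1 : PointSpace κ b.interval (t i)) else 0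
  have hx : ∀ k, b.left.val < k → k ≤ b.right.val → coord κ t b x k = 1 := by
    intro k h1 h2
    have hkm : k < m := by omega
    have hmem : t ⟨k, hkm⟩ ∈ b.interval := (t_mem_interval h hb _).2 ⟨h1, h2⟩
    have hxk : x ⟨k, hkm⟩ =
        (Finsupp.single ⟨0, by simpa using hmem⟩ 1 : PointSpace κ b.interval (t ⟨k, hkm⟩)) :=
      dif_pos hmem
    rw [coord, dif_pos hkm, hxk]
    exact total_single _ _
  have hS : ∀ i, s i ∈ b.interval → b.left.val < i.val ∧ i.val < b.right.val := by
    intro i hi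
    have := (critical_mem_interval h hb).1 hi
    rw [ho.1, ho.2] at this
    simp only [Bool.false_eq_true, false_and, or_false] at this
    exact this
  have hxker : (b.rep κ t).diff x = 0 := by
    rw [diff_eq_zero_iff h hb]
    intro i hi
    have := hS i hi
    rw [hx _ this.1 this.2.le, hx _ (by omega) this.2]
  refine finrank_eq_one ⟨x, hxker⟩ ?_ ?_
  · intro h0
    have h1 := hx (b.left.val + 1) (by omega) hlr
    rw [show x = 0 from congrArg Subtype.val h0] at h1
    unfold coord at h1
    split_ifs at h1
    · exact zero_ne_one ((map_zero _).symm.trans h1)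
    · exact zero_ne_one h1
  · rintro ⟨y, hy⟩
    refine ⟨coord κ t b y (b.left.val + 1), Subtype.ext (sub_eq_zero.1 ?_)⟩
    have hy' : ∀ k, k < b.right.val → b.left.val < k →
        coord κ t b y k = coord κ t b y (k + 1) := by
      intro k h1 h2
      refine (diff_eq_zero_iff h hb y).1 hy ⟨k, by omega⟩ ((critical_mem_interval h hb).2 ?_)
      simpa [Fin.lt_def, Fin.ext_iff] using ⟨Or.inl h2, Or.inl h1⟩
    have hconst : ∀ n, b.left.val + 1 + n ≤ b.right.val →
        coord κ t b y (b.left.val + 1 + n) = coord κ t b y (b.left.val + 1) := by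
      intro n
      induction n with
      | zero => exact fun _ => rfl
      | succ n ih =>
        intro hn
        rw [← ih (by omega), ← add_assoc, ← hy' _ (by omega) (by omega)]
    refine eq_zero_of_coord h hb fun k h1 h2 => ?_
    have h3 := hconst (k - (b.left.val + 1)) (by omega)
    rw [show b.left.val + 1 + (k - (b.left.val + 1)) = k by omega] at h3
    have hlin : coord κ t b (coord κ t b y (b.left.val + 1) • x - y) k =
        coord κ t b y (b.left.val + 1) * coord κ t b x k - coord κ t b y k := by
      have hkm : k < m := by omega
      generalize coord κ t b y (b.left.val + 1) = c
      simp only [coord, dif_pos hkm]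
      exact (map_sub (total b.interval (t ⟨k, hkm⟩)) _ _).trans
        (congrArg (· - _) (map_smul (total b.interval (t ⟨k, hkm⟩)) c _))
    exact hlin.trans (by rw [hx k h1 h2, h3, mul_one, sub_self])

open Classical in
theorem finrank_ker_diff : Module.finrank κ (LinearMap.ker (b.rep κ t).diff) =
    if b.BothOpen then 1 else 0 := by
  split_ifs with ho
  · exact finrank_ker_diff_of_bothOpen h hb ho
  · rw [ker_diff_eq_bot h hb ho, finrank_bot]

theorem finite_pointSpace {a : ℝ} (ha : a ∈ Ioc 0 (2 * Real.pi)) :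
    Module.Finite κ (PointSpace κ b.interval a) := by
  have := subsingleton_index h hb ha
  infer_instance

theorem finrank_odd : Module.finrank κ (∀ i, (b.rep κ t).odd i) =
    b.right.val - b.left.val := by
  classical
  have := fun i => finite_pointSpace (κ := κ) h hb (h.regular_mem_Ioc i)
  have h1 : Module.finrank κ (∀ i, (b.rep κ t).odd i) =
      ∑ i, Module.finrank κ (PointSpace κ b.interval (t i)) :=
    Module.finrank_pi_fintype κ (M := fun i => PointSpace κ b.interval (t i))
  rw [h1, Finset.sum_congr rfl fun i _ => finrank_pointSpace h hb (h.regular_mem_Ioc i),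
    ← Fin.card_Ioc, Finset.sum_boole, Nat.cast_id]
  congr 1
  ext i
  simp [t_mem_interval h hb]

/-- There are `right - left - 1` critical angles between the ends when these differ, plus the closed
ends. Adding `1` on the left avoids truncated subtraction and covers bar codes with one point. -/
theorem finrank_even : Module.finrank κ (∀ i, (b.rep κ t).even i) + 1 =
    b.right.val - b.left.val + (if b.leftClosed = true then 1 else 0) +
      if b.rightClosed = true then 1 else 0 := by
  classical
  have := fun i => finite_pointSpace (κ := κ) h hb (h.critical_mem_Ioc i)
  have h1 : Module.finrank κ (∀ i, (b.rep κ t).even i) =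
      ∑ i, Module.finrank κ (PointSpace κ b.interval (s i)) :=
    Module.finrank_pi_fintype κ (M := fun i => PointSpace κ b.interval (s i))
  have hlr : b.left ≤ b.right := left_le_right h hb
  have hlr' : b.left.val ≤ b.right.val := hlr
  have hne : ¬ (b.leftClosed = true ∧ b.rightClosed = true) → b.left ≠ b.right :=
    fun hc he => hc (bothClosed_of_eq hb he)
  rw [h1, Finset.sum_congr rfl fun i _ => finrank_pointSpace h hb (h.critical_mem_Ioc i),
    Finset.sum_boole, Nat.cast_id]
  simp only [critical_mem_interval h hb]
  by_cases hl : b.leftClosed = true <;> by_cases hr : b.rightClosed = true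
  · have : (Finset.univ.filter fun i => (b.left < i ∨ (b.leftClosed = true ∧ i = b.left)) ∧
        (i < b.right ∨ (b.rightClosed = true ∧ i = b.right))) = Finset.Icc b.left b.right := by
      ext i
      simp only [hl, hr, true_and, Finset.mem_filter, Finset.mem_univ, Finset.mem_Icc,
        Fin.lt_def, Fin.le_def, Fin.ext_iff]
      omega
    rw [this, Fin.card_Icc, if_pos hl, if_pos hr]
    omega
  · have : (Finset.univ.filter fun i => (b.left < i ∨ (b.leftClosed = true ∧ i = b.left)) ∧
        (i < b.right ∨ (b.rightClosed = true ∧ i = b.right))) = Finset.Ico b.left b.right := by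
      ext i
      simp only [hl, hr, true_and, Finset.mem_filter, Finset.mem_univ, Finset.mem_Ico,
        Fin.lt_def, Fin.le_def, Fin.ext_iff]
      simp
      omega
    rw [this, Fin.card_Ico, if_pos hl, if_neg hr]
  · have : (Finset.univ.filter fun i => (b.left < i ∨ (b.leftClosed = true ∧ i = b.left)) ∧
        (i < b.right ∨ (b.rightClosed = true ∧ i = b.right))) = Finset.Ioc b.left b.right := by
      ext i
      simp only [hl, hr, true_and, Finset.mem_filter, Finset.mem_univ, Finset.mem_Ioc,
        Fin.lt_def, Fin.le_def, Fin.ext_iff]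
      simp
      omega
    rw [this, Fin.card_Ioc, if_neg hl, if_pos hr]
  · have : (Finset.univ.filter fun i => (b.left < i ∨ (b.leftClosed = true ∧ i = b.left)) ∧
        (i < b.right ∨ (b.rightClosed = true ∧ i = b.right))) = Finset.Ioo b.left b.right := by
      ext i
      simp [hl, hr]
    have hlt : b.left.val < b.right.val := lt_of_le_of_ne hlr' fun he =>
      hne (fun hc => hl hc.1) (Fin.ext he)
    rw [this, Fin.card_Ioo, if_neg hl, if_neg hr]
    omega

-- The cokernel exceeds the kernel in dimension by the difference of the even and odd dimensions,
-- which is the number of closed ends minus `1`.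
open Classical in
theorem finrank_coker_diff :
    Module.finrank κ ((∀ i, (b.rep κ t).even i) ⧸ LinearMap.range (b.rep κ t).diff) =
      if b.BothClosed then 1 else 0 := by
  have := fun i => finite_pointSpace (κ := κ) h hb (h.regular_mem_Ioc i)
  have := fun i => finite_pointSpace (κ := κ) h hb (h.critical_mem_Ioc i)
  have hfo : Module.Finite κ (∀ i, (b.rep κ t).odd i) :=
    inferInstanceAs (Module.Finite κ (∀ i, PointSpace κ b.interval (t i)))
  have hfe : Module.Finite κ (∀ i, (b.rep κ t).even i) :=
    inferInstanceAs (Module.Finite κ (∀ i, PointSpace κ b.interval (s i)))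
  have h1 := Submodule.finrank_quotient_add_finrank (LinearMap.range (b.rep κ t).diff)
  have h2 := LinearMap.finrank_range_add_finrank_ker (b.rep κ t).diff
  rw [finrank_ker_diff h hb, finrank_odd h hb] at h2
  have h3 := finrank_even (κ := κ) h hb
  have hlr : b.left.val ≤ b.right.val := left_le_right h hb
  have hne : ¬ b.BothClosed → b.left.val ≠ b.right.val :=
    fun hc he => hc (bothClosed_of_eq hb (Fin.ext he))
  unfold BothOpen BothClosed at *
  cases hl : b.leftClosed <;> cases hr : b.rightClosed <;> simp [hl, hr] at h2 h3 hne ⊢ <;> omega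

open Classical in
theorem rank_ker_diff : Module.rank κ (LinearMap.ker (b.rep κ t).diff) =
    if b.BothOpen then 1 else 0 := by
  have := fun i => finite_pointSpace (κ := κ) h hb (h.regular_mem_Ioc i)
  have hfo : Module.Finite κ (∀ i, (b.rep κ t).odd i) :=
    inferInstanceAs (Module.Finite κ (∀ i, PointSpace κ b.interval (t i)))
  rw [← Module.finrank_eq_rank, finrank_ker_diff h hb]
  split_ifs <;> simp

open Classical in
theorem rank_coker_diff :
    Module.rank κ ((∀ i, (b.rep κ t).even i) ⧸ LinearMap.range (b.rep κ t).diff) =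
      if b.BothClosed then 1 else 0 := by
  have := fun i => finite_pointSpace (κ := κ) h hb (h.critical_mem_Ioc i)
  have hfe : Module.Finite κ (∀ i, (b.rep κ t).even i) :=
    inferInstanceAs (Module.Finite κ (∀ i, PointSpace κ b.interval (s i)))
  rw [← Module.finrank_eq_rank, finrank_coker_diff h hb]
  split_ifs <;> simp

end BarCode

end BarDiff

end CircleValued

end

noncomputable section

open Set

namespace CircleValued

/-! ### Points of the spiral on a ray -/

namespace BarCode

variable {m : ℕ} {s t : Fin m → ℝ} (b : BarCode s)

theorem first_le_last : b.first ≤ b.last := by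
  obtain ⟨τ, hτ⟩ := b.interval_nonempty
  exact (b.interval_subset hτ).1.trans (b.interval_subset hτ).2

theorem radius_pos {τ : ℝ} (hτ : τ ∈ b.interval) : 0 < b.radius τ := by
  have h1 := b.interval_subset hτ
  rcases b.first_le_last.eq_or_lt with he | hlt
  -- Division by zero yields `0`, so a bar code with one point has radius `1`.
  · simp [radius, he]
  · have h2 : b.radius τ = (τ - b.first) / (b.last - b.first) + 2 := by
      have : b.last - b.first ≠ 0 := (sub_pos.2 hlt).ne'
      rw [radius]
      field_simp
      ring
    have h3 : 0 ≤ (τ - b.first) / (b.last - b.first) :=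
      div_nonneg (sub_nonneg.2 h1.1) (sub_nonneg.2 hlt.le)
    rw [h2]
    linarith

theorem radius_injOn : InjOn b.radius b.interval := by
  intro τ hτ τ' hτ' h
  have h1 := b.interval_subset hτ
  have h1' := b.interval_subset hτ'
  rcases b.first_le_last.eq_or_lt with he | hlt
  · rw [← he] at h1 h1'
    exact (le_antisymm h1.2 h1.1).trans (le_antisymm h1'.2 h1'.1).symm
  · have h2 : 1 / (b.last - b.first) ≠ 0 := one_div_ne_zero (sub_pos.2 hlt).ne'
    refine mul_left_cancel₀ h2 ?_
    unfold radius at h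
    linarith

theorem polar_injective {c c' : ℝ} (hc : 0 < c) (hc' : 0 ≤ c') {θ θ' : Real.Angle}
    (h : (c * θ.cos, c * θ.sin) = (c' * θ'.cos, c' * θ'.sin)) : c = c' ∧ θ = θ' := by
  obtain ⟨h1, h2⟩ := Prod.ext_iff.1 h
  simp only at h1 h2
  have h3 := θ.cos_sq_add_sin_sq
  have h4 := θ'.cos_sq_add_sin_sq
  have h5 : c ^ 2 = c' ^ 2 := by
    calc c ^ 2 = (c * θ.cos) ^ 2 + (c * θ.sin) ^ 2 := by linear_combination -c ^ 2 * h3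
      _ = c' ^ 2 := by rw [h1, h2]; linear_combination c' ^ 2 * h4
  have h6 : c = c' := (pow_left_inj₀ hc.le hc' two_ne_zero).1 h5
  subst h6
  refine ⟨rfl, ?_⟩
  replace h1 := mul_left_cancel₀ hc.ne' h1
  replace h2 := mul_left_cancel₀ hc.ne' h2
  induction θ using Real.Angle.induction_on with | h x =>
  induction θ' using Real.Angle.induction_on with | h y =>
  exact Real.Angle.cos_sin_inj h1 h2

/-- The radius is positive and injective along the bar code. Polar coordinates of a point of the
spiral thus recover its parameter, and the ray selects the parameters congruent to `a`. -/
theorem count_eq (a : ℝ) :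
    b.count (a : Real.Angle) = Cardinal.mk {n : ℤ // a + 2 * Real.pi * n ∈ b.interval} := by
  have hcoe : ∀ n : ℤ, ((a + 2 * Real.pi * n : ℝ) : Real.Angle) = a := fun n => by
    rw [Real.Angle.angle_eq_iff_two_pi_dvd_sub]
    exact ⟨n, by ring⟩
  refine (Cardinal.mk_congr (Equiv.ofBijective (fun n : {n : ℤ // a + 2 * Real.pi * n ∈ b.interval} =>
    (⟨(b.radius (a + 2 * Real.pi * n.1) * Real.cos (a + 2 * Real.pi * n.1),
      b.radius (a + 2 * Real.pi * n.1) * Real.sin (a + 2 * Real.pi * n.1)),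
      ⟨_, n.2, rfl⟩, ?_⟩ : ↥(b.spiral ∩ ray a))) ⟨?_, ?_⟩)).symm
  · refine ⟨_, (b.radius_pos n.2).le, ?_⟩
    rw [← Real.Angle.cos_coe, ← Real.Angle.sin_coe, hcoe]
  · intro n n' h
    have h1 := congrArg Subtype.val h
    simp only [← Real.Angle.cos_coe, ← Real.Angle.sin_coe] at h1
    have h2 := b.radius_injOn n.2 n'.2
      (polar_injective (b.radius_pos n.2) (b.radius_pos n'.2).le h1).1
    have h3 : 2 * Real.pi * (n.1 : ℝ) = 2 * Real.pi * (n'.1 : ℝ) := by linarith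
    exact Subtype.ext (Int.cast_injective (mul_left_cancel₀ Real.two_pi_pos.ne' h3))
  · rintro ⟨_, ⟨τ, hτ, rfl⟩, c, hc, h⟩
    change (b.radius τ * (τ : Real.Angle).cos, b.radius τ * (τ : Real.Angle).sin) = _ at h
    have h1 := (polar_injective (b.radius_pos hτ) hc h).2
    obtain ⟨n, hn⟩ := Real.Angle.angle_eq_iff_two_pi_dvd_sub.1 h1
    have h2 : τ = a + 2 * Real.pi * n := by linarith
    subst h2
    exact ⟨⟨n, hτ⟩, rfl⟩

variable {b}

theorem count_congr (h : Interlaced s t) (hb : b.turns = 0) {a a' : ℝ}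
    (ha : a ∈ Ioc 0 (2 * Real.pi)) (ha' : a' ∈ Ioc 0 (2 * Real.pi))
    (haa' : a ∈ b.interval ↔ a' ∈ b.interval) :
    b.count (a : Real.Angle) = b.count (a' : Real.Angle) := by
  rw [count_eq, count_eq]
  refine Cardinal.mk_congr (Equiv.subtypeEquivRight fun n => ?_)
  rw [add_mem_interval_iff h hb ha, add_mem_interval_iff h hb ha', haa']

theorem count_eq_zero (h : Interlaced s t) (hb : b.turns = 0) {a : ℝ}
    (ha : a ∈ Ioc 0 (2 * Real.pi)) (hI : a ∉ b.interval) : b.count (a : Real.Angle) = 0 := by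
  rw [count_eq, Cardinal.mk_eq_zero_iff]
  exact ⟨fun n => hI ((add_mem_interval_iff h hb ha _).1 n.2).2⟩

end BarCode

/-! ### Dimensions in terms of bar codes -/

section Formulas

theorem sum_ite {ι : Type w} (p : ι → Prop) [DecidablePred p] :
    (Cardinal.sum fun b => if p b then (1 : Cardinal.{w'}) else 0) =
      Cardinal.lift.{w'} (Cardinal.mk {b // p b}) := by
  have h1 : (fun b => if p b then (1 : Cardinal.{w'}) else 0) =
      fun b => Cardinal.mk (ULift.{w'} (PLift (p b))) := by
    funext b
    split_ifs with hb
    · exact (Cardinal.eq_one_iff_unique.2 ⟨inferInstance, ⟨⟨⟨hb⟩⟩⟩⟩).symm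
    · have : IsEmpty (ULift.{w'} (PLift (p b))) := ⟨fun x => hb x.down.down⟩
      exact (Cardinal.mk_eq_zero _).symm
  rw [h1, ← Cardinal.mk_sigma, ← Cardinal.mk_uLift]
  exact Cardinal.mk_congr ⟨fun x => ⟨⟨x.1, x.2.down.down⟩⟩, fun x => ⟨x.down.1, ⟨⟨x.down.2⟩⟩⟩,
    fun _ => rfl, fun _ => rfl⟩

theorem sum_lift {ι : Type (max w v)} (c : ι → Cardinal.{0}) :
    (Cardinal.sum fun b => Cardinal.lift.{v} (c b)) = (Cardinal.sum c : Cardinal.{max w v}) := by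
  have h1 : c = fun b => Cardinal.mk (c b).out := by
    funext b
    exact (Cardinal.mk_out _).symm
  have h2 : (fun b => Cardinal.lift.{v} (c b)) = fun b => Cardinal.mk (ULift.{v} (c b).out) := by
    funext b
    rw [Cardinal.mk_uLift, Cardinal.mk_out]
  rw [h2]
  conv_rhs => rw [h1]
  rw [← Cardinal.mk_sigma, ← Cardinal.mk_sigma]
  exact Cardinal.mk_congr (Equiv.sigmaCongrRight fun b => Equiv.ulift)

theorem rank_pointSpace_sum {κ : Type v} [Field κ] {m : ℕ} {s : Fin m → ℝ} {ι : Type (max w v)}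
    (B : ι → BarCode s) (a : ℝ) :
    Module.rank κ (Π₀ b, PointSpace κ (B b).interval a) =
      Cardinal.sum fun b => (B b).count (a : Real.Angle) := by
  rw [rank_dfinsupp, ← sum_lift.{v, w}]
  refine congrArg _ (funext fun b => ?_)
  rw [rank_finsupp_self, BarCode.count_eq]

variable {κ : Type v} [Field κ] {m : ℕ} {s t : Fin m → ℝ} {ι : Type (max w v)}
  {B : ι → BarCode s} {ρ : CyclicRep.{v, max w v} κ m}
  (e : ρ.Iso (CyclicRep.directSum fun b => (B b).rep κ t))

include e

theorem rank_even_eq_sum_count (i : Fin m) :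
    Module.rank κ (ρ.even i) = Cardinal.sum fun b => (B b).count (s i : Real.Angle) :=
  (e.even i).rank_eq.trans (rank_pointSpace_sum.{v, w} B _)

theorem rank_odd_eq_sum_count (i : Fin m) :
    Module.rank κ (ρ.odd i) = Cardinal.sum fun b => (B b).count (t i : Real.Angle) :=
  (e.odd i).rank_eq.trans (rank_pointSpace_sum.{v, w} B _)

/-- A bar code passing over `t₁` would contribute a non-zero vector at a vertex where `ρ` vanishes.
-/
theorem turns_eq_zero_of_iso (h : Interlaced s t) {i : Fin m} (hi : i.val = 0)
    (hodd : Subsingleton (ρ.odd i)) (b : ι) : (B b).turns = 0 := by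
  classical
  refine (B b).turns_eq_zero h hi fun n hn => ?_
  have h1 : Subsingleton (Π₀ b, PointSpace κ (B b).interval (t i)) :=
    (e.odd i).toEquiv.subsingleton_congr.1 hodd
  have h2 := DFunLike.congr_fun (h1.elim (DFinsupp.single b (Finsupp.single ⟨n, hn⟩ 1)) 0) b
  rw [DFinsupp.single_eq_same] at h2
  exact one_ne_zero (Finsupp.single_eq_zero.1 h2)

theorem rank_ker_diff_eq (h : Interlaced s t) (hB : ∀ b, (B b).turns = 0) :
    Module.rank κ (LinearMap.ker ρ.diff) = Cardinal.mk {b // (B b).BothOpen} := by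
  classical
  rw [e.rank_ker_diff, CyclicRep.rank_ker_directSum_diff,
    funext fun b => BarCode.rank_ker_diff (κ := κ) h (hB b), sum_ite, Cardinal.lift_id']

theorem rank_coker_diff_eq (h : Interlaced s t) (hB : ∀ b, (B b).turns = 0) :
    Module.rank κ ((∀ i, ρ.even i) ⧸ LinearMap.range ρ.diff) =
      Cardinal.mk {b // (B b).BothClosed} := by
  classical
  rw [e.rank_coker_diff, CyclicRep.rank_coker_directSum_diff,
    funext fun b => BarCode.rank_coker_diff (κ := κ) h (hB b), sum_ite, Cardinal.lift_id']

end Formulas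

/-! ### Betti numbers of arbitrary fibers. -/

section Fibers

variable {κ : Type v} [Field κ] {X : Type u} [TopologicalSpace X] {f : X → ℝ} {m : ℕ}
  {s t : Fin m → ℝ}

/-- An angle with representative `y` in `(0, 2π]` is critical, or lies in the gap below the next
critical value, or lies above the last one. In the gap at `i` neither the homology of the fiber nor
the count differs from that at `t i`; above the last critical value both vanish. -/
theorem IsFrame.betti_fiber (hF : IsFrame κ (realLift f) s t) {r : ℕ} {ι : Type (max u v)}
    {B : ι → BarCode s} (e : (fiberRep κ (toCircleValued f) hF.interlaced r).Iso
      (CyclicRep.directSum fun b => (B b).rep κ t)) (hB : ∀ b, (B b).turns = 0)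
    (θ : Real.Angle) : betti κ r (Fiber (toCircleValued f) θ) =
      Cardinal.sum fun b => (B b).count θ := by
  have hmem : ∃ y ∈ Ioc 0 (2 * Real.pi), (y : Real.Angle) = θ := by
    induction θ using Real.Angle.induction_on with | h a =>
    refine ⟨toIocMod Real.two_pi_pos 0 a, by simpa using toIocMod_mem_Ioc Real.two_pi_pos 0 a, ?_⟩
    rw [Real.Angle.angle_eq_iff_two_pi_dvd_sub]
    refine ⟨-toIocDiv Real.two_pi_pos 0 a, ?_⟩
    have := toIocMod_add_toIocDiv_zsmul Real.two_pi_pos 0 a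
    rw [zsmul_eq_mul] at this
    push_cast
    linarith
  obtain ⟨y, hy, rfl⟩ := hmem
  by_cases hex : ∃ j, y ≤ s j
  · classical
    obtain ⟨i, hi, hmin⟩ := (Finset.univ.filter fun i => y ≤ s i).exists_minimal
      (hex.imp fun j hj => by simpa using hj)
    simp only [Finset.mem_filter, Finset.mem_univ, true_and] at hi hmin
    rcases hi.eq_or_lt with rfl | hlt
    · exact rank_even_eq_sum_count e i
    · have hgap : y ∈ gap s i := by
        refine ⟨⟨hy.1, hlt.trans_le (hF.interlaced.le i)⟩, fun j => ⟨fun hj => ?_, fun hj => ?_⟩⟩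
        · by_contra hyj
          exact absurd (hmin (not_lt.1 hyj) hj.le) (not_le.2 hj)
        · exact hlt.trans_le (hF.interlaced.strictMono.monotone hj)
      rw [hF.betti_fiber_gap r hgap, rank_odd_eq_sum_count e i]
      refine congrArg _ (funext fun b => ?_)
      refine BarCode.count_congr hF.interlaced (hB b) (hF.interlaced.regular_mem_Ioc i) hy ?_
      rw [BarCode.mem_interval_of_mem_gap (hB b) hgap,
        BarCode.t_mem_interval hF.interlaced (hB b)]
  · push Not at hex
    rw [betti_fiber_empty]
    · have h1 : ∀ b, (B b).count (y : Real.Angle) = 0 := fun b => by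
        refine BarCode.count_eq_zero hF.interlaced (hB b) hy fun hI => ?_
        have h2 := ((B b).interval_subset hI).2
        rw [BarCode.last_eq (hB b)] at h2
        exact absurd (hex _) (not_lt.2 h2)
      simp [h1]
    · refine eq_empty_of_forall_notMem fun x hx => ?_
      have h1 : realLift f x = y := angle_coe_injOn (hF.mem x) hy hx
      have h2 := hF.value_le x ⟨m - 1, Nat.sub_lt hF.pos one_pos⟩ (Nat.sub_add_cancel hF.pos)
      exact absurd (hex _) (not_lt.2 (h1 ▸ h2))

end Fibers

end CircleValued

end

noncomputable section

open Set

namespace CircleValued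

/-! ### Families adapted to flags -/

section Flags

variable {κ : Type v} [Field κ] {V : Type w} [AddCommGroup V] [Module κ V] {T C : Type*}

theorem isChain_image {α β : Type*} [Preorder α] [Preorder β] {F : Set α}
    (hF : IsChain (· ≤ ·) F) {g : α → β} (hg : Monotone g) : IsChain (· ≤ ·) (g '' F) := by
  rintro _ ⟨a, ha, rfl⟩ _ ⟨b, hb, rfl⟩ -
  exact (hF.total ha hb).imp (fun h => hg h) fun h => hg h

/-- A finite chain of subspaces which ends with the whole space. -/
structure IsFlag (F : Set (Submodule κ V)) : Prop where
  finite : F.Finite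
  chain : IsChain (· ≤ ·) F
  top_mem : ⊤ ∈ F

variable (κ) in
/-- The non-zero members of the family are linearly independent. -/
def IsIndep (v : T → V) : Prop :=
  ∀ l : T →₀ κ, (∀ b, v b = 0 → l b = 0) → Finsupp.linearCombination κ v l = 0 → l = 0

/-- The non-zero members of the family are linearly independent and all members of the flag are
spanned by members of the family. -/
structure IsAdapted (F : Set (Submodule κ V)) (v : T → V) : Prop where
  indep : IsIndep κ v
  span : ∀ A ∈ F, A ≤ Submodule.span κ (v '' {b | v b ∈ A})

theorem IsAdapted.mono {F F' : Set (Submodule κ V)} {v : T → V} (h : IsAdapted F v) (hF : F' ⊆ F) :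
    IsAdapted F' v := ⟨h.indep, fun A hA => h.span A (hF hA)⟩

/-- A chain of subspaces has an adapted basis. -/
theorem exists_adapted_set (F : Set (Submodule κ V)) (hfin : F.Finite) (hc : IsChain (· ≤ ·) F) :
    ∃ B : Set V, LinearIndepOn κ id B ∧ (∀ x ∈ B, ∃ A ∈ F, x ∈ A) ∧
      ∀ A ∈ F, A ≤ Submodule.span κ (B ∩ A) := by
  induction hn : F.ncard generalizing F with
  | zero =>
    rw [Set.ncard_eq_zero hfin] at hn
    subst hn
    exact ⟨∅, linearIndepOn_empty κ id, by simp, by simp⟩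
  | succ n ih =>
    have hne : F.Nonempty := Set.nonempty_of_ncard_ne_zero (by omega)
    obtain ⟨A, hA⟩ := hfin.exists_maximal hne
    have hle : ∀ C ∈ F, C ≤ A := fun C hC => by
      rcases hc.total hC hA.prop with h | h
      · exact h
      · exact hA.le_of_ge hC h
    obtain ⟨B, hB, hBF, hBs⟩ := ih (F \ {A}) hfin.sdiff (hc.mono Set.sdiff_subset) (by
      have := Set.ncard_sdiff_singleton_of_mem hA.prop
      omega)
    have hBA : B ⊆ A := fun x hx => by
      obtain ⟨C, hC, hxC⟩ := hBF x hx
      exact hle C hC.1 hxC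
    -- The basis adapted to the smaller members lies in the greatest member `A` and is extended to a
    -- basis of `A`.
    obtain ⟨B', hB'A, hBB', hs, hB'⟩ := exists_linearIndepOn_id_extension hB hBA
    refine ⟨B', hB', fun x hx => ⟨A, hA.prop, hB'A hx⟩, fun C hC => ?_⟩
    by_cases hCA : C = A
    · subst hCA
      rw [Set.inter_eq_left.2 hB'A]
      exact hs
    · exact (hBs C ⟨hC, hCA⟩).trans (Submodule.span_mono (Set.inter_subset_inter_left _ hBB'))

/-- A chain of subspaces has an adapted basis, as a family. -/
theorem exists_isAdapted {F : Set (Submodule κ V)} (hfin : F.Finite) (hc : IsChain (· ≤ ·) F) :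
    ∃ (C : Type w) (k : C → V), (∀ c, k c ≠ 0) ∧ (∀ c, ∃ A ∈ F, k c ∈ A) ∧ IsAdapted F k := by
  obtain ⟨B, hB, hBF, hs⟩ := exists_adapted_set F hfin hc
  have hli : LinearIndependent κ (Subtype.val : B → V) := hB
  refine ⟨B, Subtype.val, fun c => hli.ne_zero c, fun c => hBF _ c.2, fun l _ hl => ?_,
    fun A hA => (hs A hA).trans (Submodule.span_mono ?_)⟩
  · exact linearIndependent_iff.1 hli l hl
  · rintro x ⟨hx, hxA⟩
    exact ⟨⟨x, hx⟩, hxA, rfl⟩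

/-- Joint adaptedness of two families. -/
structure IsAdaptedPair (F : Set (Submodule κ V)) (v : T → V) (k : C → V) : Prop where
  indep : ∀ (l : T →₀ κ) (l' : C →₀ κ), (∀ b, v b = 0 → l b = 0) → (∀ c, k c = 0 → l' c = 0) →
    Finsupp.linearCombination κ v l + Finsupp.linearCombination κ k l' = 0 → l = 0 ∧ l' = 0
  span : ∀ A ∈ F, A ≤ Submodule.span κ (v '' {b | v b ∈ A}) ⊔ Submodule.span κ (k '' {c | k c ∈ A})

theorem IsAdaptedPair.symm {F : Set (Submodule κ V)} {v : T → V} {k : C → V}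
    (h : IsAdaptedPair F v k) : IsAdaptedPair F k v :=
  ⟨fun l l' hl hl' h0 => (h.indep l' l hl' hl ((add_comm _ _).trans h0)).symm,
    fun A hA => (h.span A hA).trans (sup_comm _ _).le⟩

theorem IsAdaptedPair.isAdapted {F : Set (Submodule κ V)} {v : T → V} {k : C → V}
    (h : IsAdaptedPair F v k) : IsAdapted F (Sum.elim v k) where
  indep l hl h0 := by
    have e := Finsupp.sumFinsuppEquivProdFinsupp.symm_apply_apply l
    set p := Finsupp.sumFinsuppEquivProdFinsupp l with hp
    have h1 : ∀ b, p.1 b = l (Sum.inl b) := fun b => by rw [hp]; rfl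
    have h2 : ∀ c, p.2 c = l (Sum.inr c) := fun c => by rw [hp]; rfl
    have h3 : Finsupp.linearCombination κ (Sum.elim v k) l =
        Finsupp.linearCombination κ v p.1 + Finsupp.linearCombination κ k p.2 := by
      have h4 : l = p.1.mapDomain Sum.inl + p.2.mapDomain Sum.inr := by
        ext t
        rcases t with b | c
        · rw [Finsupp.add_apply, Finsupp.mapDomain_apply Sum.inl_injective,
            Finsupp.mapDomain_of_notMem_range, add_zero, h1]
          simp
        · rw [Finsupp.add_apply, Finsupp.mapDomain_apply Sum.inr_injective,
            Finsupp.mapDomain_of_notMem_range, zero_add, h2]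
          simp
      conv_lhs => rw [h4]
      rw [map_add, Finsupp.linearCombination_mapDomain, Finsupp.linearCombination_mapDomain]
      rfl
    obtain ⟨h4, h5⟩ := h.indep p.1 p.2 (fun b hb => (h1 b).trans (hl _ hb))
      (fun c hc => (h2 c).trans (hl _ hc)) (h3.symm.trans h0)
    ext t
    rcases t with b | c
    · rw [← h1, h4]; rfl
    · rw [← h2, h5]; rfl
  span A hA := by
    refine (h.span A hA).trans (sup_le (Submodule.span_mono ?_) (Submodule.span_mono ?_))
    · rintro _ ⟨b, hb, rfl⟩
      exact ⟨Sum.inl b, hb, rfl⟩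
    · rintro _ ⟨c, hc, rfl⟩
      exact ⟨Sum.inr c, hc, rfl⟩

/-- Zero members are harmless, since independence concerns the non-zero ones only. This lets one
index set serve for all positions, with zero where an interval is absent. -/
theorem IsAdapted.pair_zero {F : Set (Submodule κ V)} {v : T → V} (h : IsAdapted F v) :
    IsAdaptedPair F v (fun _ : C => (0 : V)) where
  indep l l' hl hl' h0 := by
    have h1 : l' = 0 := Finsupp.ext fun c => hl' c rfl
    refine ⟨h.indep l hl ?_, h1⟩
    simpa [h1] using h0
  span A hA := (h.span A hA).trans le_sup_left

theorem linearCombination_comp_eq {W : Type w'} [AddCommGroup W] [Module κ W] (φ : V →ₗ[κ] W)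
    {v : T → V} {u : T → W} {l : T →₀ κ} (h : ∀ b, l b ≠ 0 → φ (v b) = u b) :
    φ (Finsupp.linearCombination κ v l) = Finsupp.linearCombination κ u l := by
  rw [Finsupp.linearCombination_apply, Finsupp.linearCombination_apply, Finsupp.sum, Finsupp.sum,
    map_sum]
  refine Finset.sum_congr rfl fun b hb => ?_
  rw [map_smul, h b (Finsupp.mem_support_iff.1 hb)]

/-- Adapted families of the image and of the kernel of a map combine to an adapted family. -/
theorem exists_adapted_lift {Q : Type w'} [AddCommGroup Q] [Module κ Q] {F : Set (Submodule κ V)}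
    (hF : IsFlag F) (π : V →ₗ[κ] Q) {k : C → V} (hk : IsIndep κ k) (hkπ : ∀ c, π (k c) = 0)
    (hkF : ∀ A ∈ F, A ⊓ LinearMap.ker π ≤ Submodule.span κ (k '' {c | k c ∈ A}))
    {q : T → Q} (hq : IsIndep κ q)
    (hqF : ∀ A ∈ F, A.map π ≤ Submodule.span κ (q '' {d | q d ∈ A.map π})) :
    ∃ v : T → V, (∀ d, v d ≠ 0 → π (v d) = q d ∧ q d ≠ 0) ∧
      (∀ d, q d ∈ LinearMap.range π → π (v d) = q d) ∧ IsAdaptedPair F v k := by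
  -- Each non-zero `q d` in the range is lifted into the smallest member of the flag whose image
  -- contains it. By the chain condition the lift lies in every member whose image contains `q d`.
  have hex : ∀ d, ∃ y : V, (q d ≠ 0 ∧ q d ∈ LinearMap.range π →
      π y = q d ∧ ∀ A ∈ F, q d ∈ A.map π → y ∈ A) ∧
      (¬ (q d ≠ 0 ∧ q d ∈ LinearMap.range π) → y = 0) := by
    intro d
    by_cases hd : q d ≠ 0 ∧ q d ∈ LinearMap.range π
    · have hne : {A ∈ F | q d ∈ A.map π}.Nonempty :=
        ⟨⊤, hF.top_mem, by rw [Submodule.map_top]; exact hd.2⟩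
      obtain ⟨A, hA⟩ := (hF.finite.subset (Set.sep_subset _ _)).exists_minimal hne
      obtain ⟨y, hy, hyq⟩ := hA.prop.2
      refine ⟨y, fun _ => ⟨hyq, fun A' hA' hq' => ?_⟩, fun h => absurd hd h⟩
      rcases hF.chain.total hA.prop.1 hA' with h | h
      · exact h hy
      · exact hA.le_of_le ⟨hA', hq'⟩ h hy
    · exact ⟨0, fun h => absurd h hd, fun _ => rfl⟩
  choose v hv hv0 using hex
  have hv1 : ∀ d, v d ≠ 0 → π (v d) = q d ∧ q d ≠ 0 := fun d hd => by
    by_cases h : q d ≠ 0 ∧ q d ∈ LinearMap.range π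
    · exact ⟨(hv d h).1, h.1⟩
    · exact absurd (hv0 d h) hd
  refine ⟨v, hv1, fun d hd => ?_, fun l l' hl hl' h0 => ?_, fun A hA a ha => ?_⟩
  · by_cases h : q d = 0
    · rw [hv0 d (fun h' => h'.1 h), map_zero, h]
    · exact (hv d ⟨h, hd⟩).1
  · have h1 : Finsupp.linearCombination κ q l = 0 := by
      have h2 := congrArg π h0
      rw [map_add, map_zero, linearCombination_comp_eq π (v := k) (u := fun _ => 0)
        (fun c _ => hkπ c), linearCombination_comp_eq π (v := v) (u := q)] at h2
      · simpa [Finsupp.linearCombination_apply] using h2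
      · exact fun b hb => (hv1 b fun hb' => hb (hl b hb')).1
    have h2 : l = 0 := by
      refine hq l (fun b hb => hl b ?_) h1
      by_contra hvb
      exact (hv1 b hvb).2 hb
    refine ⟨h2, hk l' hl' ?_⟩
    rwa [h2, map_zero, zero_add] at h0
  · have h1 : Submodule.span κ (q '' {d | q d ∈ A.map π}) ≤
        (Submodule.span κ (v '' {d | v d ∈ A})).map π := by
      rw [Submodule.span_le]
      rintro _ ⟨d, hd, rfl⟩
      by_cases h : q d = 0
      · rw [h]
        exact zero_mem _
      · have h2 := hv d ⟨h, LinearMap.map_le_range hd⟩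
        exact ⟨v d, Submodule.subset_span ⟨d, h2.2 A hA hd, rfl⟩, h2.1⟩
    obtain ⟨y, hy, hya⟩ := h1 (hqF A hA ⟨a, ha, rfl⟩)
    have hyA : y ∈ A := by
      refine Submodule.span_le.2 ?_ hy
      rintro _ ⟨d, hd, rfl⟩
      exact hd
    have h2 : a - y ∈ A ⊓ LinearMap.ker π :=
      ⟨sub_mem ha hyA, LinearMap.mem_ker.2 (by rw [map_sub, hya, sub_self])⟩
    rw [← add_sub_cancel y a]
    exact add_mem (Submodule.mem_sup_left hy) (Submodule.mem_sup_right (hkF A hA h2))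

variable {W : Type w} [AddCommGroup W] [Module κ W] {F : Set (Submodule κ V)}

theorem IsFlag.map (hF : IsFlag F) (φ : V →ₗ[κ] W) :
    IsFlag (insert ⊤ ((fun A => A.map φ) '' F)) where
  finite := (hF.finite.image _).insert _
  chain := (isChain_image hF.chain fun _ _ h => Submodule.map_mono h).insert
    fun _ _ _ => Or.inr le_top
  top_mem := Set.mem_insert _ _

theorem IsFlag.comap (hF : IsFlag F) (ψ : W →ₗ[κ] V) :
    IsFlag ((fun A => A.comap ψ) '' insert ⊥ F) where
  finite := (hF.finite.insert _).image _
  chain := isChain_image (hF.chain.insert fun _ _ _ => Or.inl bot_le)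
    fun _ _ h => Submodule.comap_mono h
  top_mem := ⟨⊤, Set.mem_insert_of_mem _ hF.top_mem, Submodule.comap_top ψ⟩

/-- Pulling an adapted family back along a map. -/
theorem exists_pullback (hF : IsFlag F) (φ : V →ₗ[κ] W) {w : T → W}
    (hw : IsAdapted (insert ⊤ ((fun A => A.map φ) '' F)) w) :
    ∃ (C : Type w) (k : C → V) (v : T → V), (∀ c, k c ≠ 0) ∧ (∀ c, φ (k c) = 0) ∧
      (∀ b, v b ≠ 0 → φ (v b) = w b ∧ w b ≠ 0) ∧ IsAdapted F (Sum.elim v k) := by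
  -- The additional vectors form a basis of the kernel, adapted to the traces of the flag on it.
  obtain ⟨C, k, hk0, hkker, hk⟩ := exists_isAdapted (F := (fun A => A ⊓ LinearMap.ker φ) '' F)
    (hF.finite.image _) (isChain_image hF.chain fun _ _ h => inf_le_inf_right _ h)
  have hkφ : ∀ c, φ (k c) = 0 := fun c => by
    obtain ⟨_, ⟨A, -, rfl⟩, h⟩ := hkker c
    exact h.2
  obtain ⟨v, hv, -, h⟩ := exists_adapted_lift hF φ hk.indep hkφ (fun A hA => by
    refine (hk.span _ ⟨A, hA, rfl⟩).trans (Submodule.span_mono (Set.image_mono ?_))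
    exact fun c hc => hc.1) hw.indep fun A hA => hw.span _ (Set.mem_insert_of_mem _ ⟨A, hA, rfl⟩)
  exact ⟨C, k, v, hk0, hkφ, hv, h.isAdapted⟩

/-- A relation among the `ψ (w b)` puts the combination of the `w b` into the kernel of `ψ`. By the
hypothesis on the kernel and independence, only members in the kernel can occur, and their
coefficients are zero by assumption. -/
theorem isIndep_comp (ψ : W →ₗ[κ] V) {w : T → W} (hw : IsIndep κ w)
    (hker : LinearMap.ker ψ ≤ Submodule.span κ (w '' {b | w b ∈ LinearMap.ker ψ})) :
    IsIndep κ fun b => ψ (w b) := by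
  intro l hl h0
  have h1 : Finsupp.linearCombination κ w l ∈ LinearMap.ker ψ := by
    rw [LinearMap.mem_ker, ← h0]
    exact linearCombination_comp_eq ψ fun _ _ => rfl
  have h2 : Submodule.span κ (w '' {b | w b ∈ LinearMap.ker ψ}) ≤
      Submodule.span κ (w '' {b | w b ∈ LinearMap.ker ψ ∧ w b ≠ 0}) := by
    rw [Submodule.span_le]
    rintro _ ⟨b, hb, rfl⟩
    by_cases h : w b = 0
    · rw [h]
      exact zero_mem _
    · exact Submodule.subset_span ⟨b, ⟨hb, h⟩, rfl⟩
  obtain ⟨l', hl', h3⟩ := (Finsupp.mem_span_image_iff_linearCombination κ).1 (h2 (hker h1))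
  have hl'0 : ∀ b, ¬ (ψ (w b) = 0 ∧ w b ≠ 0) → l' b = 0 := fun b hb => by
    by_contra h
    exact hb (hl' (Finsupp.mem_support_iff.2 h))
  have h4 : l - l' = 0 := by
    refine hw _ (fun b hb => ?_) (by rw [map_sub, h3, sub_self])
    rw [Finsupp.sub_apply, hl b (by simp [hb]), hl'0 b (fun h => h.2 hb), sub_zero]
  rw [sub_eq_zero] at h4
  ext b
  by_cases h : ψ (w b) = 0
  · exact hl b h
  · rw [h4]
    exact hl'0 b fun h' => h h'.1

/-- Pushing an adapted family forward along a map. -/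
theorem exists_pushforward (hF : IsFlag F) (ψ : W →ₗ[κ] V) {w : T → W}
    (hw : IsAdapted ((fun A => A.comap ψ) '' insert ⊥ F) w) :
    ∃ (C : Type w) (k : C → V), (∀ c, k c ≠ 0) ∧
      IsAdapted F (Sum.elim (fun b => ψ (w b)) k) := by
  -- The additional vectors are lifts of a basis of the quotient by the range of `ψ`, adapted to the
  -- images of the flag.
  obtain ⟨C, q, hq0, -, hq⟩ := exists_isAdapted
    (F := (fun A => A.map (LinearMap.range ψ).mkQ) '' F)
    (hF.finite.image _) (isChain_image hF.chain fun _ _ h => Submodule.map_mono h)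
  have hker := hw.span _ ⟨⊥, Set.mem_insert _ _, rfl⟩
  obtain ⟨v, -, hv, h⟩ := exists_adapted_lift hF (LinearMap.range ψ).mkQ
    (isIndep_comp ψ hw.indep hker) (fun b => (Submodule.Quotient.mk_eq_zero _).2 ⟨w b, rfl⟩)
    (fun A hA => by
      rintro _ ⟨ha, hr⟩
      rw [SetLike.mem_coe, Submodule.ker_mkQ] at hr
      obtain ⟨z, rfl⟩ := hr
      have h1 := Submodule.mem_map_of_mem (f := ψ)
        (hw.span _ ⟨A, Set.mem_insert_of_mem _ hA, rfl⟩ ha)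
      rw [Submodule.map_span, Set.image_image] at h1
      exact h1) hq.indep fun A hA => hq.span _ ⟨A, hA, rfl⟩
  refine ⟨C, v, fun c hc => hq0 c ?_, h.symm.isAdapted⟩
  rw [← hv c (by rw [Submodule.range_mkQ]; trivial), hc, map_zero]

end Flags

end CircleValued

end

noncomputable section

open Set

namespace CircleValued

/-! ### Decomposition of a sequence of vector spaces and maps in both directions -/

section Strings

variable {κ : Type v} [Field κ] {V : ℕ → Type w} [∀ q, AddCommGroup (V q)] [∀ q, Module κ (V q)]

/-- The family `x` decomposes the part of the sequence between `p` and `n` into intervals. Between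
`q` and `q + 1` there is the map `φ q` if `fwd q` holds and the map `ψ q` otherwise. -/
structure IsDecomposition (fwd : ℕ → Prop) (φ : ∀ q, V q →ₗ[κ] V (q + 1))
    (ψ : ∀ q, V (q + 1) →ₗ[κ] V q) (p n : ℕ) {T : Type w} (x : T → ∀ q, V q) : Prop where
  support : ∀ b, ∃ lo hi, p ≤ lo ∧ lo ≤ hi ∧ hi ≤ n ∧ ∀ q, x b q ≠ 0 ↔ lo ≤ q ∧ q ≤ hi
  adapted : ∀ q, p ≤ q → q ≤ n → IsAdapted {(⊤ : Submodule κ (V q))} fun b => x b q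
  comm_fwd : ∀ q, p ≤ q → q < n → fwd q → ∀ b, x b q ≠ 0 → φ q (x b q) = x b (q + 1)
  comm_bwd : ∀ q, p ≤ q → q < n → ¬ fwd q → ∀ b, x b (q + 1) ≠ 0 → ψ q (x b (q + 1)) = x b q

variable {fwd : ℕ → Prop} {φ : ∀ q, V q →ₗ[κ] V (q + 1)} {ψ : ∀ q, V (q + 1) →ₗ[κ] V q}

/-- The family `x`, with the values `v` at `p`, together with a family concentrated at `p`. -/
def extendFamily {T C : Type w} (p : ℕ) (x : T → ∀ q, V q) (v : T → V p) (k : C → V p) :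
    T ⊕ C → ∀ q, V q :=
  Sum.elim (fun b => Function.update (x b) p (v b)) fun c => Pi.single p (k c)

/-- Passing from `p + 1` to `p`, an interval that contains `p + 1` is prolonged to `p` if `v b ≠ 0`;
the members of `k` are new intervals consisting of `p` only. -/
theorem IsDecomposition.extend {p n : ℕ} {T C : Type w} {x : T → ∀ q, V q}
    (h : IsDecomposition fwd φ ψ (p + 1) n x) (hpn : p < n) {v : T → V p} {k : C → V p}
    (hk : ∀ c, k c ≠ 0) (hv : ∀ b, v b ≠ 0 → x b (p + 1) ≠ 0)
    (had : IsAdapted {(⊤ : Submodule κ (V p))} (Sum.elim v k))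
    (hφv : fwd p → ∀ b, v b ≠ 0 → φ p (v b) = x b (p + 1)) (hφk : fwd p → ∀ c, φ p (k c) = 0)
    (hψ : ¬ fwd p → ∀ b, x b (p + 1) ≠ 0 → ψ p (x b (p + 1)) = v b) :
    IsDecomposition fwd φ ψ p n (extendFamily p x v k) where
  support := by
    rintro (b | c)
    · obtain ⟨lo, hi, h1, h2, h3, h4⟩ := h.support b
      by_cases hb : v b = 0
      · refine ⟨lo, hi, by omega, h2, h3, fun q => ?_⟩
        rcases eq_or_ne q p with rfl | hq
        · simp only [extendFamily, Sum.elim_inl, Function.update_self, hb, ne_eq, not_true_eq_false,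
            false_iff]
          omega
        · simp only [extendFamily, Sum.elim_inl, Function.update_of_ne hq]
          exact h4 q
      · have h5 := (h4 (p + 1)).1 (hv b hb)
        refine ⟨p, hi, le_rfl, by omega, h3, fun q => ?_⟩
        rcases eq_or_ne q p with rfl | hq
        · simp only [extendFamily, Sum.elim_inl, Function.update_self]
          exact ⟨fun _ => ⟨le_rfl, by omega⟩, fun _ => hb⟩
        · simp only [extendFamily, Sum.elim_inl, Function.update_of_ne hq]
          rw [h4 q]
          omega
    · refine ⟨p, p, le_rfl, le_rfl, hpn.le, fun q => ?_⟩
      rcases eq_or_ne q p with rfl | hq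
      · simp [extendFamily, hk c]
      · simp only [extendFamily, Sum.elim_inr, Pi.single_eq_of_ne hq]
        simp only [ne_eq, not_true_eq_false, false_iff]
        omega
  adapted q hq hqn := by
    rcases hq.eq_or_lt with rfl | hlt
    · convert had using 1
      funext t
      rcases t with b | c
      · simp [extendFamily]
      · simp [extendFamily]
    · convert ((h.adapted q hlt hqn).pair_zero (C := C)).isAdapted using 1
      funext t
      rcases t with b | c
      · simp [extendFamily, hlt.ne']
      · simp [extendFamily, hlt.ne']
  comm_fwd q hq hqn hf := by
    rcases hq.eq_or_lt with rfl | hlt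
    · rintro (b | c) hb
      · simp only [extendFamily, Sum.elim_inl, Function.update_self,
          Function.update_of_ne (Nat.succ_ne_self _)] at hb ⊢
        exact hφv hf b hb
      · simp only [extendFamily, Sum.elim_inr, Pi.single_eq_same,
          Pi.single_eq_of_ne (Nat.succ_ne_self _)]
        exact hφk hf c
    · rintro (b | c) hb
      · simp only [extendFamily, Sum.elim_inl, Function.update_of_ne hlt.ne',
          Function.update_of_ne (show q + 1 ≠ p by omega)] at hb ⊢
        exact h.comm_fwd q hlt hqn hf b hb
      · simp [extendFamily, hlt.ne'] at hb
  comm_bwd q hq hqn hf := by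
    have hq1 : q + 1 ≠ p := by omega
    rintro (b | c) hb
    · rcases hq.eq_or_lt with rfl | hlt
      · simp only [extendFamily, Sum.elim_inl, Function.update_self,
          Function.update_of_ne (Nat.succ_ne_self _)] at hb ⊢
        exact hψ hf b hb
      · simp only [extendFamily, Sum.elim_inl, Function.update_of_ne hlt.ne',
          Function.update_of_ne hq1] at hb ⊢
        exact h.comm_bwd q hlt hqn hf b hb
    · simp only [extendFamily, Sum.elim_inr, Pi.single_eq_of_ne hq1, ne_eq, not_true_eq_false] at hb

theorem extendFamily_self {T C : Type w} (p : ℕ) (x : T → ∀ q, V q) (v : T → V p) (k : C → V p) :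
    (fun t => extendFamily p x v k t p) = Sum.elim v k := by
  funext t
  rcases t with b | c
  · simp [extendFamily]
  · simp [extendFamily]

/-- A sequence of vector spaces is a sum of intervals, in a way which is compatible with a flag in
the first space. -/
theorem exists_decomposition (fwd : ℕ → Prop) (φ : ∀ q, V q →ₗ[κ] V (q + 1))
    (ψ : ∀ q, V (q + 1) →ₗ[κ] V q) (n k p : ℕ) (hp : p + k = n) (F : Set (Submodule κ (V p)))
    (hF : IsFlag F) : ∃ (T : Type w) (x : T → ∀ q, V q), IsDecomposition fwd φ ψ p n x ∧
      IsAdapted F fun b => x b p := by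
  induction k generalizing p with
  | zero =>
    obtain rfl : p = n := hp
    obtain ⟨C, e, he, -, had⟩ := exists_isAdapted hF.finite hF.chain
    have hx : (fun c => (Pi.single p (e c) : ∀ q, V q) p) = e := by
      funext c
      simp
    refine ⟨C, fun c => Pi.single p (e c), ⟨fun c => ⟨p, p, le_rfl, le_rfl, le_rfl, fun q => ?_⟩,
      fun q hq hqp => ?_, fun q h1 h2 => absurd h1 (not_le.2 h2),
      fun q h1 h2 => absurd h1 (not_le.2 h2)⟩, ?_⟩
    · rcases eq_or_ne q p with rfl | hq
      · simp [he c]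
      · simp only [Pi.single_eq_of_ne hq, ne_eq, not_true_eq_false, false_iff]
        omega
    · obtain rfl : q = p := le_antisymm hqp hq
      rw [hx]
      exact had.mono (by simpa using hF.top_mem)
    · rw [hx]
      exact had
  | succ k ih =>
    have hpn : p < n := by omega
    by_cases hf : fwd p
    -- For a forward map the decomposition to the right is required to respect the image flag, so
    -- that its vectors can be lifted compatibly with `F`. This is why the induction needs arbitrary
    -- flags.
    · obtain ⟨T, x, hx, hxF⟩ := ih (p + 1) (by omega) _ (hF.map (φ p))
      obtain ⟨C, e, v, he, heφ, hv, had⟩ := exists_pullback hF (φ p) hxF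
      refine ⟨T ⊕ C, extendFamily p x v e, hx.extend hpn he (fun b hb => (hv b hb).2)
        (had.mono (by simpa using hF.top_mem)) (fun _ b hb => (hv b hb).1) (fun _ => heφ)
        (fun h => absurd hf h), ?_⟩
      rw [extendFamily_self]
      exact had
    -- For a backward map the preimages of the flag are used together with the kernel, the preimage
    -- of `⊥`; adaptedness to the kernel keeps the non-zero images independent.
    · obtain ⟨T, x, hx, hxF⟩ := ih (p + 1) (by omega) _ (hF.comap (ψ p))
      obtain ⟨C, e, he, had⟩ := exists_pushforward hF (ψ p) hxF
      refine ⟨T ⊕ C, extendFamily p x (fun b => ψ p (x b (p + 1))) e, hx.extend hpn he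
        (fun b hb h0 => hb (by rw [h0, map_zero])) (had.mono (by simpa using hF.top_mem))
        (fun h => absurd h hf) (fun h => absurd h hf) (fun _ b _ => rfl), ?_⟩
      rw [extendFamily_self]
      exact had

end Strings

/-! ### The sequence of a representation -/

namespace CyclicRep

variable {κ : Type v} [Field κ] {m : ℕ} (ρ : CyclicRep.{v, w} κ m)

/-- The space at the vertex `x_{q+1}`, and zero for `q ≥ 2m`. -/
abbrev space (q : ℕ) : Type w :=
  (∀ i : {i : Fin m // 2 * i.val = q}, ρ.odd i.1) ×
    ∀ i : {i : Fin m // 2 * i.val + 1 = q}, ρ.even i.1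

/-- The maps `α` in the sequence of spaces. -/
def spaceMap (q : ℕ) : ρ.space q →ₗ[κ] ρ.space (q + 1) :=
  LinearMap.prod 0 (LinearMap.pi fun i =>
    ρ.α i.1 ∘ₗ LinearMap.proj (φ := fun i : {i : Fin m // 2 * i.val = q} => ρ.odd i.1)
      ⟨i.1, Nat.succ.inj i.2⟩ ∘ₗ LinearMap.fst κ _ _)

/-- The maps `β` in the sequence of spaces. -/
def spaceMap' (q : ℕ) : ρ.space (q + 1) →ₗ[κ] ρ.space q :=
  LinearMap.prod 0 (LinearMap.pi fun i => if h : i.1.val + 1 < m then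
    ρ.β i.1 ∘ₗ LinearMap.proj (φ := fun i : {i : Fin m // 2 * i.val = q + 1} => ρ.odd i.1)
      ⟨finRotate m i.1, by rw [finRotate_val_of_lt h]; have := i.2; omega⟩ ∘ₗ LinearMap.fst κ _ _
    else 0)

/-- The space at an odd vertex. -/
def oddSpace (i : Fin m) : ρ.space (2 * i.val) ≃ₗ[κ] ρ.odd i :=
  LinearEquiv.ofBijective (LinearMap.proj
    (φ := fun j : {j : Fin m // 2 * j.val = 2 * i.val} => ρ.odd j.1) ⟨i, rfl⟩ ∘ₗ
      LinearMap.fst κ _ _) (by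
    constructor
    · intro z z' h
      refine Prod.ext (funext fun ⟨j, hj⟩ => ?_) (funext fun ⟨j, hj⟩ => by omega)
      obtain rfl : j = i := Fin.ext (by omega)
      exact h
    · intro y
      refine ⟨⟨fun j => (Fin.ext (by have := j.2; omega) : i = j.1) ▸ y,
        fun ⟨j, hj⟩ => by omega⟩, rfl⟩)

/-- The space at an even vertex. -/
def evenSpace (i : Fin m) : ρ.space (2 * i.val + 1) ≃ₗ[κ] ρ.even i :=
  LinearEquiv.ofBijective (LinearMap.proj
    (φ := fun j : {j : Fin m // 2 * j.val + 1 = 2 * i.val + 1} => ρ.even j.1) ⟨i, rfl⟩ ∘ₗ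
      LinearMap.snd κ _ _) (by
    constructor
    · intro z z' h
      refine Prod.ext (funext fun ⟨j, hj⟩ => by omega) (funext fun ⟨j, hj⟩ => ?_)
      obtain rfl : j = i := Fin.ext (by omega)
      exact h
    · intro y
      refine ⟨⟨fun ⟨j, hj⟩ => by omega,
        fun j => (Fin.ext (by have := j.2; omega) : i = j.1) ▸ y⟩, rfl⟩)

theorem evenSpace_spaceMap' {i : Fin m} (h : i.val + 1 < m)
    (h' : 2 * (finRotate m i).val = 2 * i.val + 1 + 1) (z : ρ.space (2 * i.val + 1 + 1)) :
    ρ.evenSpace i (ρ.spaceMap' (2 * i.val + 1) z) = ρ.β i (z.1 ⟨finRotate m i, h'⟩) := by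
  have h1 : ρ.evenSpace i (ρ.spaceMap' (2 * i.val + 1) z) =
      (ρ.spaceMap' (2 * i.val + 1) z).2 ⟨i, rfl⟩ := rfl
  rw [h1, spaceMap']
  simp [dif_pos h]

theorem _root_.CircleValued.IsAdapted.map_equiv {M N : Type w} [AddCommGroup M] [Module κ M] [AddCommGroup N]
    [Module κ N] {T : Type w'} {u : T → M} (h : IsAdapted {(⊤ : Submodule κ M)} u) (e : M ≃ₗ[κ] N) :
    IsAdapted {(⊤ : Submodule κ N)} fun b => e (u b) where
  indep l hl h0 := by
    refine h.indep l (fun b hb => hl b (by simp [hb])) ?_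
    rw [← e.map_eq_zero_iff, ← h0]
    exact linearCombination_comp_eq e.toLinearMap fun _ _ => rfl
  span := by
    rintro _ rfl
    have h1 := Submodule.map_mono (f := (e : M →ₗ[κ] N)) (h.span ⊤ rfl)
    rw [Submodule.map_top, LinearEquiv.range, Submodule.map_span, Set.image_image] at h1
    exact h1

/-- A representation which vanishes at the first vertex is a sum of intervals. The positions `2i`
and `2i + 1` belong to `odd i` and `even i`. -/
theorem exists_strings (hodd : ∀ i : Fin m, i.val = 0 → Subsingleton (ρ.odd i)) :
    ∃ (T : Type w) (lo hi : T → ℕ) (x : T → ∀ i, ρ.odd i) (y : T → ∀ i, ρ.even i),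
      (∀ b, 0 < lo b ∧ lo b ≤ hi b ∧ hi b < 2 * m) ∧
      (∀ b i, x b i ≠ 0 ↔ lo b ≤ 2 * i.val ∧ 2 * i.val ≤ hi b) ∧
      (∀ b i, y b i ≠ 0 ↔ lo b ≤ 2 * i.val + 1 ∧ 2 * i.val + 1 ≤ hi b) ∧
      (∀ i, IsAdapted {(⊤ : Submodule κ (ρ.odd i))} fun b => x b i) ∧
      (∀ i, IsAdapted {(⊤ : Submodule κ (ρ.even i))} fun b => y b i) ∧
      (∀ b i, x b i ≠ 0 → ρ.α i (x b i) = y b i) ∧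
      ∀ b i, i.val + 1 < m → x b (finRotate m i) ≠ 0 → ρ.β i (x b (finRotate m i)) = y b i := by
  rcases Nat.eq_zero_or_pos m with rfl | hm
  · exact ⟨PEmpty, fun b => b.elim, fun b => b.elim, fun b => b.elim, fun b => b.elim,
      fun b => b.elim, fun b => b.elim, fun b => b.elim, fun i => i.elim0, fun i => i.elim0,
      fun b => b.elim, fun b => b.elim⟩
  -- Maps `α` lead from position `2i` forward to `2i + 1`, maps `β` from `2i + 2` back to `2i + 1`.
  -- The last `β` starts at the vanishing first vertex and is left out, which makes the sequence a
  -- line.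
  obtain ⟨T, z, hz, -⟩ := exists_decomposition (fun q => Even q) ρ.spaceMap ρ.spaceMap'
    (2 * m - 1) (2 * m - 1) 0 (by omega) {⊤} ⟨finite_singleton _, IsChain.singleton, rfl⟩
  choose lo hi h0 h1 h2 h3 using hz.support
  have hx : ∀ b i, ρ.oddSpace i (z b (2 * i.val)) ≠ 0 ↔ lo b ≤ 2 * i.val ∧ 2 * i.val ≤ hi b :=
    fun b i => by rw [← h3, ne_eq, LinearEquiv.map_eq_zero_iff]
  have hy : ∀ b i, ρ.evenSpace i (z b (2 * i.val + 1)) ≠ 0 ↔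
      lo b ≤ 2 * i.val + 1 ∧ 2 * i.val + 1 ≤ hi b :=
    fun b i => by rw [← h3, ne_eq, LinearEquiv.map_eq_zero_iff]
  refine ⟨T, lo, hi, fun b i => ρ.oddSpace i (z b (2 * i.val)),
    fun b i => ρ.evenSpace i (z b (2 * i.val + 1)), fun b => ⟨?_, h1 b, ?_⟩, hx, hy,
    fun i => IsAdapted.map_equiv (hz.adapted _ (Nat.zero_le _) (by omega)) _,
    fun i => IsAdapted.map_equiv (hz.adapted _ (Nat.zero_le _) (by omega)) _,
    fun b i hb => ?_, fun b i hi hb => ?_⟩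
  · by_contra hlo
    have := hodd ⟨0, hm⟩ rfl
    exact (hx b ⟨0, hm⟩).2 ⟨by simp only; omega, Nat.zero_le _⟩ (Subsingleton.elim _ _)
  · have := h2 b
    omega
  · have hb' : z b (2 * i.val) ≠ 0 := fun h => hb (by simp only [h, map_zero])
    have h4 := hz.comm_fwd (2 * i.val) (Nat.zero_le _) (by omega) (even_two_mul _) b hb'
    beta_reduce
    rw [← h4]
    rfl
  · have hrot := finRotate_val_of_lt hi
    have hb' : z b (2 * (finRotate m i).val) ≠ 0 := fun h => hb (by simp only [h, map_zero])
    have h5 : 2 * (finRotate m i).val = 2 * i.val + 1 + 1 := by omega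
    have hb'' : z b (2 * i.val + 1 + 1) ≠ 0 := by rwa [← h5]
    have h4 := hz.comm_bwd (2 * i.val + 1) (Nat.zero_le _) (by omega)
      (by simp [parity_simps]) b hb''
    beta_reduce
    rw [← h4]
    have h6 : ∀ q (hq : 2 * (finRotate m i).val = q),
        ρ.oddSpace (finRotate m i) (z b (2 * (finRotate m i).val)) =
          (z b q).1 ⟨finRotate m i, hq⟩ := by
      rintro q rfl
      rfl
    rw [h6 _ h5]
    exact (ρ.evenSpace_spaceMap' hi h5 _).symm

end CyclicRep

end CircleValued

end

noncomputable section

open Set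

namespace CircleValued

/-! ### Existence of bar codes -/

section Existence

variable {κ : Type v} [Field κ] {m : ℕ} {s t : Fin m → ℝ}

/-- The bar code of the interval between the vertices `x_{lo+1}` and `x_{hi+1}`. -/
theorem exists_barCode (h : Interlaced s t) {lo hi : ℕ} (hlo : 0 < lo) (hle : lo ≤ hi)
    (hhi : hi < 2 * m) : ∃ b : BarCode s, b.turns = 0 ∧
      (∀ i, t i ∈ b.interval ↔ lo ≤ 2 * i.val ∧ 2 * i.val ≤ hi) ∧
      ∀ i, s i ∈ b.interval ↔ lo ≤ 2 * i.val + 1 ∧ 2 * i.val + 1 ≤ hi := by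
  -- A start at `lo = 2l + 1` is a closed end at `s l`; a start at `lo = 2l + 2`, the position of `t
  -- (l + 1)`, is an open end at `s l`. Likewise `hi = 2r + 1` is closed and `hi = 2r` is open at `s
  -- r`.
  let l : Fin m := ⟨(lo - 1) / 2, by omega⟩
  let r : Fin m := ⟨hi / 2, by omega⟩
  have hne : (flaggedInterval (s l) (s r + 2 * Real.pi * (0 : ℕ)) (decide (lo % 2 = 1))
      (decide (hi % 2 = 1))).Nonempty := by
    rw [Nat.cast_zero, mul_zero, add_zero]
    rcases Nat.mod_two_eq_zero_or_one lo with hl | hl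
    · refine ⟨t ⟨lo / 2, by omega⟩, Or.inl ?_, Or.inl ?_⟩
      · refine h.lt_next _ _ (Fin.lt_def.2 ?_)
        simp only [l]
        omega
      · refine (h.lt _).trans_le (h.strictMono.monotone (Fin.le_def.2 ?_))
        simp only [r]
        omega
    · refine ⟨s l, Or.inr ⟨by simpa using hl, rfl⟩, ?_⟩
      rw [h.strictMono.lt_iff_lt, h.strictMono.injective.eq_iff, Fin.lt_def, Fin.ext_iff,
        decide_eq_true_iff]
      simp only [l, r]
      omega
  let b : BarCode s := ⟨l, r, 0, decide (lo % 2 = 1), decide (hi % 2 = 1), hne⟩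
  have hb : b.turns = 0 := rfl
  refine ⟨b, hb, fun i => ?_, fun i => ?_⟩
  · rw [BarCode.t_mem_interval h hb, Fin.lt_def, Fin.le_def]
    simp only [b, l, r]
    omega
  · rw [BarCode.critical_mem_interval h hb, Fin.lt_def, Fin.lt_def, Fin.ext_iff, Fin.ext_iff]
    simp only [b, l, r, decide_eq_true_iff]
    omega

variable {T : Type w}

/-- The map from a sum of spaces with at most one coordinate which is given by a family. -/
def familyMap {M : Type w} [AddCommGroup M] [Module κ M] (B : T → BarCode s) (a : ℝ) (u : T → M) :
    (Π₀ b, PointSpace κ (B b).interval a) →ₗ[κ] M :=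
  haveI := Classical.decEq T
  DFinsupp.lsum ℕ fun b => (LinearMap.toSpanSingleton κ M (u b)) ∘ₗ total (B b).interval a

theorem familyMap_single [DecidableEq T] {M : Type w} [AddCommGroup M] [Module κ M]
    (B : T → BarCode s) (a : ℝ) (u : T → M) (b : T) (z : PointSpace κ (B b).interval a) :
    familyMap B a u (DFinsupp.single b z) = total (B b).interval a z • u b := by
  have : ‹DecidableEq T› = Classical.decEq T := Subsingleton.elim _ _
  subst this
  simp [familyMap]

theorem familyMap_eq_linearCombination {M : Type w} [AddCommGroup M] [Module κ M]
    (B : T → BarCode s) (a : ℝ) (u : T → M) (z : Π₀ b, PointSpace κ (B b).interval a) :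
    ∃ l : T →₀ κ, (∀ b, l b = total (B b).interval a (z b)) ∧
      familyMap B a u z = Finsupp.linearCombination κ u l := by
  classical
  induction z using DFinsupp.induction with
  | h0 => exact ⟨0, fun b => by simp, by simp⟩
  | ha b y z _ _ ih =>
    obtain ⟨l, hl, h⟩ := ih
    refine ⟨Finsupp.single b (total (B b).interval a y) + l, fun b' => ?_, ?_⟩
    · rw [Finsupp.add_apply, DFinsupp.add_apply, map_add, hl]
      congr 1
      rcases eq_or_ne b b' with rfl | hne
      · rw [Finsupp.single_eq_same, DFinsupp.single_eq_same]
      · rw [Finsupp.single_eq_of_ne hne.symm, DFinsupp.single_eq_of_ne hne.symm, map_zero]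
    · rw [map_add, map_add, h, familyMap_single, Finsupp.linearCombination_single]

theorem familyMap_mapRange {M N : Type w} [AddCommGroup M] [Module κ M] [AddCommGroup N]
    [Module κ N] {B : T → BarCode s} {a a' : ℝ} {x : T → M} {y : T → N} (A : M →ₗ[κ] N)
    (p : ∀ b, PointSpace κ (B b).interval a →ₗ[κ] PointSpace κ (B b).interval a')
    (hp : ∀ b z, total (B b).interval a' (p b z) • y b = total (B b).interval a z • A (x b))
    (z : Π₀ b, PointSpace κ (B b).interval a) :
    familyMap B a' y (DFinsupp.mapRange.linearMap p z) = A (familyMap B a x z) := by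
  classical
  induction z using DFinsupp.induction with
  | h0 => simp
  | ha b u z _ _ ih =>
    rw [map_add, map_add, map_add, map_add, ih, familyMap_single,
      DFinsupp.mapRange.linearMap_apply, DFinsupp.mapRange_single, familyMap_single, hp, map_smul]

/-- The summand of `b` is a line if `u b ≠ 0` and zero otherwise, and the non-zero `u b` form a
basis of `M`. -/
theorem familyMap_bijective (h : Interlaced s t) {M : Type w} [AddCommGroup M] [Module κ M]
    {B : T → BarCode s} (hB : ∀ b, (B b).turns = 0) {a : ℝ} (ha : a ∈ Ioc 0 (2 * Real.pi))
    {u : T → M} (hu : IsAdapted {(⊤ : Submodule κ M)} u)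
    (hmem : ∀ b, u b ≠ 0 ↔ a ∈ (B b).interval) : Function.Bijective (familyMap (κ := κ) B a u) := by
  classical
  constructor
  · intro z z' hz
    obtain ⟨l, hl, hzl⟩ := familyMap_eq_linearCombination B a u z
    obtain ⟨l', hl', hzl'⟩ := familyMap_eq_linearCombination B a u z'
    have hl0 : l - l' = 0 := by
      refine hu.indep _ (fun b hb => ?_) (by rw [map_sub, ← hzl, ← hzl', hz, sub_self])
      have hI : a ∉ (B b).interval := fun hab => (hmem b).2 hab hb
      rw [Finsupp.sub_apply, hl, hl', BarCode.total_eq_zero h (hB b) ha hI,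
        BarCode.total_eq_zero h (hB b) ha hI, sub_self]
    ext1 b
    refine total_injective (BarCode.subsingleton_index h (hB b) ha) ?_
    rw [← hl, ← hl', sub_eq_zero.1 hl0]
  · rw [← LinearMap.range_eq_top, eq_top_iff]
    refine (hu.span ⊤ rfl).trans (Submodule.span_le.2 ?_)
    rintro _ ⟨b, -, rfl⟩
    by_cases hb : u b = 0
    · rw [hb]
      exact zero_mem _
    · have h0 : a + 2 * Real.pi * ((0 : ℤ) : ℝ) ∈ (B b).interval := by
        simpa using (hmem b).1 hb
      refine ⟨DFinsupp.single b (Finsupp.single ⟨0, h0⟩ 1), ?_⟩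
      rw [familyMap_single, total_single, one_smul]

/-- The zero representation. -/
def CyclicRep.zero (κ : Type v) [Field κ] (m : ℕ) : CyclicRep.{v, w} κ m where
  odd _ := ModuleCat.of κ PUnit
  even _ := ModuleCat.of κ PUnit
  α _ := 0
  β _ := 0

theorem CyclicRep.nonempty_iso_prod_zero {ρ σ : CyclicRep.{v, w} κ m} (e : ρ.Iso σ) :
    Nonempty (ρ.Iso (σ.prod (CyclicRep.zero.{v, w} κ m))) :=
  ⟨{ odd := fun i => (e.odd i).trans (LinearEquiv.ofBijective
        (LinearMap.inl κ (σ.odd i) ((CyclicRep.zero.{v, w} κ m).odd i))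
          ⟨LinearMap.inl_injective, fun y => ⟨y.1, rfl⟩⟩)
     even := fun i => (e.even i).trans (LinearEquiv.ofBijective
        (LinearMap.inl κ (σ.even i) ((CyclicRep.zero.{v, w} κ m).even i))
          ⟨LinearMap.inl_injective, fun y => ⟨y.1, rfl⟩⟩)
     comm_α := fun i x => Prod.ext (e.comm_α i x) rfl
     comm_β := fun i x => Prod.ext (e.comm_β i x) rfl }⟩

theorem CyclicRep.nonempty_iso_of_subsingleton {ρ : CyclicRep.{v, w} κ m}
    {σ : CyclicRep.{v, w'} κ m} (h1 : ∀ i, Subsingleton (ρ.odd i))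
    (h2 : ∀ i, Subsingleton (ρ.even i)) (h3 : ∀ i, Subsingleton (σ.odd i))
    (h4 : ∀ i, Subsingleton (σ.even i)) : Nonempty (ρ.Iso σ) :=
  ⟨⟨fun _ => 0, fun _ => 0, fun i _ => (h4 i).elim _ _, fun i _ => (h4 i).elim _ _⟩⟩

/-- Each string yields a bar code, whose point on a ray is sent to the vector of the string at that
vertex. The strings exhaust the representation, so `ρ'` is zero and there are no Jordan cells. -/
theorem exists_hasInvariants (h : Interlaced s t) (ρ : CyclicRep.{v, max w v} κ m)
    (hodd : ∀ i : Fin m, i.val = 0 → Subsingleton (ρ.odd i)) :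
    ∃ (ι ι' : Type (max w v)) (B : ι → BarCode s) (J : ι' → JordanCell (AlgebraicClosure κ)),
      HasInvariants t ρ B J := by
  classical
  obtain ⟨T, lo, hi, x, y, hlh, hx, hy, hxa, hya, hα, hβ⟩ := ρ.exists_strings hodd
  choose B hB hBt hBs using fun b => exists_barCode h (hlh b).1 (hlh b).2.1 (hlh b).2.2
  have hxm : ∀ i b, x b i ≠ 0 ↔ t i ∈ (B b).interval := fun i b => (hx b i).trans (hBt b i).symm
  have hym : ∀ i b, y b i ≠ 0 ↔ s i ∈ (B b).interval := fun i b => (hy b i).trans (hBs b i).symm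
  let eo := fun i => LinearEquiv.ofBijective (familyMap (κ := κ) B (t i) fun b => x b i)
    (familyMap_bijective h hB (h.regular_mem_Ioc i) (hxa i) (hxm i))
  let ee := fun i => LinearEquiv.ofBijective (familyMap (κ := κ) B (s i) fun b => y b i)
    (familyMap_bijective h hB (h.critical_mem_Ioc i) (hya i) (hym i))
  let σ := CyclicRep.directSum fun b => (B b).rep κ t
  have hpt : ∀ b i j (z : PointSpace κ (B b).interval (t j)),
      total (B b).interval (s i) (pointMap κ (B b).interval (t j) (s i) 0 z) • y b i =
        total (B b).interval (t j) z • y b i := by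
    intro b i j z
    rw [total_pointMap fun n hn =>
      ((BarCode.add_mem_interval_iff h (hB b) (h.regular_mem_Ioc j) n).1 hn).1]
    split_ifs with hs
    · rfl
    · rw [show y b i = 0 from by_contra fun hne => hs ((hym i b).1 hne), smul_zero, smul_zero]
  have hzero : ∀ b j, x b j = 0 → ∀ z : PointSpace κ (B b).interval (t j), z = 0 := by
    intro b j hb z
    refine total_injective (BarCode.subsingleton_index h (hB b) (h.regular_mem_Ioc j)) ?_
    rw [map_zero]
    exact BarCode.total_eq_zero h (hB b) (h.regular_mem_Ioc j)
      (fun hab => (hxm j b).2 hab hb) _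
  have hcα : ∀ i z, ee i (σ.α i z) = ρ.α i (eo i z) := by
    intro i z
    refine familyMap_mapRange (ρ.α i) (fun b => ((B b).rep κ t).α i) (fun b z => ?_) z
    change total (B b).interval (s i)
      (pointMap κ (B b).interval (t i) (s i) 0 z) • y b i = _
    by_cases hb : x b i = 0
    · rw [hzero b i hb z, map_zero, map_zero, map_zero, zero_smul, zero_smul]
    · rw [hα b i hb]
      exact hpt b i i z
  have hcβ : ∀ i z, ee i (σ.β i z) = ρ.β i (eo (finRotate m i) z) := by
    intro i z
    refine familyMap_mapRange (ρ.β i) (fun b => ((B b).rep κ t).β i) (fun b z => ?_) z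
    change total (B b).interval (s i)
      (pointMap κ (B b).interval (t (finRotate m i)) (s i) (carry i) z) • y b i = _
    by_cases hb : x b (finRotate m i) = 0
    · rw [hzero b _ hb z, map_zero, map_zero, map_zero, zero_smul, zero_smul]
    -- Strings avoid the first vertex, so a non-zero vector at the successor of `i` excludes the
    -- last index and the carry is `0`.
    · have hi : i.val + 1 < m := by
        by_contra hi
        have h1 := finRotate_val_of_eq (le_antisymm i.2 (not_lt.1 hi))
        have h2 := (hx b _).1 hb
        have h3 := (hlh b).1
        omega
      rw [hβ b i hi hb, show carry i = 0 by simp [carry, hi.ne]]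
      exact hpt b i _ z
  obtain ⟨e⟩ := CyclicRep.nonempty_iso_prod_zero (ρ := ρ) (σ := σ)
    ⟨fun i => (eo i).symm, fun i => (ee i).symm, fun i x =>
      (LinearEquiv.symm_apply_eq (ee i)).2
        ((hcα i _).trans (congrArg (ρ.α i) ((eo i).apply_symm_apply x))).symm, fun i x =>
      (LinearEquiv.symm_apply_eq (ee i)).2
        ((hcβ i _).trans (congrArg (ρ.β i) ((eo _).apply_symm_apply x))).symm⟩
  refine ⟨T, PEmpty, B, fun j => j.elim, CyclicRep.zero κ m, ⟨e⟩,
    CyclicRep.nonempty_iso_of_subsingleton (fun i => ?_) (fun i => ?_) (fun i => ?_) fun i => ?_⟩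
  · exact inferInstanceAs (Subsingleton (TensorProduct κ (AlgebraicClosure κ) PUnit.{max v w + 1}))
  · exact inferInstanceAs (Subsingleton (TensorProduct κ (AlgebraicClosure κ) PUnit.{max v w + 1}))
  · exact ⟨fun x y => DFinsupp.ext fun j => j.elim⟩
  · exact ⟨fun x y => DFinsupp.ext fun j => j.elim⟩

end Existence

end CircleValued

end

theorem corollary1 {κ : Type v} [Field κ] {X : Type u} [TopologicalSpace X] [CompactSpace X]
    [Nonempty X] (f : X → ℝ) (hf : CircleValued.IsTame f) :
    (CircleValued.criticalValues (CircleValued.toCircleValued f)).Finite ∧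
    ∀ (m : ℕ) (s t : Fin m → ℝ) (h : CircleValued.Interlaced s t),
      Set.range (fun i => (s i : Real.Angle)) =
        CircleValued.criticalValues (CircleValued.toCircleValued f) →
      (∀ r : ℕ, ∃ (ι ι' : Type (max u v)) (B : ι → CircleValued.BarCode s)
        (J : ι' → CircleValued.JordanCell (AlgebraicClosure κ)),
        CircleValued.HasInvariants t
          (CircleValued.fiberRep κ (CircleValued.toCircleValued f) h r) B J) ∧
      ∀ (ι ι' : ℕ → Type (max u v)) (B : ∀ r, ι r → CircleValued.BarCode s)
        (J : ∀ r, ι' r → CircleValued.JordanCell (AlgebraicClosure κ)),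
        (∀ r, CircleValued.HasInvariants t
          (CircleValued.fiberRep κ (CircleValued.toCircleValued f) h r) (B r) (J r)) →
        (∀ r, IsEmpty (ι' r)) ∧
        (∀ (r : ℕ) (θ : Real.Angle),
          CircleValued.betti κ r (CircleValued.Fiber (CircleValued.toCircleValued f) θ) =
            Cardinal.sum fun b : ι r => (B r b).count θ) ∧
        CircleValued.betti κ 0 X = Cardinal.mk {b : ι 0 // (B 0 b).BothClosed} ∧
        ∀ r : ℕ, CircleValued.betti κ (r + 1) X =
          Cardinal.mk {b : ι (r + 1) // (B (r + 1) b).BothClosed} +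
            Cardinal.mk {b : ι r // (B r b).BothOpen} := by
  refine ⟨CircleValued.criticalValues_finite hf, fun m s t h hs => ?_⟩
  have hF := CircleValued.isFrame_of_isTame (κ := κ) hf h hs
  refine ⟨fun r => CircleValued.exists_hasInvariants.{v, u} h _ fun i hi =>
    hF.subsingleton_odd r hi, fun ι ι' B J hB => ?_⟩
  -- The odd vertex of index `0` carries the homology of the empty fiber over `t₁`.
  have hdec := fun r => CircleValued.HasInvariants.isEmpty_and_iso.{v, u} (hB r)
    (hF.subsingleton_odd r (i := ⟨0, hF.pos⟩) rfl)
  have e := fun r => (hdec r).2.some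
  have hturns := fun r => CircleValued.turns_eq_zero_of_iso.{v, u} (e r) h
    (i := ⟨0, hF.pos⟩) rfl (hF.subsingleton_odd r rfl)
  refine ⟨fun r => (hdec r).1, fun r => hF.betti_fiber (e r) (hturns r), ?_, fun r => ?_⟩
  · rw [hF.betti_zero]
    exact CircleValued.rank_coker_diff_eq.{v, u} (e 0) h (hturns 0)
  · rw [hF.betti_succ]
    exact congrArg₂ _ (CircleValued.rank_coker_diff_eq.{v, u} (e (r + 1)) h (hturns (r + 1)))
      (CircleValued.rank_ker_diff_eq.{v, u} (e r) h (hturns r))
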